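/- Let $T=U(1)$ be the circle, $\Lambda_T=\mathrm{Hom}(T,U(1))\cong\mathbb Z$ its character group ($l\in\mathbb Z$ corresponding to $t\mapsto t^l$), and $\Pi_T=\pi_0(\Omega T)\cong\mathbb Z$ with the discrete topology. Let $\kappa=\kappa^\tau:\Pi_T\to\Lambda_T$ be a nonzero homomorphism, and let $\tau$ be the $U(1)$-valued $2$-cocycle on $T\times\Pi_T$ given by $$\tau\bigl((t_1,m_1),(t_2,m_2)\bigr)=\kappa(m_1)(t_2).$$ For $n\in\mathbb Z$ let $n\tau$ be the $n$-th power of this cocycle, so that $\kappa^{n\tau}=n\kappa$. Let $(T\times\Pi_T)^\tau=T\times\Pi_T\times U(1)$ be the central extension with product $(\gamma_1,z_1)(\gamma_2,z_2)=(\gamma_1\gamma_2,z_1z_2\tau(\gamma_1,\gamma_2))$. For a second countable, locally compact, unimodular group $\Gamma$ and a normalized continuous $U(1)$-valued $2$-cocycle $\sigma$ on $\Gamma$, a $\sigma$-twisted unitary representation is a strongly continuous map $\rho$ from $\Gamma$ to the unitary group of a Hilbert space with $\rho(a)\rho(b)=\sigma(a,b)\rho(ab)$. The algebra $C^*(\Gamma,\sigma)$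 is the completion of $C_c(\Gamma)$, with the product $(f*g)(x)=\int f(y)g(y^{-1}x)\sigma(y,y^{-1}x)\,dy$ and the involution $f^*(x)=\overline{f(x^{-1})\sigma(x^{-1},x)}$, with respect to $\|f\|=\sup_\rho\|\pi_\rho(f)\|$, where $\rho$ runs over the $\sigma$-twisted unitary representations and $\pi_\rho(f)v=\int f(x)\rho(x)v\,dx$ (elements of norm zero being divided out); $C^*(\Gamma)=C^*(\Gamma,1)$. A direct sum of $C^*$-algebras consists of the families with norms tending to $0$, with the supremum norm. The group $K_0(A)$ of a $C^*$-algebra $A$ is the kernel of $K_0(A\oplus\mathbb C)\to K_0(\mathbb C)$, where $A\oplus\mathbb C$ is the unitization, and $K_0$ of a unital algebra is the Grothendieck group of Murray–von Neumann classes of projections in matrices over it. For a coset $[\lambda]\in\Lambda_T/\kappa^{n\tau}(\Pi_T)$ let $V_{[\lambda]}$ be the $n\tau$-twisted unitary representation on the Hilbert space with orthonormal basis $(e_\mu)_{\mu\in\lambda+\kappa^{n\tau}(\Pi_T)}$ given by $\rho(t,m)e_\mu=t^{\mu-\kappa^{n\tau}(m)}e_{\mu-\kappa^{n\tau}(m)}$.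 Let $R^\tau(T\times\Pi_T)$ be the Grothendieck group of the monoid, under direct sum, of unitary equivalence classes of $\tau$-twisted unitary representations of $T\times\Pi_T$ in which every weight of $T$ has finite multiplicity. Haar measure is normalized on $T$ and $U(1)$, and is counting measure on $\Pi_T$. Then the following hold. 1. There is a $*$-isomorphism $$C^*\bigl((T\times\Pi_T)^\tau\bigr)\cong\bigoplus_{n\in\mathbb Z}C^*(T\times\Pi_T,n\tau)$$ which maps (the class of) $f\in C_c((T\times\Pi_T)^\tau)$ to the family of (the classes of) the functions $f_n(\gamma)=\int_{U(1)}f(\gamma,z)z^n\,dz$. 2. For every $n\neq0$ there is a $*$-isomorphism $$C^*(T\times\Pi_T,n\tau)\cong\bigoplus_{[\lambda]\in\Lambda_T/\kappa^{n\tau}(\Pi_T)}\mathcal K(V_{[\lambda]})$$ which maps $f\in C_c(T\times\Pi_T)$ to the family of operators $\pi_{V_{[\lambda]}}(f)$; here $\mathcal K$ denotes the compact operators. 3. For $n=0$, $C^*(T\times\Pi_T,0)\cong C_0(\Pi_T\times T)$ as $C^*$-algebras. 4. There are isomorphisms of abelian groups $$K_0\bigl(C^*(T\times\Pi_T,\tau)\bigr)\cong\bigoplus_{\Lambda_T/\kappa^\tau(\Pi_T)}\mathbb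 Z\cong R^\tau(T\times\Pi_T),$$ the second of which maps the generator of the summand indexed by $[\lambda]$ to the class of $V_{[\lambda]}$. -/

import Mathlib

open MeasureTheory
open scoped CompactlySupported ENNReal InnerProductSpace ZeroAtInfty

set_option linter.unusedSectionVars false

noncomputable section

namespace TwistedCStar

/-! ### Cocycles, twisted unitary representations, central extensions -/

/-- A normalized continuous `U(1)`-valued `2`-cocycle on a topological group. -/
structure Cocycle (Γ : Type) [Group Γ] [TopologicalSpace Γ] where
  toFun : Γ → Γ → Circle
  continuous_toFun : Continuous (fun p : Γ × Γ => toFun p.1 p.2)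
  cocycle : ∀ a b c, toFun a b * toFun (a * b) c = toFun b c * toFun a (b * c)
  one_left : ∀ a, toFun 1 a = 1
  one_right : ∀ a, toFun a 1 = 1

section General

variable {Γ : Type} [Group Γ] [TopologicalSpace Γ]

instance : CoeFun (Cocycle Γ) (fun _ => Γ → Γ → Circle) := ⟨Cocycle.toFun⟩

/-- The trivial cocycle. -/
instance : One (Cocycle Γ) :=
  ⟨{ toFun := fun _ _ => 1
     continuous_toFun := continuous_const
     cocycle := fun _ _ _ => rfl
     one_left := fun _ => rfl
     one_right := fun _ => rfl }⟩

/-- A `σ`-twisted (strongly continuous) unitary representation of `Γ` on a complex Hilbert space: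
`ρ(a) ρ(b) = σ(a, b) ρ(ab)`. For `σ = 1` this is an ordinary unitary representation. Every cyclic
representation of a group in `Type` is equivalent to one on a Hilbert space in `Type`, so the
restriction to that universe does not change suprema of operator norms. -/
structure TwistedRep (σ : Cocycle Γ) where
  H : Type
  [normedAddCommGroup : NormedAddCommGroup H]
  [innerProductSpace : InnerProductSpace ℂ H]
  [completeSpace : CompleteSpace H]
  ρ : Γ → H ≃ₗᵢ[ℂ] H
  ρ_mul : ∀ a b v, ρ a (ρ b v) = (σ a b : ℂ) • ρ (a * b) v
  continuous_ρ : ∀ v, Continuous (fun a => ρ a v)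

attribute [instance] TwistedRep.normedAddCommGroup TwistedRep.innerProductSpace
  TwistedRep.completeSpace

theorem TwistedRep.ρ_one {σ : Cocycle Γ} (π : TwistedRep σ) (v : π.H) : π.ρ 1 v = v := by
  have h := π.ρ_mul 1 1 v
  rw [σ.one_left, mul_one] at h
  simpa using h

/-- The underlying space of the central extension `Γ^σ = Γ × U(1)`. -/
def CentralExt (_σ : Cocycle Γ) : Type := Γ × Circle

namespace CentralExt

variable (σ : Cocycle Γ)

instance : TopologicalSpace (CentralExt σ) := inferInstanceAs (TopologicalSpace (Γ × Circle))

instance : Mul (CentralExt σ) := ⟨fun x y => (x.1 * y.1, x.2 * y.2 * σ x.1 y.1)⟩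

instance : One (CentralExt σ) := ⟨((1 : Γ), (1 : Circle))⟩

instance : Inv (CentralExt σ) := ⟨fun x => (x.1⁻¹, x.2⁻¹ * (σ x.1⁻¹ x.1)⁻¹)⟩

theorem mul_def (x y : CentralExt σ) : x * y = (x.1 * y.1, x.2 * y.2 * σ x.1 y.1) := rfl

theorem one_def : (1 : CentralExt σ) = ((1 : Γ), (1 : Circle)) := rfl

theorem inv_def (x : CentralExt σ) : x⁻¹ = (x.1⁻¹, x.2⁻¹ * (σ x.1⁻¹ x.1)⁻¹) := rfl

/-- The group law `(a, z)(b, w) = (ab, zw σ(a, b))`. -/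
instance : Group (CentralExt σ) where
  mul_assoc x y z := by
    refine Prod.ext (mul_assoc _ _ _) ?_
    change x.2 * y.2 * σ x.1 y.1 * z.2 * σ (x.1 * y.1) z.1
      = x.2 * (y.2 * z.2 * σ y.1 z.1) * σ x.1 (y.1 * z.1)
    have h := σ.cocycle x.1 y.1 z.1
    calc _ = x.2 * y.2 * z.2 * (σ x.1 y.1 * σ (x.1 * y.1) z.1) := by ac_rfl
      _ = _ := by rw [h]; ac_rfl
  one_mul x := by
    refine Prod.ext (one_mul _) ?_
    change 1 * x.2 * σ 1 x.1 = x.2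
    rw [σ.one_left]; simp
  mul_one x := by
    refine Prod.ext (mul_one _) ?_
    change x.2 * 1 * σ x.1 1 = x.2
    rw [σ.one_right]; simp
  inv_mul_cancel x := by
    refine Prod.ext (inv_mul_cancel _) ?_
    change x.2⁻¹ * (σ x.1⁻¹ x.1)⁻¹ * x.2 * σ x.1⁻¹ x.1 = 1
    calc _ = (x.2⁻¹ * x.2) * ((σ x.1⁻¹ x.1)⁻¹ * σ x.1⁻¹ x.1) := by ac_rfl
      _ = 1 := by simp

instance [IsTopologicalGroup Γ] : IsTopologicalGroup (CentralExt σ) where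
  continuous_mul := by
    have hσ := σ.continuous_toFun
    change Continuous (fun p : (Γ × Circle) × (Γ × Circle) =>
      ((p.1.1 * p.2.1, p.1.2 * p.2.2 * σ p.1.1 p.2.1) : Γ × Circle))
    have h2 : Continuous (fun p : (Γ × Circle) × (Γ × Circle) => σ p.1.1 p.2.1) :=
      hσ.comp (by fun_prop : Continuous
        (fun p : (Γ × Circle) × (Γ × Circle) => ((p.1.1, p.2.1) : Γ × Γ)))
    fun_prop
  continuous_inv := by
    have hσ := σ.continuous_toFun
    change Continuous (fun p : Γ × Circle =>
      ((p.1⁻¹, p.2⁻¹ * (σ p.1⁻¹ p.1)⁻¹) : Γ × Circle))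
    have h2 : Continuous (fun p : Γ × Circle => σ p.1⁻¹ p.1) :=
      hσ.comp (by fun_prop : Continuous (fun p : Γ × Circle => ((p.1⁻¹, p.1) : Γ × Γ)))
    fun_prop

instance [LocallyCompactSpace Γ] : LocallyCompactSpace (CentralExt σ) :=
  inferInstanceAs (LocallyCompactSpace (Γ × Circle))

instance [SecondCountableTopology Γ] : SecondCountableTopology (CentralExt σ) :=
  inferInstanceAs (SecondCountableTopology (Γ × Circle))

end CentralExt

end General

/-! ### Haar measures -/

instance instMeasurableSpaceCircle : MeasurableSpace Circle := borel Circle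

instance instBorelSpaceCircle : BorelSpace Circle := ⟨rfl⟩

/-- The Haar measure of total mass one on the circle. -/
def circleHaar : Measure Circle := Measure.haarMeasure ⊤

instance : circleHaar.IsHaarMeasure := by unfold circleHaar; infer_instance

instance : IsProbabilityMeasure circleHaar := ⟨Measure.haarMeasure_self⟩

instance : circleHaar.IsInvInvariant := by unfold circleHaar; infer_instance

section ExtMeasure

variable {Γ : Type} [Group Γ] [TopologicalSpace Γ] [IsTopologicalGroup Γ]
  [SecondCountableTopology Γ] [MeasurableSpace Γ] [BorelSpace Γ]
  (σ : Cocycle Γ) (μ : Measure Γ)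

instance : MeasurableSpace (CentralExt σ) := inferInstanceAs (MeasurableSpace (Γ × Circle))

instance : BorelSpace (CentralExt σ) := inferInstanceAs (BorelSpace (Γ × Circle))

/-- The product of a Haar measure on `Γ` with the normalized Haar measure on `U(1)`, seen as a
measure on the central extension. -/
def CentralExt.measure : Measure (CentralExt σ) := μ.prod circleHaar

variable [μ.IsHaarMeasure] [SigmaFinite μ]

theorem measurable_cocycle : Measurable (fun p : Γ × Γ => σ p.1 p.2) :=
  σ.continuous_toFun.measurable

instance : (CentralExt.measure σ μ).IsMulLeftInvariant where
  map_mul_left_eq_self x := by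
    have h1 : MeasurePreserving (fun a : Γ => x.1 * a) μ μ := measurePreserving_mul_left μ x.1
    have h2 : Measurable (Function.uncurry fun (a : Γ) (z : Circle) => x.2 * z * σ x.1 a) := by
      have : Measurable (fun a : Γ => σ x.1 a) :=
        (measurable_cocycle σ).comp (measurable_const.prodMk measurable_id)
      exact (measurable_snd.const_mul x.2).mul (this.comp measurable_fst)
    refine (h1.skew_product (μd := circleHaar) h2 (Filter.Eventually.of_forall fun a => ?_)).map_eq
    have : (fun z : Circle => x.2 * z * σ x.1 a) = fun z => (x.2 * σ x.1 a) * z := by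
      funext z; ac_rfl
    rw [this]
    exact map_mul_left_eq_self circleHaar _

instance : (CentralExt.measure σ μ).IsHaarMeasure where
  lt_top_of_isCompact {_K} hK :=
    haveI : IsFiniteMeasureOnCompacts (μ.prod circleHaar) := inferInstance
    this.lt_top_of_isCompact hK
  open_pos U hU hne :=
    haveI : (μ.prod circleHaar).IsOpenPosMeasure := inferInstance
    this.open_pos U hU hne

instance [μ.IsInvInvariant] : (CentralExt.measure σ μ).IsInvInvariant where
  inv_eq_self := by
    have h1 : MeasurePreserving (fun a : Γ => a⁻¹) μ μ := Measure.measurePreserving_inv μ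
    have h2 : Measurable
        (Function.uncurry fun (a : Γ) (z : Circle) => z⁻¹ * (σ a⁻¹ a)⁻¹) := by
      have : Measurable (fun a : Γ => σ a⁻¹ a) :=
        (measurable_cocycle σ).comp (measurable_inv.prodMk measurable_id)
      exact measurable_snd.inv.mul (this.comp measurable_fst).inv
    refine (h1.skew_product (μd := circleHaar) h2 (Filter.Eventually.of_forall fun a => ?_)).map_eq
    have : (fun z : Circle => z⁻¹ * (σ a⁻¹ a)⁻¹) = (fun z => (σ a⁻¹ a)⁻¹ * z) ∘ Inv.inv := by
      funext z; simp [mul_comm]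
    rw [this, ← Measure.map_map (by fun_prop) (by fun_prop), Measure.map_inv_eq_self,
      map_mul_left_eq_self]

end ExtMeasure

/-! ### The twisted convolution algebra and its universal completion -/

section Convolution

variable {Γ : Type} [Group Γ] [TopologicalSpace Γ] [IsTopologicalGroup Γ]
  [LocallyCompactSpace Γ] [SecondCountableTopology Γ] [MeasurableSpace Γ] [BorelSpace Γ]
  (σ : Cocycle Γ) (μ : Measure Γ) [μ.IsHaarMeasure] [μ.IsInvInvariant]

theorem continuous_convIntegrand (f g : C_c(Γ, ℂ)) :
    Continuous (Function.uncurry fun x y : Γ => f y * g (y⁻¹ * x) * (σ y (y⁻¹ * x) : ℂ)) := by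
  have h1 : Continuous (fun p : Γ × Γ => σ p.2 (p.2⁻¹ * p.1)) :=
    σ.continuous_toFun.comp (by fun_prop : Continuous
      (fun p : Γ × Γ => ((p.2, p.2⁻¹ * p.1) : Γ × Γ)))
  have h2 : Continuous (fun p : Γ × Γ => (σ p.2 (p.2⁻¹ * p.1) : ℂ)) :=
    continuous_subtype_val.comp h1
  have hf : Continuous (fun p : Γ × Γ => f p.2) := f.continuous.comp continuous_snd
  have hg : Continuous (fun p : Γ × Γ => g (p.2⁻¹ * p.1)) := g.continuous.comp (by fun_prop)
  exact (hf.mul hg).mul h2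

/-- The twisted convolution
`(f *_σ g)(x) = ∫ f(y) g(y⁻¹ x) σ(y, y⁻¹ x) dy` on `C_c(Γ)`. -/
def conv (f g : C_c(Γ, ℂ)) : C_c(Γ, ℂ) where
  toFun x := ∫ y, f y * g (y⁻¹ * x) * (σ y (y⁻¹ * x) : ℂ) ∂μ
  continuous_toFun := by
    have h := continuous_parametric_integral_of_continuous (μ := μ)
      (continuous_convIntegrand σ f g) (s := tsupport f) f.hasCompactSupport
    convert h using 2 with x
    refine (setIntegral_eq_integral_of_forall_compl_eq_zero fun y hy => ?_).symm
    rw [image_eq_zero_of_notMem_tsupport hy, zero_mul, zero_mul]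
  hasCompactSupport' := by
    refine HasCompactSupport.intro (f.hasCompactSupport.isCompact.mul
      g.hasCompactSupport.isCompact) fun x hx => ?_
    refine (integral_congr_ae (Filter.Eventually.of_forall fun y => ?_)).trans
      (integral_zero Γ ℂ)
    by_cases hy : y ∈ tsupport f
    · have : y⁻¹ * x ∉ tsupport g := fun h => hx ⟨y, hy, _, h, by simp⟩
      simp [image_eq_zero_of_notMem_tsupport this]
    · simp [image_eq_zero_of_notMem_tsupport hy]

/-- The twisted involution `f^*(x) = conj (f(x⁻¹)) conj (σ(x⁻¹, x))` on `C_c(Γ)`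
(for unimodular `Γ`). -/
def invol (f : C_c(Γ, ℂ)) : C_c(Γ, ℂ) where
  toFun x := starRingEnd ℂ (f x⁻¹) * starRingEnd ℂ (σ x⁻¹ x : ℂ)
  continuous_toFun := by
    have h1 : Continuous (fun x : Γ => σ x⁻¹ x) :=
      σ.continuous_toFun.comp (by fun_prop : Continuous (fun x : Γ => ((x⁻¹, x) : Γ × Γ)))
    have h2 : Continuous (fun x : Γ => (σ x⁻¹ x : ℂ)) := continuous_subtype_val.comp h1
    have h3 : Continuous (fun x : Γ => f x⁻¹) := f.continuous.comp continuous_inv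
    exact (Complex.continuous_conj.comp h3).mul (Complex.continuous_conj.comp h2)
  hasCompactSupport' := by
    refine HasCompactSupport.intro f.hasCompactSupport.isCompact.inv fun x hx => ?_
    rw [Set.mem_inv] at hx
    rw [image_eq_zero_of_notMem_tsupport hx, map_zero, zero_mul]

variable {σ}

namespace TwistedRep

variable (π : TwistedRep σ)

theorem continuous_smul_ρ (f : C_c(Γ, ℂ)) (v : π.H) : Continuous (fun x => f x • π.ρ x v) :=
  f.continuous.smul (π.continuous_ρ v)

theorem hasCompactSupport_smul_ρ (f : C_c(Γ, ℂ)) (v : π.H) :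
    HasCompactSupport (fun x => f x • π.ρ x v) :=
  f.hasCompactSupport.smul_right

theorem integrable_smul_ρ (f : C_c(Γ, ℂ)) (v : π.H) :
    Integrable (fun x => f x • π.ρ x v) μ :=
  (π.continuous_smul_ρ f v).integrable_of_hasCompactSupport (π.hasCompactSupport_smul_ρ f v)

/-- The integrated form `π(f) v = ∫ f(x) ρ(x) v dx` of a twisted representation. -/
def integrated (f : C_c(Γ, ℂ)) : π.H →L[ℂ] π.H :=
  LinearMap.mkContinuous
    { toFun := fun v => ∫ x, f x • π.ρ x v ∂μ
      map_add' := fun v w => by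
        rw [← integral_add (π.integrable_smul_ρ μ f v) (π.integrable_smul_ρ μ f w)]
        simp
      map_smul' := fun c v => by
        rw [RingHom.id_apply, ← integral_smul]
        refine integral_congr_ae (Filter.Eventually.of_forall fun x => ?_)
        change f x • π.ρ x (c • v) = c • f x • π.ρ x v
        rw [map_smul, smul_comm] }
    (∫ x, ‖f x‖ ∂μ) fun v => by
      refine (norm_integral_le_integral_norm _).trans (le_of_eq ?_)
      rw [← integral_mul_const]
      refine integral_congr_ae (Filter.Eventually.of_forall fun x => ?_)
      simp [norm_smul]

theorem integrated_apply (f : C_c(Γ, ℂ)) (v : π.H) :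
    π.integrated μ f v = ∫ x, f x • π.ρ x v ∂μ := rfl

theorem norm_integrated_le (f : C_c(Γ, ℂ)) : ‖π.integrated μ f‖ ≤ ∫ x, ‖f x‖ ∂μ :=
  LinearMap.mkContinuous_norm_le _ (integral_nonneg fun _ => norm_nonneg _) _

theorem integrated_add (f g : C_c(Γ, ℂ)) :
    π.integrated μ (f + g) = π.integrated μ f + π.integrated μ g := by
  ext v
  change _ = π.integrated μ f v + π.integrated μ g v
  simp only [integrated_apply]
  rw [← integral_add (π.integrable_smul_ρ μ f v) (π.integrable_smul_ρ μ g v)]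
  simp [add_smul]

theorem integrated_smul (c : ℂ) (f : C_c(Γ, ℂ)) :
    π.integrated μ (c • f) = c • π.integrated μ f := by
  ext v
  change _ = c • π.integrated μ f v
  simp only [integrated_apply]
  rw [← integral_smul]
  simp [mul_smul]

/-- The integrated form turns twisted convolution into composition of operators. -/
theorem integrated_conv (f g : C_c(Γ, ℂ)) :
    π.integrated μ (conv σ μ f g) = π.integrated μ f * π.integrated μ g := by
  ext v
  change _ = π.integrated μ f (π.integrated μ g v)
  simp only [integrated_apply]
  have hF : Continuous (Function.uncurry fun x y : Γ =>
      (f y * g (y⁻¹ * x) * (σ y (y⁻¹ * x) : ℂ)) • π.ρ x v) :=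
    (continuous_convIntegrand σ f g).smul ((π.continuous_ρ v).comp continuous_fst)
  have hcs : HasCompactSupport (Function.uncurry fun x y : Γ =>
      (f y * g (y⁻¹ * x) * (σ y (y⁻¹ * x) : ℂ)) • π.ρ x v) := by
    refine HasCompactSupport.intro ((f.hasCompactSupport.isCompact.mul
      g.hasCompactSupport.isCompact).prod f.hasCompactSupport.isCompact) fun p hp => ?_
    obtain ⟨x, y⟩ := p
    change (f y * g (y⁻¹ * x) * (σ y (y⁻¹ * x) : ℂ)) • π.ρ x v = 0
    by_cases hy : y ∈ tsupport f
    · have : y⁻¹ * x ∉ tsupport g := fun h => hp ⟨⟨y, hy, _, h, by simp⟩, hy⟩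
      simp [image_eq_zero_of_notMem_tsupport this]
    · simp [image_eq_zero_of_notMem_tsupport hy]
  calc ∫ x, conv σ μ f g x • π.ρ x v ∂μ
      = ∫ x, ∫ y, (f y * g (y⁻¹ * x) * (σ y (y⁻¹ * x) : ℂ)) • π.ρ x v ∂μ ∂μ := by
        refine integral_congr_ae (Filter.Eventually.of_forall fun x => ?_)
        exact (integral_smul_const _ _).symm
    _ = ∫ y, ∫ x, (f y * g (y⁻¹ * x) * (σ y (y⁻¹ * x) : ℂ)) • π.ρ x v ∂μ ∂μ :=
        integral_integral_swap_of_hasCompactSupport hF hcs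
    _ = ∫ y, f y • π.ρ y (∫ x, g x • π.ρ x v ∂μ) ∂μ := by
        refine integral_congr_ae (Filter.Eventually.of_forall fun y => ?_)
        change ∫ x, (f y * g (y⁻¹ * x) * (σ y (y⁻¹ * x) : ℂ)) • π.ρ x v ∂μ = _
        rw [← integral_mul_left_eq_self _ y]
        have h1 : π.ρ y (∫ x, g x • π.ρ x v ∂μ) = ∫ x, π.ρ y (g x • π.ρ x v) ∂μ :=
          ((π.ρ y).toContinuousLinearEquiv.toContinuousLinearMap.integral_comp_comm
            (π.integrable_smul_ρ μ g v)).symm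
        refine Eq.trans ?_ (congrArg (fun w => f y • w) h1.symm)
        refine Eq.trans ?_ (integral_smul (f y) _)
        refine integral_congr_ae (Filter.Eventually.of_forall fun x => ?_)
        change (f y * g (y⁻¹ * (y * x)) * (σ y (y⁻¹ * (y * x)) : ℂ)) • π.ρ (y * x) v
          = f y • π.ρ y (g x • π.ρ x v)
        rw [map_smul, π.ρ_mul, inv_mul_cancel_left, mul_smul, mul_smul]

theorem adjoint_ρ (x : Γ) (v w : π.H) :
    ⟪v, π.ρ x w⟫_ℂ = ⟪starRingEnd ℂ (σ x x⁻¹ : ℂ) • π.ρ x⁻¹ v, w⟫_ℂ := by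
  rw [← (π.ρ x).inner_map_map (starRingEnd ℂ (σ x x⁻¹ : ℂ) • π.ρ x⁻¹ v) w, map_smul, π.ρ_mul,
    mul_inv_cancel, π.ρ_one, smul_smul]
  have : starRingEnd ℂ (σ x x⁻¹ : ℂ) * (σ x x⁻¹ : ℂ) = 1 := by
    rw [mul_comm, Complex.mul_conj]; simp
  rw [this, one_smul]

/-- The integrated form turns the twisted involution into the adjoint. -/
theorem integrated_invol (f : C_c(Γ, ℂ)) :
    π.integrated μ (invol σ f) = star (π.integrated μ f) := by
  rw [ContinuousLinearMap.star_eq_adjoint, ContinuousLinearMap.eq_adjoint_iff]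
  intro v w
  simp only [integrated_apply]
  rw [← integral_inner (π.integrable_smul_ρ μ f w), ← inner_conj_symm,
    ← integral_inner (π.integrable_smul_ρ μ (invol σ f) v), ← integral_conj,
    ← integral_inv_eq_self _ μ]
  refine integral_congr_ae (Filter.Eventually.of_forall fun x => ?_)
  change starRingEnd ℂ ⟪w, (starRingEnd ℂ (f x⁻¹⁻¹) * starRingEnd ℂ (σ x⁻¹⁻¹ x⁻¹ : ℂ)) •
    π.ρ x⁻¹ v⟫_ℂ = ⟪v, f x • π.ρ x w⟫_ℂ
  rw [inner_conj_symm, inv_inv, inner_smul_right, π.adjoint_ρ, mul_smul, inner_smul_left, Complex.conj_conj]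

end TwistedRep

instance instNonUnitalCStarAlgebraLp {ι : Type*} (A : ι → Type*) [∀ i, NonUnitalCStarAlgebra (A i)] :
    NonUnitalCStarAlgebra (lp A ∞) where

variable (σ)

/-- The universal representation `f ↦ (π(f))_π` of `C_c(Γ)`, with values in bounded families of
operators indexed by all `σ`-twisted unitary representations `π`. Its norm is
`‖f‖ = sup_π ‖π(f)‖`. -/
def universal (f : C_c(Γ, ℂ)) : lp (fun π : TwistedRep σ => π.H →L[ℂ] π.H) ∞ :=
  ⟨fun π => π.integrated μ f, memℓp_infty ⟨∫ x, ‖f x‖ ∂μ, by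
    rintro _ ⟨π, rfl⟩
    exact π.norm_integrated_le μ f⟩⟩

/-- The image of the twisted convolution algebra `(C_c(Γ), *_σ)` under the universal
representation. -/
def convAlgebra :
    NonUnitalStarSubalgebra ℂ (lp (fun π : TwistedRep σ => π.H →L[ℂ] π.H) ∞) where
  carrier := Set.range (universal σ μ)
  add_mem' := by
    rintro _ _ ⟨f, rfl⟩ ⟨g, rfl⟩
    exact ⟨f + g, Subtype.ext (funext fun π => π.integrated_add μ f g)⟩
  zero_mem' := ⟨0, Subtype.ext (funext fun π => by
    have := π.integrated_smul μ 0 0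
    rw [zero_smul, zero_smul] at this
    exact this)⟩
  mul_mem' := by
    rintro _ _ ⟨f, rfl⟩ ⟨g, rfl⟩
    exact ⟨conv σ μ f g, Subtype.ext (funext fun π => π.integrated_conv μ f g)⟩
  smul_mem' := by
    rintro c _ ⟨f, rfl⟩
    exact ⟨c • f, Subtype.ext (funext fun π => π.integrated_smul μ c f)⟩
  star_mem' := by
    rintro _ ⟨f, rfl⟩
    exact ⟨invol σ f, Subtype.ext (funext fun π => π.integrated_invol μ f)⟩

/-- The closure of `convAlgebra σ μ`, i.e. its completion in the norm `‖f‖ = sup_π ‖π(f)‖`. -/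
def groupCStarSubalgebra :
    NonUnitalStarSubalgebra ℂ (lp (fun π : TwistedRep σ => π.H →L[ℂ] π.H) ∞) :=
  (convAlgebra σ μ).topologicalClosure

/-- The twisted group `C^*`-algebra `C^*(Γ, σ)`: the completion of the twisted convolution algebra
`C_c(Γ)` in the norm `‖f‖ = sup_π ‖π(f)‖`, `π` running over the `σ`-twisted unitary
representations of `Γ`. For `σ = 1` it is the group `C^*`-algebra `C^*(Γ)`. -/
def GroupCStar : Type 1 := groupCStarSubalgebra σ μ

instance : NonUnitalCStarAlgebra (GroupCStar σ μ) :=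
  haveI : IsClosed (groupCStarSubalgebra σ μ :
      Set (lp (fun π : TwistedRep σ => π.H →L[ℂ] π.H) ∞)) :=
    (convAlgebra σ μ).isClosed_topologicalClosure
  inferInstanceAs (NonUnitalCStarAlgebra (groupCStarSubalgebra σ μ))

/-- The canonical map `C_c(Γ) → C^*(Γ, σ)`. -/
def toCStar (f : C_c(Γ, ℂ)) : GroupCStar σ μ :=
  ⟨universal σ μ f, (convAlgebra σ μ).le_topologicalClosure ⟨f, rfl⟩⟩

/-- The `n`-th weight component `f_n(x) = ∫ f(x, z) z^n dz` of a function on the central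
extension. -/
def component (n : ℤ) (f : C_c(CentralExt σ, ℂ)) : C_c(Γ, ℂ) where
  toFun x := ∫ z, f ((x, z) : Γ × Circle) * ((z ^ n : Circle) : ℂ) ∂circleHaar
  continuous_toFun := by
    have hF : Continuous (Function.uncurry fun (x : Γ) (z : Circle) =>
        f ((x, z) : Γ × Circle) * ((z ^ n : Circle) : ℂ)) := by
      have h1 : Continuous (fun p : Γ × Circle => f (p : Γ × Circle)) := f.continuous
      have h2 : Continuous (fun p : Γ × Circle => p.2 ^ n) := continuous_snd.zpow n
      have h3 : Continuous (fun p : Γ × Circle => ((p.2 ^ n : Circle) : ℂ)) :=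
        continuous_subtype_val.comp h2
      exact h1.mul h3
    have h := continuous_parametric_integral_of_continuous (μ := circleHaar) hF isCompact_univ
    simpa using h
  hasCompactSupport' := by
    have hK : IsCompact (Prod.fst '' (tsupport f : Set (Γ × Circle))) :=
      IsCompact.image (X := Γ × Circle) f.hasCompactSupport continuous_fst
    refine HasCompactSupport.intro hK fun x hx => ?_
    refine (integral_congr_ae (Filter.Eventually.of_forall fun z => ?_)).trans
      (integral_zero Circle ℂ)
    have : (((x, z) : Γ × Circle) : CentralExt σ) ∉ tsupport f :=
      fun h => hx ⟨(x, z), h, rfl⟩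
    change f ((x, z) : Γ × Circle) * _ = 0
    rw [image_eq_zero_of_notMem_tsupport this, zero_mul]

end Convolution

/-! ### `c₀`-direct sums of `C^*`-algebras and algebras of compact operators -/

section Sums

variable {ι : Type*} (A : ι → Type*) [∀ i, NonUnitalCStarAlgebra (A i)]

/-- The bounded families `x` with `‖x i‖ → 0` along the cofinite filter. -/
def c0Subalgebra : NonUnitalStarSubalgebra ℂ (lp A ∞) where
  carrier := {x | Filter.Tendsto (fun i => ‖x i‖) Filter.cofinite (nhds 0)}
  add_mem' := fun {x y} hx hy => by
    have h := Filter.Tendsto.add hx hy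
    rw [add_zero] at h
    exact squeeze_zero (fun _ => norm_nonneg _) (fun i => norm_add_le (x i) (y i)) h
  zero_mem' := by
    change Filter.Tendsto (fun i => ‖(0 : A i)‖) Filter.cofinite (nhds 0)
    simpa using tendsto_const_nhds
  mul_mem' := fun {x y} hx hy => by
    have h := Filter.Tendsto.mul hx hy
    rw [mul_zero] at h
    exact squeeze_zero (fun _ => norm_nonneg _) (fun i => norm_mul_le (x i) (y i)) h
  smul_mem' := fun c x hx => by
    have h := Filter.Tendsto.const_mul ‖c‖ hx
    rw [mul_zero] at h
    exact squeeze_zero (fun _ => norm_nonneg _) (fun i => norm_smul_le c (x i)) h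
  star_mem' := fun {x} hx => by
    refine Filter.Tendsto.congr (fun i => ?_) hx
    exact (norm_star (x i)).symm

theorem isClosed_c0Subalgebra : IsClosed (c0Subalgebra A : Set (lp A ∞)) := by
  refine isClosed_of_closure_subset fun x hx => ?_
  change Filter.Tendsto (fun i => ‖x i‖) Filter.cofinite (nhds 0)
  rw [Metric.tendsto_nhds]
  intro ε hε
  obtain ⟨y, hy, hxy⟩ := Metric.mem_closure_iff.1 hx (ε / 2) (half_pos hε)
  have hy' : Filter.Tendsto (fun i => ‖y i‖) Filter.cofinite (nhds 0) := hy
  filter_upwards [Metric.tendsto_nhds.1 hy' (ε / 2) (half_pos hε)] with i hi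
  rw [Real.dist_0_eq_abs, abs_of_nonneg (norm_nonneg _)] at hi ⊢
  have h1 : ‖x i - y i‖ ≤ ‖x - y‖ := lp.norm_apply_le_norm ENNReal.top_ne_zero (x - y) i
  rw [dist_eq_norm] at hxy
  have h2 : ‖x i‖ ≤ ‖x i - y i‖ + ‖y i‖ := by
    simpa using norm_add_le (x i - y i) (y i)
  linarith

/-- The direct sum of a family of `C^*`-algebras: the families `x` with `‖x i‖ → 0` along the
cofinite filter, with the supremum norm. -/
def C0Sum : Type _ := c0Subalgebra A

instance : NonUnitalCStarAlgebra (C0Sum A) :=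
  haveI : IsClosed (c0Subalgebra A : Set (lp A ∞)) := isClosed_c0Subalgebra A
  inferInstanceAs (NonUnitalCStarAlgebra (c0Subalgebra A))

variable {A} in
/-- The `i`-th component of an element of a direct sum of `C^*`-algebras. -/
def C0Sum.proj (i : ι) (x : C0Sum A) : A i := (show c0Subalgebra A from x).1 i

end Sums

section Compact

variable (H : Type*) [NormedAddCommGroup H] [InnerProductSpace ℂ H] [CompleteSpace H]

theorem isCompactOperator_star {T : H →L[ℂ] H} (hT : IsCompactOperator T) :
    IsCompactOperator (star T : H →L[ℂ] H) := by
  -- `‖T^* x - T^* y‖² ≤ ‖x - y‖ ‖T T^* (x - y)‖` and `T T^*` is compact.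
  have hS : IsCompactOperator (T * star T : H →L[ℂ] H) := IsCompactOperator.comp_clm hT (star T)
  have key : ∀ x y : H, ‖star T x - star T y‖ ^ 2 ≤
      ‖x - y‖ * ‖(T * star T) x - (T * star T) y‖ := by
    intro x y
    have h1 : ‖star T (x - y)‖ ^ 2 = RCLike.re ⟪x - y, (T * star T) (x - y)⟫_ℂ := by
      rw [← inner_self_eq_norm_sq (𝕜 := ℂ), ContinuousLinearMap.star_eq_adjoint,
        ContinuousLinearMap.adjoint_inner_left]
      rfl
    rw [← map_sub, ← map_sub, h1]
    exact (RCLike.re_le_norm _).trans (norm_inner_le_norm _ _)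
  refine (isCompactOperator_iff_isCompact_closure_image_closedBall
    ((star T : H →L[ℂ] H) : H →ₗ[ℂ] H) one_pos).2 ?_
  have htb : TotallyBounded ((T * star T : H →L[ℂ] H) '' Metric.closedBall 0 1) :=
    ((isCompactOperator_iff_isCompact_closure_image_closedBall
      ((T * star T : H →L[ℂ] H) : H →ₗ[ℂ] H) one_pos).1 hS).totallyBounded.subset subset_closure
  refine TotallyBounded.isCompact_of_isClosed (TotallyBounded.closure ?_) isClosed_closure
  rw [Metric.totallyBounded_iff]
  intro ε hε
  obtain ⟨t, hts, htf, htc⟩ := Metric.finite_approx_of_totallyBounded htb (ε ^ 2 / 4) (by positivity)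
  have hts' : ∀ y, y ∈ t → ∃ x, x ∈ Metric.closedBall (0 : H) 1 ∧ (T * star T) x = y :=
    fun y hy => hts hy
  choose! g hg1 hg2 using hts'
  refine ⟨(fun y => star T (g y)) '' t, htf.image _, ?_⟩
  rintro _ ⟨x, hx, rfl⟩
  obtain ⟨y, hy, hxy⟩ := Set.mem_iUnion₂.1 (htc ⟨x, hx, rfl⟩)
  refine Set.mem_iUnion₂.2 ⟨_, ⟨y, hy, rfl⟩, ?_⟩
  have hgy : ‖g y‖ ≤ 1 := by simpa using hg1 y hy
  have hx1 : ‖x‖ ≤ 1 := by simpa using hx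
  have h2 : ‖x - g y‖ ≤ 2 := (norm_sub_le _ _).trans (by linarith)
  have h3 : ‖(T * star T) x - (T * star T) (g y)‖ ≤ ε ^ 2 / 4 := by
    have h4 : (T * star T) (g y) = y := hg2 y hy
    rw [h4, ← dist_eq_norm]
    exact (Metric.mem_ball.1 hxy).le
  have h5 : ‖star T x - star T (g y)‖ ^ 2 ≤ 2 * (ε ^ 2 / 4) :=
    (key x (g y)).trans (mul_le_mul h2 h3 (norm_nonneg _) (by norm_num))
  change dist (star T x) (star T (g y)) < ε
  rw [dist_eq_norm]
  exact lt_of_pow_lt_pow_left₀ 2 hε.le (by nlinarith [pow_pos hε 2])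

/-- The compact operators, as a `*`-subalgebra of the bounded operators. -/
def compactSubalgebra : NonUnitalStarSubalgebra ℂ (H →L[ℂ] H) where
  carrier := {T | IsCompactOperator T}
  add_mem' := fun hx hy => IsCompactOperator.add hx hy
  zero_mem' := isCompactOperator_zero
  mul_mem' := fun {_ y} hx _ => IsCompactOperator.comp_clm hx y
  smul_mem' := fun c _ hx => IsCompactOperator.smul hx c
  star_mem' := fun hx => isCompactOperator_star H hx

/-- The `C^*`-algebra `𝒦(H)` of compact operators on a Hilbert space. -/
def CompactOps : Type _ := compactSubalgebra H

instance : NonUnitalCStarAlgebra (CompactOps H) :=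
  haveI : IsClosed (compactSubalgebra H : Set (H →L[ℂ] H)) := isClosed_setOfPred_isCompactOperator
  inferInstanceAs (NonUnitalCStarAlgebra (compactSubalgebra H))

variable {H} in
/-- The bounded operator underlying an element of `𝒦(H)`. -/
def CompactOps.toCLM (T : CompactOps H) : H →L[ℂ] H := (show compactSubalgebra H from T).1

end Compact

/-! ### `K_0` of a (possibly non-unital) `C^*`-algebra -/

section KTheory

/-- A projection in `M_n(R)` for some `n`. -/
structure MatProj (R : Type*) [Ring R] [StarRing R] where
  n : ℕ
  p : Matrix (Fin n) (Fin n) R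
  star_eq : p.conjTranspose = p
  idem : p * p = p

namespace MatProj

variable {R : Type*} [Ring R] [StarRing R]

/-- Murray–von Neumann equivalence: `p = v^* v` and `q = v v^*` for a rectangular matrix `v`. -/
def MvN (p q : MatProj R) : Prop :=
  ∃ v : Matrix (Fin q.n) (Fin p.n) R, v.conjTranspose * v = p.p ∧ v * v.conjTranspose = q.p

/-- The block sum `p ⊕ q`. -/
def add (p q : MatProj R) : MatProj R where
  n := p.n + q.n
  p := (Matrix.fromBlocks p.p 0 0 q.p).submatrix finSumFinEquiv.symm finSumFinEquiv.symm
  star_eq := by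
    rw [Matrix.conjTranspose_submatrix, Matrix.fromBlocks_conjTranspose]
    simp [p.star_eq, q.star_eq]
  idem := by
    rw [Matrix.submatrix_mul_equiv, Matrix.fromBlocks_multiply]
    simp [p.idem, q.idem]

/-- The zero projection of size `0`. -/
def zero : MatProj R := ⟨0, 0, by simp, by simp⟩

instance setoid (R : Type*) [Ring R] [StarRing R] : Setoid (MatProj R) where
  r := MvN
  iseqv :=
    { refl := fun p => ⟨p.p, by rw [p.star_eq, p.idem], by rw [p.star_eq, p.idem]⟩
      symm := fun ⟨v, h1, h2⟩ => ⟨v.conjTranspose, by simpa using h2, by simpa using h1⟩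
      trans := by
        rintro p q r ⟨v, h1, h2⟩ ⟨w, h3, h4⟩
        refine ⟨w * v, ?_, ?_⟩
        · rw [Matrix.conjTranspose_mul, Matrix.mul_assoc, ← Matrix.mul_assoc _ w v, h3, ← h2,
            Matrix.mul_assoc, h1, ← Matrix.mul_assoc, h1, p.idem]
        · rw [Matrix.conjTranspose_mul, Matrix.mul_assoc, ← Matrix.mul_assoc v, h2, ← h3,
            Matrix.mul_assoc, h4, ← Matrix.mul_assoc, h4, r.idem] }

/-- Blockwise description of Murray–von Neumann equivalence through an arbitrary finite index. -/
theorem equiv_of {p q : MatProj R} {m n : Type} [Fintype m] [Fintype n]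
    (e : m ≃ Fin p.n) (f : n ≃ Fin q.n) (v : Matrix n m R)
    (h1 : v.conjTranspose * v = p.p.submatrix e e) (h2 : v * v.conjTranspose = q.p.submatrix f f) :
    MvN p q := by
  refine ⟨v.submatrix f.symm e.symm, ?_, ?_⟩
  · rw [Matrix.conjTranspose_submatrix, Matrix.submatrix_mul_equiv, h1]; simp
  · rw [Matrix.conjTranspose_submatrix, Matrix.submatrix_mul_equiv, h2]; simp

/-- The index set of a block sum. -/
def addIndex (p q : MatProj R) : Fin p.n ⊕ Fin q.n ≃ Fin (p.add q).n := finSumFinEquiv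

theorem add_p_addIndex (p q : MatProj R) (i j : Fin p.n ⊕ Fin q.n) :
    (p.add q).p (addIndex p q i) (addIndex p q j) = Matrix.fromBlocks p.p 0 0 q.p i j := by
  change Matrix.fromBlocks p.p 0 0 q.p (finSumFinEquiv.symm (finSumFinEquiv i))
    (finSumFinEquiv.symm (finSumFinEquiv j)) = _
  rw [Equiv.symm_apply_apply, Equiv.symm_apply_apply]

theorem add_p_submatrix (p q : MatProj R) :
    (p.add q).p.submatrix (addIndex p q) (addIndex p q) = Matrix.fromBlocks p.p 0 0 q.p := by
  ext i j
  exact add_p_addIndex p q i j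

theorem add_equiv {p p' q q' : MatProj R} (h : MvN p p') (k : MvN q q') :
    MvN (p.add q) (p'.add q') := by
  obtain ⟨v, h1, h2⟩ := h
  obtain ⟨w, k1, k2⟩ := k
  refine equiv_of (addIndex p q) (addIndex p' q') (Matrix.fromBlocks v 0 0 w) ?_ ?_
  · rw [add_p_submatrix]
    simp [Matrix.fromBlocks_conjTranspose, Matrix.fromBlocks_multiply, h1, k1]
  · rw [add_p_submatrix]
    simp [Matrix.fromBlocks_conjTranspose, Matrix.fromBlocks_multiply, h2, k2]

theorem equiv_of_reindex {p q : MatProj R} {m : Type} [Fintype m]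
    (e : m ≃ Fin p.n) (f : m ≃ Fin q.n) (h : ∀ i j, p.p (e i) (e j) = q.p (f i) (f j)) :
    MvN p q := by
  have h' : p.p.submatrix e e = q.p.submatrix f f := by ext i j; exact h i j
  refine equiv_of e f (p.p.submatrix e e) ?_ ?_
  · rw [Matrix.conjTranspose_submatrix, p.star_eq, Matrix.submatrix_mul_equiv, p.idem]
  · rw [← h', Matrix.conjTranspose_submatrix, p.star_eq, Matrix.submatrix_mul_equiv, p.idem]

theorem zero_add_equiv (p : MatProj R) : MvN (zero.add p) p :=
  equiv_of_reindex ((Equiv.emptySum (Fin 0) (Fin p.n)).symm.trans (addIndex zero p))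
    (Equiv.refl _) (fun i j => add_p_addIndex zero p (Sum.inr i) (Sum.inr j))

theorem add_comm_equiv (p q : MatProj R) : MvN (p.add q) (q.add p) :=
  equiv_of_reindex (addIndex p q) ((Equiv.sumComm _ _).trans (addIndex q p)) (fun i j => by
    refine (add_p_addIndex p q i j).trans (Eq.trans ?_ (add_p_addIndex q p i.swap j.swap).symm)
    rcases i with i | i <;> rcases j with j | j <;> rfl)

theorem add_assoc_equiv (p q r : MatProj R) : MvN ((p.add q).add r) (p.add (q.add r)) :=
  equiv_of_reindex
    (((Equiv.sumCongr (addIndex p q) (Equiv.refl _))).trans (addIndex (p.add q) r))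
    (((Equiv.sumAssoc _ _ _).trans
      (Equiv.sumCongr (Equiv.refl _) (addIndex q r))).trans (addIndex p (q.add r)))
    (fun i j => by
      refine (add_p_addIndex (p.add q) r _ _).trans
        (Eq.trans ?_ (add_p_addIndex p (q.add r) _ _).symm)
      rcases i with (i | i) | i <;> rcases j with (j | j) | j
      · exact add_p_addIndex p q (Sum.inl i) (Sum.inl j)
      · exact add_p_addIndex p q (Sum.inl i) (Sum.inr j)
      · rfl
      · exact add_p_addIndex p q (Sum.inr i) (Sum.inl j)
      · exact (add_p_addIndex p q (Sum.inr i) (Sum.inr j)).trans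
          (add_p_addIndex q r (Sum.inl i) (Sum.inl j)).symm
      · exact (add_p_addIndex q r (Sum.inl i) (Sum.inr j)).symm
      · rfl
      · exact (add_p_addIndex q r (Sum.inr i) (Sum.inl j)).symm
      · exact (add_p_addIndex q r (Sum.inr i) (Sum.inr j)).symm)

variable {S : Type*} [Ring S] [StarRing S]

/-- The image of a matrix projection under a unital `*`-homomorphism. -/
def map (φ : R →+* S) (hφ : ∀ x, φ (star x) = star (φ x)) (p : MatProj R) : MatProj S where
  n := p.n
  p := p.p.map φ
  star_eq := by
    conv_rhs => rw [← p.star_eq]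
    exact (Matrix.conjTranspose_map (f := φ) hφ).symm
  idem := by rw [← Matrix.map_mul, p.idem]

theorem map_equiv (φ : R →+* S) (hφ : ∀ x, φ (star x) = star (φ x)) {p q : MatProj R}
    (h : MvN p q) : MvN (p.map φ hφ) (q.map φ hφ) := by
  obtain ⟨v, h1, h2⟩ := h
  have hv : (v.map φ).conjTranspose = v.conjTranspose.map φ :=
    (Matrix.conjTranspose_map (f := φ) hφ).symm
  refine ⟨v.map φ, ?_, ?_⟩
  · change (v.map φ).conjTranspose * v.map φ = p.p.map φ
    rw [hv, ← Matrix.map_mul, h1]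
  · change v.map φ * (v.map φ).conjTranspose = q.p.map φ
    rw [hv, ← Matrix.map_mul, h2]

end MatProj

/-- The monoid `V(R)` of Murray–von Neumann classes of projections in matrices over `R`. -/
def ProjMonoid (R : Type*) [Ring R] [StarRing R] : Type _ := Quotient (MatProj.setoid R)

namespace ProjMonoid

variable (R : Type*) [Ring R] [StarRing R]

instance : Add (ProjMonoid R) :=
  ⟨Quotient.map₂ MatProj.add fun _ _ h _ _ k => MatProj.add_equiv h k⟩

instance : Zero (ProjMonoid R) := ⟨Quotient.mk _ MatProj.zero⟩

instance : AddCommMonoid (ProjMonoid R) where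
  add_assoc := by
    rintro ⟨p⟩ ⟨q⟩ ⟨r⟩
    exact Quotient.sound (MatProj.add_assoc_equiv p q r)
  add_comm := by
    rintro ⟨p⟩ ⟨q⟩
    exact Quotient.sound (MatProj.add_comm_equiv p q)
  zero_add := by
    rintro ⟨p⟩
    exact Quotient.sound (MatProj.zero_add_equiv p)
  add_zero := by
    rintro ⟨p⟩
    exact Quotient.sound (Setoid.trans (MatProj.add_comm_equiv p _) (MatProj.zero_add_equiv p))
  nsmul := nsmulRec

variable {R} {S : Type*} [Ring S] [StarRing S]

/-- The map `V(R) → V(S)` induced by a unital `*`-homomorphism. -/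
def map (φ : R →+* S) (hφ : ∀ x, φ (star x) = star (φ x)) : ProjMonoid R →+ ProjMonoid S where
  toFun := Quotient.map (MatProj.map φ hφ) fun _ _ h => MatProj.map_equiv φ hφ h
  map_zero' := Quotient.sound (MatProj.equiv_of_reindex (Equiv.refl _)
    (Equiv.refl _) (fun i => Fin.elim0 i))
  map_add' := by
    rintro ⟨p⟩ ⟨q⟩
    refine Quotient.sound (MatProj.equiv_of_reindex (p := (p.add q).map φ hφ)
      (q := (p.map φ hφ).add (q.map φ hφ)) (MatProj.addIndex p q)
      (MatProj.addIndex (p.map φ hφ) (q.map φ hφ)) fun i j => ?_)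
    refine (congrArg φ (MatProj.add_p_addIndex p q i j)).trans
      (Eq.trans ?_ (MatProj.add_p_addIndex (p.map φ hφ) (q.map φ hφ) i j).symm)
    rcases i with i | i <;> rcases j with j | j
    · rfl
    · exact map_zero φ
    · exact map_zero φ
    · rfl

end ProjMonoid

/-- `K_0` of a unital `C^*`-algebra: the Grothendieck group of `V(R)`. -/
abbrev K0Unital (R : Type*) [Ring R] [StarRing R] : Type _ :=
  Algebra.GrothendieckAddGroup (ProjMonoid R)

/-- The map on `K_0` induced by a unital `*`-homomorphism. -/
def K0Unital.map {R S : Type*} [Ring R] [StarRing R] [Ring S] [StarRing S]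
    (φ : R →+* S) (hφ : ∀ x, φ (star x) = star (φ x)) : K0Unital R →+ K0Unital S :=
  Algebra.GrothendieckAddGroup.lift (Algebra.GrothendieckAddGroup.of.comp (ProjMonoid.map φ hφ))

/-- `K_0(A)` for an arbitrary `C^*`-algebra `A`: the kernel of the map
`K_0(Ã) → K_0(ℂ)` induced by the canonical character of the unitization `Ã = A ⊕ ℂ`. -/
def K0 (A : Type*) [NonUnitalCStarAlgebra A] : AddSubgroup (K0Unital (Unitization ℂ A)) :=
  (K0Unital.map (Unitization.fstHom ℂ A : Unitization ℂ A →+* ℂ) (fun x => by simp)).ker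

end KTheory

/-! ### The Grothendieck group of twisted representations -/

section Reps

variable {Γ : Type} [Group Γ] [TopologicalSpace Γ] {σ : Cocycle Γ}

namespace TwistedRep

/-- Unitary equivalence of twisted representations. -/
def Iso (π π' : TwistedRep σ) : Prop :=
  ∃ U : π.H ≃ₗᵢ[ℂ] π'.H, ∀ a v, U (π.ρ a v) = π'.ρ a (U v)

theorem Iso.refl (π : TwistedRep σ) : Iso π π := ⟨LinearIsometryEquiv.refl ℂ _, fun _ _ => rfl⟩

theorem Iso.symm {π π' : TwistedRep σ} : Iso π π' → Iso π' π := fun ⟨U, hU⟩ =>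
  ⟨U.symm, fun a v => by rw [LinearIsometryEquiv.symm_apply_eq, hU, U.apply_symm_apply]⟩

theorem Iso.trans {π π' π'' : TwistedRep σ} : Iso π π' → Iso π' π'' → Iso π π'' :=
  fun ⟨U, hU⟩ ⟨W, hW⟩ => ⟨U.trans W, fun a v => by
    change W (U (π.ρ a v)) = π''.ρ a (W (U v))
    rw [hU, hW]⟩

/-- The (Hilbert space) direct sum of two twisted representations. -/
def sum (π π' : TwistedRep σ) : TwistedRep σ where
  H := WithLp 2 (π.H × π'.H)
  ρ a := (π.ρ a).withLpProdCongr 2 (π'.ρ a)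
  ρ_mul a b v := by
    refine WithLp.ofLp_injective 2 (Prod.ext (π.ρ_mul a b v.fst) (π'.ρ_mul a b v.snd))
  continuous_ρ v := (WithLp.prod_continuous_toLp 2 π.H π'.H).comp
    ((π.continuous_ρ v.fst).prodMk (π'.continuous_ρ v.snd))

/-- The zero representation. -/
def zero : TwistedRep σ where
  H := EuclideanSpace ℂ Empty
  ρ _ := LinearIsometryEquiv.refl ℂ _
  ρ_mul _ _ _ := Subsingleton.elim _ _
  continuous_ρ _ := continuous_const

theorem Iso.sum {π₁ π₂ π₁' π₂' : TwistedRep σ} :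
    Iso π₁ π₁' → Iso π₂ π₂' → Iso (π₁.sum π₂) (π₁'.sum π₂') :=
  fun ⟨U, hU⟩ ⟨W, hW⟩ => ⟨U.withLpProdCongr 2 W, fun a v =>
    WithLp.ofLp_injective 2 (Prod.ext (hU a v.fst) (hW a v.snd))⟩

theorem sum_comm_iso (π π' : TwistedRep σ) : Iso (π.sum π') (π'.sum π) :=
  ⟨LinearIsometryEquiv.withLpProdComm 2 ℂ π.H π'.H, fun _ _ => rfl⟩

theorem sum_assoc_iso (π π' π'' : TwistedRep σ) :
    Iso ((π.sum π').sum π'') (π.sum (π'.sum π'')) :=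
  ⟨LinearIsometryEquiv.withLpProdAssoc 2 ℂ π.H π'.H π''.H, fun _ _ => rfl⟩

theorem zero_sum_iso (π : TwistedRep σ) : Iso (zero.sum π) π :=
  haveI : Unique (zero : TwistedRep σ).H :=
    inferInstanceAs (Unique (EuclideanSpace ℂ Empty))
  ⟨LinearIsometryEquiv.withLpUniqueProd 2 ℂ _ π.H, fun _ _ => rfl⟩

end TwistedRep

end Reps

/-! ### The group `T × Π_T` for a circle `T`, and its cocycles -/

section Torus

/-- `T × Π_T` for a circle `T`; the discrete group `Π_T = π₀(ΩT) ≅ ℤ` is written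
multiplicatively. -/
abbrev TPi : Type := Circle × Multiplicative ℤ

instance : MeasurableSpace (Multiplicative ℤ) := ⊤

instance : DiscreteMeasurableSpace (Multiplicative ℤ) := ⟨fun _ => trivial⟩

/-- The Haar measure on `T × Π_T`: normalized Haar measure on `T` times counting measure. -/
def haarTPi : Measure TPi := circleHaar.prod Measure.count

instance : (Measure.count : Measure (Multiplicative ℤ)).IsHaarMeasure where
  lt_top_of_isCompact := fun {_} hK =>
    Measure.count_apply_lt_top.2 (isCompact_iff_finite.1 hK)
  open_pos := fun _ _ hne => Measure.count_ne_zero hne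

instance : haarTPi.IsHaarMeasure := by unfold haarTPi; infer_instance

instance : SigmaFinite haarTPi := by unfold haarTPi; infer_instance

instance : haarTPi.IsInvInvariant where
  inv_eq_self := ((Measure.measurePreserving_inv circleHaar).prod
    (Measure.measurePreserving_inv (Measure.count : Measure (Multiplicative ℤ)))).map_eq

variable (κ : ℤ →+ ℤ)

/-- The cocycle `τ((t₁, n₁), (t₂, n₂)) = κ(n₁)(t₂)` on `T × Π_T`, where the character group
`Λ_T` of the circle is identified with `ℤ`, `l ∈ ℤ` corresponding to `t ↦ t^l`. -/
def tau : Cocycle TPi where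
  toFun a b := b.1 ^ κ (Multiplicative.toAdd a.2)
  continuous_toFun := by
    have h1 : Continuous (fun p : Circle × ℤ => p.1 ^ p.2) :=
      continuous_prod_of_discrete_right.2 fun n => continuous_zpow n
    have h2 : Continuous (fun m : Multiplicative ℤ => κ (Multiplicative.toAdd m)) :=
      continuous_of_discreteTopology
    exact h1.comp (by fun_prop : Continuous (fun p : TPi × TPi =>
      ((p.2.1, κ (Multiplicative.toAdd p.1.2)) : Circle × ℤ)))
  cocycle a b c := by
    simp only [Prod.fst_mul, Prod.snd_mul, toAdd_mul, map_add, mul_zpow, zpow_add]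
    ac_rfl
  one_left a := by simp
  one_right a := by simp

/-- The cocycle attached to `n • κ` is the `n`-th power `nτ` of the cocycle attached to `κ`. -/
theorem tau_zsmul (n : ℤ) (a b : TPi) : tau (n • κ) a b = (tau κ a b) ^ n := by
  change b.1 ^ (n • κ (Multiplicative.toAdd a.2)) = (b.1 ^ κ (Multiplicative.toAdd a.2)) ^ n
  rw [smul_eq_mul, mul_comm, zpow_mul]

/-- The weights in a coset `[λ] ∈ Λ_T / κ(Π_T)`. -/
abbrev Weights (c : ℤ ⧸ κ.range) : Type := {l : ℤ // (l : ℤ ⧸ κ.range) = c}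

/-- Translation by `κ(m)` on the weights in a coset. -/
def shift (c : ℤ ⧸ κ.range) (m : ℤ) : Weights κ c ≃ Weights κ c where
  toFun l := ⟨l.1 + κ m, by
    refine Eq.trans ?_ l.2
    rw [QuotientAddGroup.eq]; exact ⟨-m, by simp⟩⟩
  invFun l := ⟨l.1 - κ m, by
    refine Eq.trans ?_ l.2
    rw [QuotientAddGroup.eq]; exact ⟨m, by simp⟩⟩
  left_inv l := by ext; simp
  right_inv l := by ext; simp

/-- The Hilbert space with orthonormal basis indexed by the weights in a coset. -/
abbrev VSpace (c : ℤ ⧸ κ.range) : Type := lp (fun _ : Weights κ c => ℂ) 2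

variable {κ}

theorem memlp_action {c : ℤ ⧸ κ.range} (t : Circle) (m : ℤ) (v : VSpace κ c) :
    Memℓp (fun l : Weights κ c => ((t ^ l.1 : Circle) : ℂ) * v (shift κ c m l)) 2 := by
  have h := (lp.memℓp v).summable (by norm_num)
  refine memℓp_gen (((shift κ c m).summable_iff.2 h).congr fun l => ?_)
  rw [norm_mul, Circle.norm_coe, one_mul]
  rfl

theorem norm_action {c : ℤ ⧸ κ.range} (t : Circle) (m : ℤ) (v : VSpace κ c) :
    ‖(⟨_, memlp_action t m v⟩ : VSpace κ c)‖ = ‖v‖ := by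
  rw [lp.norm_eq_tsum_rpow (by norm_num), lp.norm_eq_tsum_rpow (by norm_num)]
  congr 1
  rw [← (shift κ c m).tsum_eq (fun l => ‖v l‖ ^ (2 : ℝ≥0∞).toReal)]
  refine tsum_congr fun l => ?_
  rw [norm_mul, Circle.norm_coe, one_mul]

/-- The operator `ρ(t, m)` on `V_{[λ]}`: `(ρ(t, m) v)(l) = t^l v(l + κ(m))`, that is
`ρ(t, m) e_l = t^{l - κ(m)} e_{l - κ(m)}`. -/
def action {c : ℤ ⧸ κ.range} (t : Circle) (m : ℤ) : VSpace κ c ≃ₗᵢ[ℂ] VSpace κ c :=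
  LinearIsometryEquiv.ofSurjective
    { toFun := fun v => ⟨_, memlp_action t m v⟩
      map_add' := fun v w => by ext l; exact mul_add _ _ _
      map_smul' := fun z v => by ext l; exact mul_left_comm _ _ _
      norm_map' := norm_action t m }
    (fun w => by
      refine ⟨⟨fun l => (((t ^ (l.1 - κ m))⁻¹ : Circle) : ℂ) * w ((shift κ c m).symm l), ?_⟩, ?_⟩
      · have h := (lp.memℓp w).summable (by norm_num)
        refine memℓp_gen (((shift κ c m).symm.summable_iff.2 h).congr fun l => ?_)
        rw [norm_mul, Circle.norm_coe, one_mul]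
        rfl
      · ext l
        change ((t ^ l.1 : Circle) : ℂ) * ((((t ^ (l.1 + κ m - κ m))⁻¹ : Circle) : ℂ) *
          w ((shift κ c m).symm (shift κ c m l))) = w l
        rw [Equiv.symm_apply_apply, add_sub_cancel_right, ← mul_assoc, ← Circle.coe_mul]
        simp)

theorem action_apply {c : ℤ ⧸ κ.range} (t : Circle) (m : ℤ) (v : VSpace κ c) (l : Weights κ c) :
    action t m v l = ((t ^ l.1 : Circle) : ℂ) * v (shift κ c m l) := rfl

theorem continuous_action {c : ℤ ⧸ κ.range} (m : ℤ) (v : VSpace κ c) :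
    Continuous (fun t : Circle => action t m v) := by
  rw [continuous_iff_continuousAt]
  intro s
  rw [ContinuousAt, tendsto_iff_norm_sub_tendsto_zero]
  have h := (lp.memℓp v).summable (by norm_num)
  have h' : Summable fun l => 4 * ‖v (shift κ c m l)‖ ^ (2 : ℝ≥0∞).toReal :=
    ((shift κ c m).summable_iff.2 h).mul_left 4
  have key : Filter.Tendsto (fun t : Circle =>
      ∑' l : Weights κ c, ‖(action t m v - action s m v) l‖ ^ (2 : ℝ≥0∞).toReal)
      (nhds s) (nhds (∑' _ : Weights κ c, (0 : ℝ))) := by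
    refine tendsto_tsum_of_dominated_convergence h' (fun l => ?_)
      (Filter.Eventually.of_forall fun t l => ?_)
    · have hc : Continuous fun t : Circle =>
          ‖((t ^ l.1 : Circle) : ℂ) * v (shift κ c m l) -
            ((s ^ l.1 : Circle) : ℂ) * v (shift κ c m l)‖ ^ 2 := by
        have h1 : Continuous fun t : Circle => t ^ l.1 := continuous_zpow l.1
        have h2 : Continuous fun t : Circle => ((t ^ l.1 : Circle) : ℂ) :=
          continuous_subtype_val.comp h1
        fun_prop
      have := hc.tendsto s
      rw [sub_self, norm_zero, zero_pow two_ne_zero] at this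
      refine this.congr fun t => ?_
      rw [ENNReal.toReal_ofNat, Real.rpow_ofNat]
      rfl
    · have e1 : (action t m v - action s m v) l =
          (((t ^ l.1 : Circle) : ℂ) - ((s ^ l.1 : Circle) : ℂ)) * v (shift κ c m l) := by
        change action t m v l - action s m v l = _
        rw [action_apply, action_apply, sub_mul]
      have e2 : ‖((t ^ l.1 : Circle) : ℂ) - ((s ^ l.1 : Circle) : ℂ)‖ ≤ 2 := by
        refine (norm_sub_le _ _).trans ?_
        rw [Circle.norm_coe, Circle.norm_coe]; norm_num
      rw [e1, norm_mul]
      have e3 := norm_nonneg (v (shift κ c m l))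
      have e4 : (‖((t ^ l.1 : Circle) : ℂ) - ((s ^ l.1 : Circle) : ℂ)‖ *
          ‖v (shift κ c m l)‖) ^ 2 ≤ 4 * ‖v (shift κ c m l)‖ ^ 2 := by
        rw [mul_pow]
        have e5 := norm_nonneg (((t ^ l.1 : Circle) : ℂ) - ((s ^ l.1 : Circle) : ℂ))
        exact mul_le_mul_of_nonneg_right (by nlinarith) (by positivity)
      rw [ENNReal.toReal_ofNat, Real.rpow_ofNat, Real.rpow_ofNat, Real.norm_of_nonneg (by positivity)]
      exact e4
  rw [tsum_zero] at key
  have key2 := key.rpow_const (p := 1 / (2 : ℝ≥0∞).toReal) (Or.inr (by positivity))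
  rw [Real.zero_rpow (by norm_num)] at key2
  refine key2.congr fun t => ?_
  exact (lp.norm_eq_tsum_rpow (by norm_num) _).symm

variable (κ)

/-- The representation `V_{[λ]}` of `T × Π_T` at level `τ`, the Hilbert direct sum of the characters
`ℂ_μ`, `μ ∈ λ + κ(Π_T)`, on which `T` acts by the weights and `Π_T` by permuting the summands. -/
def V (c : ℤ ⧸ κ.range) : TwistedRep (tau κ) where
  H := VSpace κ c
  ρ a := action a.1 (Multiplicative.toAdd a.2)
  ρ_mul a b v := by
    ext l
    change action a.1 _ (action b.1 _ v) l = ((b.1 ^ κ (Multiplicative.toAdd a.2) : Circle) : ℂ) *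
      action (a.1 * b.1) (Multiplicative.toAdd a.2 + Multiplicative.toAdd b.2) v l
    simp only [action_apply]
    have h1 : shift κ c (Multiplicative.toAdd b.2) (shift κ c (Multiplicative.toAdd a.2) l) =
        shift κ c (Multiplicative.toAdd a.2 + Multiplicative.toAdd b.2) l := by
      ext
      change l.1 + κ _ + κ _ = l.1 + κ (_ + _)
      rw [map_add, add_assoc]
    rw [h1]
    change ((a.1 ^ l.1 : Circle) : ℂ) *
      (((b.1 ^ (l.1 + κ (Multiplicative.toAdd a.2)) : Circle) : ℂ) * _) = _
    rw [← mul_assoc, ← mul_assoc, ← Circle.coe_mul, ← Circle.coe_mul, mul_zpow, zpow_add]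
    congr 2
    ac_rfl
  continuous_ρ v := continuous_prod_of_discrete_right.2 fun m =>
    continuous_action (Multiplicative.toAdd m) v

variable {κ}

/-- The weight space `{v | ρ(t) v = t^l v for all t ∈ T}`. -/
def weightSpace (π : TwistedRep (tau κ)) (l : ℤ) : Submodule ℂ π.H where
  carrier := {v | ∀ t : Circle, π.ρ (t, 1) v = ((t ^ l : Circle) : ℂ) • v}
  add_mem' := fun hv hw t => by rw [map_add, hv t, hw t, smul_add]
  zero_mem' := fun t => by simp
  smul_mem' := fun z v hv t => by rw [map_smul, hv t, smul_comm]

/-- All weights of `T` occur with finite multiplicity. -/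
def FiniteMult (π : TwistedRep (tau κ)) : Prop :=
  ∀ l, FiniteDimensional ℂ (weightSpace π l)

theorem finiteMult_sum {π π' : TwistedRep (tau κ)} (h : FiniteMult π) (h' : FiniteMult π') :
    FiniteMult (π.sum π') := by
  intro l
  have := h l
  have := h' l
  let F : weightSpace (π.sum π') l →ₗ[ℂ] weightSpace π l × weightSpace π' l :=
    { toFun := fun v => (⟨WithLp.fst v.1, fun t => congrArg WithLp.fst (v.2 t)⟩,
        ⟨WithLp.snd v.1, fun t => congrArg WithLp.snd (v.2 t)⟩)
      map_add' := fun _ _ => rfl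
      map_smul' := fun _ _ => rfl }
  refine FiniteDimensional.of_injective F fun v w hvw => ?_
  refine Subtype.ext (WithLp.ofLp_injective 2 (Prod.ext ?_ ?_))
  · exact congrArg (fun x => (x.1 : π.H)) hvw
  · exact congrArg (fun x => (x.2 : π'.H)) hvw

theorem finiteMult_zero : FiniteMult (TwistedRep.zero : TwistedRep (tau κ)) := by
  intro l
  have : FiniteDimensional ℂ (TwistedRep.zero : TwistedRep (tau κ)).H :=
    inferInstanceAs (FiniteDimensional ℂ (EuclideanSpace ℂ Empty))
  infer_instance

variable (κ)

/-- Unitary equivalence on the `τ`-twisted representations with finite weight multiplicities. -/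
def repSetoid : Setoid {π : TwistedRep (tau κ) // FiniteMult π} where
  r π π' := TwistedRep.Iso π.1 π'.1
  iseqv := ⟨fun _ => TwistedRep.Iso.refl _, TwistedRep.Iso.symm, TwistedRep.Iso.trans⟩

/-- The monoid, under direct sum, of unitary equivalence classes of `τ`-twisted unitary
representations of `T × Π_T` with finite weight multiplicities. -/
def RepMonoid : Type 1 := Quotient (repSetoid κ)

instance : Add (RepMonoid κ) :=
  ⟨Quotient.map₂ (fun π π' => ⟨π.1.sum π'.1, finiteMult_sum π.2 π'.2⟩)
    fun _ _ h _ _ k => TwistedRep.Iso.sum h k⟩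

instance : Zero (RepMonoid κ) := ⟨Quotient.mk (repSetoid κ) ⟨TwistedRep.zero, finiteMult_zero⟩⟩

instance : AddCommMonoid (RepMonoid κ) where
  add_assoc := by
    rintro ⟨p⟩ ⟨q⟩ ⟨r⟩
    exact Quotient.sound (TwistedRep.sum_assoc_iso p.1 q.1 r.1)
  add_comm := by
    rintro ⟨p⟩ ⟨q⟩
    exact Quotient.sound (TwistedRep.sum_comm_iso p.1 q.1)
  zero_add := by
    rintro ⟨p⟩
    exact Quotient.sound (TwistedRep.zero_sum_iso p.1)
  add_zero := by
    rintro ⟨p⟩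
    exact Quotient.sound
      (TwistedRep.Iso.trans (TwistedRep.sum_comm_iso p.1 _) (TwistedRep.zero_sum_iso p.1))
  nsmul := nsmulRec

/-- `R^τ(T × Π_T)`: the Grothendieck group of the monoid of `τ`-twisted representations. -/
abbrev RTau : Type 1 := Algebra.GrothendieckAddGroup (RepMonoid κ)

/-- The class in `R^τ(T × Π_T)` of a `τ`-twisted representation. -/
def RTau.mk (π : TwistedRep (tau κ)) (h : FiniteMult π) : RTau κ :=
  Algebra.GrothendieckAddGroup.of (Quotient.mk (repSetoid κ) ⟨π, h⟩ : RepMonoid κ)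

end Torus

end TwistedCStar

end

/-! The norm of `C^*(Γ, σ)` is a supremum over twisted representations. Once every twisted
representation is split into known pieces, a map from `C_c(Γ)` to the algebra acting on these pieces
is isometric. If its range is also dense, it extends to an isomorphism
(`exists_starAlgEquiv_groupCStar`). The splittings come from circle actions: the weight spaces of a
strongly continuous unitary action of `U(1)` are orthogonal with dense span
(`isHilbertSum_circleWeightSpace`), and operators preserving an orthogonal decomposition are bounded
by the supremum of the bounds on the pieces (`opNorm_le_of_isHilbertSum'`).

For the central extension this is applied to the central circle. A representation of central weight
`n` is the same as an `nτ`-twisted representation, and there `f` acts through `f_n`.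
Riemann-Lebesgue with dominated convergence gives `‖f_n‖ → 0`, so the components form an element of
the direct sum.

For `κ ≠ 0` the cocycle relation makes `ρ(1, m)` move weight `l` to weight `l - κ(m)`. Since `κ` is
injective, the translates of a unit weight vector are orthonormal and span a copy of some `V_{[λ]}`
(`exists_intertwiner`); hence every twisted representation is a Hilbert sum of such copies
(`exists_isHilbertSum_V`). The functions `t^j` on `T × {m}` act on the `V_{[λ]}` as matrix units or
as zero, and matrix units generate the compact operators. The image of `κ` has finite index, so
there are finitely many summands.

For `κ = 0` the group `Π_T` preserves each weight space. On weight `l`, the function `f` acts by the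
functional calculus of the unitary `ρ(1, 1)` applied to the row `l` of the Fourier transform of `f`.
So the universal norm is the supremum norm of the Fourier transform.

For `K_0`, projections over the compact operators are orthogonal sums of rank one projections
(`cls_mem_closure`). Any projection over the unitization differs from its scalar part by such
projections (`exists_cls_add_eq`), so the rank one classes generate the kernel. They are independent
because the unitized compact operators are stably finite (`mul_conjTranspose_eq_one`). The group
`R^τ` is free on the `V_{[λ]}`: copies split off one at a time until the finite total multiplicity
is used up, and the multiplicities detect the coefficients (`exists_addEquiv_RTau`). -/

noncomputable section

namespace TwistedCStar

/-! ### Extending isometric maps from dense subsets -/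

section Extension

variable {X A B : Type*} [NonUnitalCStarAlgebra A] [NonUnitalCStarAlgebra B]

/-- Two dense maps from a set with algebraic operations into `C^*`-algebras which respect these
operations and define the same distance extend to an isomorphism. -/
theorem exists_starAlgEquiv_of_denseRange (i : X → A) (φ : X → B)
    (hi : DenseRange i) (hφ : DenseRange φ)
    (hdist : ∀ x y, dist (φ x) (φ y) = dist (i x) (i y))
    (hadd : ∀ x y, ∃ z, i z = i x + i y ∧ φ z = φ x + φ y)
    (hmul : ∀ x y, ∃ z, i z = i x * i y ∧ φ z = φ x * φ y)
    (hsmul : ∀ (c : ℂ) x, ∃ z, i z = c • i x ∧ φ z = c • φ x)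
    (hstar : ∀ x, ∃ z, i z = star (i x) ∧ φ z = star (φ x)) :
    ∃ Φ : A ≃⋆ₐ[ℂ] B, ∀ x, Φ (i x) = φ x := by
  -- With the distance pulled back along `i`, both `i` and `φ` are isometries, so `φ` extends
  -- uniformly continuously along `i`. Elements of norm zero need not be divided out beforehand, and
  -- every algebraic identity is a closed condition that can be checked on the range of `i`.
  let _ : PseudoMetricSpace X := PseudoMetricSpace.induced i inferInstance
  have hii : Isometry i := Isometry.of_dist_eq fun _ _ => rfl
  have hφi : Isometry φ := Isometry.of_dist_eq hdist
  have hu := hii.isUniformInducing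
  obtain ⟨F, hFc, hFi⟩ : ∃ F : A → B, Continuous F ∧ ∀ x, F (i x) = φ x :=
    ⟨_, (uniformContinuous_uniformly_extend hu hi hφi.uniformContinuous).continuous,
      uniformly_extend_of_ind hu hi hφi.uniformContinuous⟩
  have hF : Isometry F := Isometry.of_dist_eq fun a b => by
    refine hi.induction_on₂ (p := fun a b => dist (F a) (F b) = dist a b) ?_ ?_ a b
    · exact isClosed_eq ((hFc.comp continuous_fst).dist (hFc.comp continuous_snd)) (by fun_prop)
    · intro x y
      rw [hFi, hFi, hdist]
  have h_add : ∀ a b, F (a + b) = F a + F b := fun a b => by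
    refine hi.induction_on₂ (p := fun a b => F (a + b) = F a + F b) ?_ ?_ a b
    · exact isClosed_eq (by fun_prop) (by fun_prop)
    · intro x y
      obtain ⟨z, hz, hz'⟩ := hadd x y
      rw [← hz, hFi, hFi, hFi, hz']
  have h_mul : ∀ a b, F (a * b) = F a * F b := fun a b => by
    refine hi.induction_on₂ (p := fun a b => F (a * b) = F a * F b) ?_ ?_ a b
    · exact isClosed_eq (by fun_prop) (by fun_prop)
    · intro x y
      obtain ⟨z, hz, hz'⟩ := hmul x y
      rw [← hz, hFi, hFi, hFi, hz']
  have h_smul : ∀ (c : ℂ) a, F (c • a) = c • F a := fun c a => by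
    refine hi.induction_on (p := fun a => F (c • a) = c • F a) a ?_ ?_
    · exact isClosed_eq (by fun_prop) (by fun_prop)
    · intro x
      obtain ⟨z, hz, hz'⟩ := hsmul c x
      rw [← hz, hFi, hFi, hz']
  have h_star : ∀ a, F (star a) = star (F a) := fun a => by
    refine hi.induction_on (p := fun a => F (star a) = star (F a)) a ?_ ?_
    · exact isClosed_eq (by fun_prop) (by fun_prop)
    · intro x
      obtain ⟨z, hz, hz'⟩ := hstar x
      rw [← hz, hFi, hFi, hz']
  -- The range of an isometry from a complete space is closed, and it contains the dense range of
  -- `φ`.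
  have h_surj : Function.Surjective F := by
    rw [← Set.range_eq_univ]
    refine (hF.isClosedEmbedding.isClosed_range.closure_eq).symm.trans ?_
    refine (hφ.mono ?_).closure_eq
    rintro _ ⟨x, rfl⟩
    exact ⟨i x, hFi x⟩
  have h_zero : F 0 = 0 := by simpa using h_smul 0 0
  let G : A →⋆ₙₐ[ℂ] B :=
    { toFun := F, map_add' := h_add, map_mul' := h_mul, map_smul' := h_smul, map_zero' := h_zero
      map_star' := h_star }
  exact ⟨StarAlgEquiv.ofBijective G ⟨hF.injective, h_surj⟩, hFi⟩

end Extension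

/-! ### Isomorphisms out of `C^*(Γ, σ)` from maps on `C_c(Γ)` -/

section GroupExtension

variable {Γ : Type} [Group Γ] [TopologicalSpace Γ] [IsTopologicalGroup Γ]
  [LocallyCompactSpace Γ] [SecondCountableTopology Γ] [MeasurableSpace Γ] [BorelSpace Γ]
  (σ : Cocycle Γ) (μ : Measure Γ) [μ.IsHaarMeasure] [μ.IsInvInvariant]

theorem denseRange_toCStar : DenseRange (toCStar σ μ) := by
  intro x
  rw [Metric.mem_closure_iff]
  intro ε hε
  obtain ⟨_, ⟨f, rfl⟩, hf⟩ := Metric.mem_closure_iff.1 (show x.1 ∈ closure _ from x.2) ε hε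
  exact ⟨_, ⟨f, rfl⟩, hf⟩

theorem toCStar_add (f g : C_c(Γ, ℂ)) :
    toCStar σ μ (f + g) = toCStar σ μ f + toCStar σ μ g :=
  Subtype.ext (Subtype.ext (funext fun π => π.integrated_add μ f g))

theorem toCStar_smul (c : ℂ) (f : C_c(Γ, ℂ)) : toCStar σ μ (c • f) = c • toCStar σ μ f :=
  Subtype.ext (Subtype.ext (funext fun π => π.integrated_smul μ c f))

theorem toCStar_conv (f g : C_c(Γ, ℂ)) :
    toCStar σ μ (conv σ μ f g) = toCStar σ μ f * toCStar σ μ g :=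
  Subtype.ext (Subtype.ext (funext fun π => π.integrated_conv μ f g))

theorem toCStar_invol (f : C_c(Γ, ℂ)) : toCStar σ μ (invol σ f) = star (toCStar σ μ f) :=
  Subtype.ext (Subtype.ext (funext fun π => π.integrated_invol μ f))

variable {σ} in
theorem norm_integrated_le_norm_toCStar (π : TwistedRep σ) (f : C_c(Γ, ℂ)) :
    ‖π.integrated μ f‖ ≤ ‖toCStar σ μ f‖ :=
  lp.norm_apply_le_norm ENNReal.top_ne_zero (universal σ μ f) π

theorem norm_toCStar_le {f : C_c(Γ, ℂ)} {C : ℝ} (hC : 0 ≤ C)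
    (h : ∀ π : TwistedRep σ, ‖π.integrated μ f‖ ≤ C) : ‖toCStar σ μ f‖ ≤ C :=
  lp.norm_le_of_forall_le hC h

theorem norm_toCStar_le_integral (f : C_c(Γ, ℂ)) : ‖toCStar σ μ f‖ ≤ ∫ x, ‖f x‖ ∂μ :=
  norm_toCStar_le σ μ (integral_nonneg fun _ => norm_nonneg _) fun π => π.norm_integrated_le μ f

/-- A map on `C_c(Γ)` with dense range in a `C^*`-algebra which respects the twisted convolution
structure and the universal norm extends to an isomorphism from `C^*(Γ, σ)`. -/
theorem exists_starAlgEquiv_groupCStar {B : Type*} [NonUnitalCStarAlgebra B]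
    (φ : C_c(Γ, ℂ) → B) (hφ : DenseRange φ)
    (hadd : ∀ f g, φ (f + g) = φ f + φ g)
    (hsmul : ∀ (c : ℂ) f, φ (c • f) = c • φ f)
    (hmul : ∀ f g, φ (conv σ μ f g) = φ f * φ g)
    (hstar : ∀ f, φ (invol σ f) = star (φ f))
    (hnorm : ∀ f, ‖φ f‖ = ‖toCStar σ μ f‖) :
    ∃ Φ : GroupCStar σ μ ≃⋆ₐ[ℂ] B, ∀ f, Φ (toCStar σ μ f) = φ f := by
  refine exists_starAlgEquiv_of_denseRange (toCStar σ μ) φ (denseRange_toCStar σ μ) hφ ?_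
    (fun f g => ⟨f + g, toCStar_add σ μ f g, hadd f g⟩)
    (fun f g => ⟨conv σ μ f g, toCStar_conv σ μ f g, hmul f g⟩)
    (fun c f => ⟨c • f, toCStar_smul σ μ c f, hsmul c f⟩)
    (fun f => ⟨invol σ f, toCStar_invol σ μ f, hstar f⟩)
  intro f g
  have h1 : φ f - φ g = φ (f + (-1 : ℂ) • g) := by
    rw [hadd, hsmul, neg_one_smul, sub_eq_add_neg]
  have h2 : toCStar σ μ f - toCStar σ μ g = toCStar σ μ (f + (-1 : ℂ) • g) := by
    rw [toCStar_add, toCStar_smul, neg_one_smul, sub_eq_add_neg]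
  rw [dist_eq_norm, dist_eq_norm, h1, h2, hnorm]

end GroupExtension

/-! ### Norms of operators on Hilbert sums -/

/-- An operator which preserves the summands of a dense orthogonal family and is bounded by `C` on
each of them has norm at most `C`. -/
theorem opNorm_le_of_isHilbertSum' {ι E : Type*} {G : ι → Type*} [NormedAddCommGroup E]
    [InnerProductSpace ℂ E] [CompleteSpace E] [∀ i, NormedAddCommGroup (G i)]
    [∀ i, InnerProductSpace ℂ (G i)] {V : ∀ i, G i →ₗᵢ[ℂ] E} (hV : IsHilbertSum ℂ G V)
    (T : E →L[ℂ] E) {C : ℝ} (hC : 0 ≤ C)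
    (hT : ∀ i x, ∃ y, T (V i x) = V i y ∧ ‖y‖ ≤ C * ‖x‖) : ‖T‖ ≤ C := by
  choose S hTS hS using hT
  refine T.opNorm_le_bound hC fun v => ?_
  have hv := hV.hasSum_linearIsometryEquiv_symm (hV.linearIsometryEquiv v)
  rw [LinearIsometryEquiv.symm_apply_apply] at hv
  have hTv := hv.mapL T
  -- The bound is proved for the finite partial sums of the decomposition of `v`, where Pythagoras
  -- applies to both sides, and then passes to the limit.
  refine le_of_tendsto_of_tendsto hTv.norm (hv.norm.const_mul C)
    (Filter.Eventually.of_forall fun s => ?_)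
  refine le_of_sq_le_sq ?_ (by positivity)
  simp only [hTS]
  rw [mul_pow, hV.OrthogonalFamily.norm_sum, hV.OrthogonalFamily.norm_sum, Finset.mul_sum]
  refine Finset.sum_le_sum fun i _ => ?_
  rw [← mul_pow]
  exact pow_le_pow_left₀ (norm_nonneg _) (hS i _) 2

/-- An operator which acts through operators of norm at most `C` on the summands of a dense
orthogonal family has norm at most `C`. -/
theorem opNorm_le_of_isHilbertSum {ι E : Type*} {G : ι → Type*} [NormedAddCommGroup E]
    [InnerProductSpace ℂ E] [CompleteSpace E] [∀ i, NormedAddCommGroup (G i)]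
    [∀ i, InnerProductSpace ℂ (G i)] {V : ∀ i, G i →ₗᵢ[ℂ] E} (hV : IsHilbertSum ℂ G V)
    (T : E →L[ℂ] E) (S : ∀ i, G i →L[ℂ] G i) (hTS : ∀ i x, T (V i x) = V i (S i x))
    {C : ℝ} (hC : 0 ≤ C) (hS : ∀ i, ‖S i‖ ≤ C) : ‖T‖ ≤ C :=
  opNorm_le_of_isHilbertSum' hV T hC fun i x => ⟨S i x, hTS i x, ((S i).le_opNorm _).trans
    (mul_le_mul_of_nonneg_right (hS i) (norm_nonneg _))⟩

end TwistedCStar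
end

noncomputable section

namespace TwistedCStar

/-! ### Trigonometric polynomials on the circle -/

/-- The character `z ↦ z ^ n` of the circle, as a complex-valued function. -/
def circleChar (n : ℤ) : C(Circle, ℂ) :=
  ⟨fun z => ((z ^ n : Circle) : ℂ), continuous_subtype_val.comp (continuous_zpow n)⟩

theorem circleChar_apply (n : ℤ) (z : Circle) : circleChar n z = ((z ^ n : Circle) : ℂ) := rfl

theorem circleChar_zero : circleChar 0 = 1 := by ext z; simp [circleChar_apply]

theorem circleChar_add (m n : ℤ) : circleChar (m + n) = circleChar m * circleChar n := by
  ext z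
  simp [circleChar_apply, zpow_add]

theorem star_circleChar (n : ℤ) : star (circleChar n) = circleChar (-n) := by
  ext z
  change starRingEnd ℂ ((z ^ n : Circle) : ℂ) = ((z ^ (-n) : Circle) : ℂ)
  rw [← Circle.coe_inv_eq_conj, zpow_neg]

/-- The star subalgebra of trigonometric polynomials. -/
def trigSubalgebra : StarSubalgebra ℂ C(Circle, ℂ) where
  toSubalgebra := Algebra.adjoin ℂ (Set.range circleChar)
  star_mem' := by
    change Algebra.adjoin ℂ (Set.range circleChar) ≤ star (Algebra.adjoin ℂ (Set.range circleChar))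
    refine Algebra.adjoin_le ?_
    rintro - ⟨n, rfl⟩
    exact Algebra.subset_adjoin ⟨-n, (star_circleChar n).symm⟩

/-- Products of characters are characters, so the algebra they generate is already their linear
span. -/
theorem trigSubalgebra_coe :
    Subalgebra.toSubmodule trigSubalgebra.toSubalgebra =
      Submodule.span ℂ (Set.range circleChar) := by
  apply Algebra.adjoin_eq_span_of_subset
  refine Set.Subset.trans ?_ Submodule.subset_span
  intro x hx
  refine Submonoid.closure_induction (fun _ => id) ⟨0, circleChar_zero⟩ ?_ hx
  rintro - - - - ⟨m, rfl⟩ ⟨n, rfl⟩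
  exact ⟨m + n, circleChar_add m n⟩

/-- Stone-Weierstrass: the character `z ↦ z` alone separates the points of the circle. -/
theorem span_circleChar_closure_eq_top :
    (Submodule.span ℂ (Set.range circleChar)).topologicalClosure = ⊤ := by
  rw [← trigSubalgebra_coe]
  refine congrArg (Subalgebra.toSubmodule <| StarSubalgebra.toSubalgebra ·)
    (ContinuousMap.starSubalgebra_topologicalClosure_eq_top_of_separatesPoints trigSubalgebra ?_)
  intro x y hxy
  refine ⟨_, ⟨circleChar 1, Algebra.subset_adjoin ⟨1, rfl⟩, rfl⟩, ?_⟩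
  intro h
  apply hxy
  have h' : ((x ^ (1 : ℤ) : Circle) : ℂ) = ((y ^ (1 : ℤ) : Circle) : ℂ) := h
  rw [zpow_one, zpow_one] at h'
  exact Subtype.ext h'

theorem dense_span_circleChar : Dense (Submodule.span ℂ (Set.range circleChar) : Set C(Circle, ℂ)) :=
  Submodule.dense_iff_topologicalClosure_eq_top.2 span_circleChar_closure_eq_top

theorem integrable_circle {E : Type*} [NormedAddCommGroup E] {f : Circle → E} (hf : Continuous f) :
    Integrable f circleHaar :=
  hf.integrable_of_hasCompactSupport (HasCompactSupport.of_compactSpace f)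

/-- Translation by `w` multiplies the integral by `w ^ n` and leaves it unchanged, so it vanishes as
soon as `w ^ n ≠ 1` for some `w`. -/
theorem integral_zpow (n : ℤ) :
    ∫ z, ((z ^ n : Circle) : ℂ) ∂circleHaar = if n = 0 then 1 else 0 := by
  split_ifs with h
  · simp [h]
  · obtain ⟨w, hw⟩ : ∃ w : Circle, ((w ^ n : Circle) : ℂ) ≠ 1 := by
      -- For this choice `w ^ n = exp(iπ) = -1`.
      refine ⟨Circle.exp (Real.pi / n), ?_⟩
      rw [← Circle.exp_intCast_mul, mul_div_cancel₀ _ (by exact_mod_cast h)]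
      exact fun h' => Circle.exp_pi_ne_one (Subtype.ext h')
    have h1 : ∫ z, ((z ^ n : Circle) : ℂ) ∂circleHaar =
        ((w ^ n : Circle) : ℂ) * ∫ z, ((z ^ n : Circle) : ℂ) ∂circleHaar := by
      rw [← integral_const_mul]
      conv_lhs => rw [← integral_mul_left_eq_self _ w]
      refine integral_congr_ae (Filter.Eventually.of_forall fun z => ?_)
      simp [mul_zpow]
    have h2 : (((w ^ n : Circle) : ℂ) - 1) * ∫ z, ((z ^ n : Circle) : ℂ) ∂circleHaar = 0 := by
      rw [sub_mul, one_mul, ← h1, sub_self]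
    exact (mul_eq_zero.1 h2).resolve_left (sub_ne_zero.2 hw)

/-- A continuous function on the circle all of whose Fourier coefficients vanish is zero. -/
theorem eq_zero_of_integral_zpow_mul {g : Circle → ℂ} (hg : Continuous g)
    (h : ∀ n : ℤ, ∫ z, ((z ^ n : Circle) : ℂ) * g z ∂circleHaar = 0) : g = 0 := by
  have hint : ∀ φ : C(Circle, ℂ), Integrable (fun z => φ z * g z) circleHaar := fun φ =>
    integrable_circle (by fun_prop)
  let L : C(Circle, ℂ) →ₗ[ℂ] ℂ :=
    { toFun := fun φ => ∫ z, φ z * g z ∂circleHaar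
      map_add' := fun φ ψ => by
        rw [← integral_add (hint φ) (hint ψ)]
        simp [add_mul]
      map_smul' := fun c φ => by
        rw [RingHom.id_apply, smul_eq_mul, ← integral_const_mul]
        simp [mul_assoc] }
  have hLc : Continuous L := by
    refine AddMonoidHomClass.continuous_of_bound L (∫ z, ‖g z‖ ∂circleHaar) fun φ => ?_
    refine (norm_integral_le_integral_norm _).trans ?_
    rw [mul_comm, ← integral_const_mul]
    refine integral_mono (hint φ).norm ((integrable_circle hg.norm).const_mul _) fun z => ?_
    rw [norm_mul]
    exact mul_le_mul_of_nonneg_right (φ.norm_coe_le_norm z) (norm_nonneg _)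
  have hL : ∀ φ, L φ = 0 := by
    have h0 : ∀ φ ∈ Submodule.span ℂ (Set.range circleChar), L φ = 0 := fun φ hφ => by
      have : Submodule.span ℂ (Set.range circleChar) ≤ LinearMap.ker L := by
        rw [Submodule.span_le]
        rintro _ ⟨n, rfl⟩
        exact h n
      exact this hφ
    have := Continuous.ext_on dense_span_circleChar hLc continuous_const (g := fun _ => 0) h0
    exact fun φ => congrFun this φ
  -- The functional `L` vanishes on all continuous functions by density; its value at the conjugate
  -- of `g` is the integral of `|g|²`.
  have h1 : ∫ z, ‖g z‖ ^ 2 ∂circleHaar = 0 := by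
    have h2 : ∫ z, starRingEnd ℂ (g z) * g z ∂circleHaar = 0 :=
      hL ⟨fun z => starRingEnd ℂ (g z), Complex.continuous_conj.comp hg⟩
    have h3 : ∀ z, starRingEnd ℂ (g z) * g z = ((‖g z‖ ^ 2 : ℝ) : ℂ) := fun z => by
      rw [Complex.conj_mul']; push_cast; rfl
    simp only [h3] at h2
    rw [integral_complex_ofReal] at h2
    exact_mod_cast h2
  have hg2 : Continuous fun z => ‖g z‖ ^ 2 := by fun_prop
  -- Haar measure charges every nonempty open set, so a continuous function vanishing almost
  -- everywhere vanishes.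
  have h2 : (fun z => ‖g z‖ ^ 2) = 0 :=
    Measure.eq_of_ae_eq ((integral_eq_zero_iff_of_nonneg (fun z => by positivity)
      (integrable_circle hg2)).1 h1) hg2 continuous_zero
  funext z
  simpa using congrFun h2 z

/-! ### Weight decompositions under an action of the circle -/

section CircleAction

variable {E : Type*} [NormedAddCommGroup E] [InnerProductSpace ℂ E] [CompleteSpace E]
  (R : Circle → E ≃ₗᵢ[ℂ] E)

/-- The space of vectors of weight `n` under an action of the circle. -/
def circleWeightSpace (n : ℤ) : Submodule ℂ E where
  carrier := {v | ∀ z, R z v = ((z ^ n : Circle) : ℂ) • v}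
  add_mem' := fun hv hw z => by rw [map_add, hv z, hw z, smul_add]
  zero_mem' := fun z => by simp
  smul_mem' := fun c v hv z => by rw [map_smul, hv z, smul_comm]

theorem isClosed_circleWeightSpace (n : ℤ) : IsClosed (circleWeightSpace R n : Set E) := by
  have : (circleWeightSpace R n : Set E) = ⋂ z, {v | R z v = ((z ^ n : Circle) : ℂ) • v} := by
    ext v
    simp [circleWeightSpace]
  rw [this]
  exact isClosed_iInter fun z => isClosed_eq (R z).continuous (continuous_const_smul _)

instance (n : ℤ) : CompleteSpace (circleWeightSpace R n) :=
  (isClosed_circleWeightSpace R n).completeSpace_coe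

/-- Unitarity gives `⟪v, w⟫ = z^(n-m) ⟪v, w⟫` for every `z`; averaging over the circle kills the
right side. -/
theorem inner_eq_zero_of_weights {m n : ℤ} (h : m ≠ n) {v w : E} (hv : v ∈ circleWeightSpace R m)
    (hw : w ∈ circleWeightSpace R n) : ⟪v, w⟫_ℂ = 0 := by
  have h1 : ∀ z : Circle, ((z ^ (n - m) : Circle) : ℂ) * ⟪v, w⟫_ℂ = ⟪v, w⟫_ℂ := fun z => by
    conv_rhs => rw [← (R z).inner_map_map v w]
    rw [hv z, hw z, inner_smul_left, inner_smul_right, ← mul_assoc,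
      ← Circle.coe_inv_eq_conj, ← Circle.coe_mul, sub_eq_neg_add, zpow_add, zpow_neg]
  have h2 : ∫ z : Circle, ((z ^ (n - m) : Circle) : ℂ) * ⟪v, w⟫_ℂ ∂circleHaar = ⟪v, w⟫_ℂ := by
    simp only [h1]
    simp
  rw [integral_mul_const, integral_zpow, if_neg (sub_ne_zero.2 h.symm), zero_mul] at h2
  exact h2.symm

variable {R} (hR : ∀ a b v, R a (R b v) = R (a * b) v) (hc : ∀ v, Continuous fun z => R z v)

-- This integral is the projection of `v` to weight `n`. Applying `R w` translates the variable, and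
-- invariance of Haar measure turns the translation into the factor `w ^ n`.
include hR hc in
theorem integral_mem_circleWeightSpace (n : ℤ) (v : E) :
    ∫ z, ((z ^ (-n) : Circle) : ℂ) • R z v ∂circleHaar ∈ circleWeightSpace R n := by
  intro w
  have hcont : Continuous fun z : Circle => ((z ^ (-n) : Circle) : ℂ) • R z v :=
    ((circleChar (-n)).continuous).smul (hc v)
  have h1 : R w (∫ z, ((z ^ (-n) : Circle) : ℂ) • R z v ∂circleHaar) =
      ∫ z, R w (((z ^ (-n) : Circle) : ℂ) • R z v) ∂circleHaar :=
    ((R w).toContinuousLinearEquiv.toContinuousLinearMap.integral_comp_comm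
      (integrable_circle hcont)).symm
  rw [h1, ← integral_smul, ← integral_mul_left_eq_self _ w⁻¹]
  refine integral_congr_ae (Filter.Eventually.of_forall fun z => ?_)
  simp only
  rw [map_smul, hR, mul_inv_cancel_left, smul_smul, mul_zpow, inv_zpow, zpow_neg w, inv_inv,
    Circle.coe_mul]

-- If `v` is orthogonal to all weight spaces, then the matrix coefficient `z ↦ ⟪v, R z v⟫` has
-- vanishing Fourier coefficients, because each of these is the inner product of `v` with a weight
-- vector. So the matrix coefficient is zero, and its value at `1` is `‖v‖²`.
include hR hc in
theorem iSup_circleWeightSpace_closure_eq_top :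
    (⨆ n, circleWeightSpace R n).topologicalClosure = ⊤ := by
  rw [Submodule.topologicalClosure_eq_top_iff, Submodule.eq_bot_iff]
  intro v hv
  have hg : Continuous fun z => ⟪v, R z v⟫_ℂ := continuous_const.inner (hc v)
  have h1 : (fun z => ⟪v, R z v⟫_ℂ) = 0 := by
    refine eq_zero_of_integral_zpow_mul hg fun n => ?_
    have hcont : Continuous fun z : Circle => ((z ^ n : Circle) : ℂ) • R z v :=
      ((circleChar n).continuous).smul (hc v)
    have h2 : ∀ z, ((z ^ n : Circle) : ℂ) * ⟪v, R z v⟫_ℂ =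
        ⟪v, ((z ^ n : Circle) : ℂ) • R z v⟫_ℂ := fun z => (inner_smul_right _ _ _).symm
    simp only [h2]
    rw [integral_inner (integrable_circle hcont)]
    have h3 := integral_mem_circleWeightSpace hR hc (-n) v
    rw [neg_neg] at h3
    exact Submodule.inner_left_of_mem_orthogonal
      (Submodule.mem_iSup_of_mem (-n) h3) hv
  have h2 := congrFun h1 1
  have h3 : R 1 v = v := (R 1).injective (by rw [hR, one_mul])
  simp only [h3, Pi.zero_apply, inner_self_eq_zero] at h2
  exact h2

include hR hc in
theorem isHilbertSum_circleWeightSpace :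
    IsHilbertSum ℂ (fun n => circleWeightSpace R n) fun n => (circleWeightSpace R n).subtypeₗᵢ :=
  IsHilbertSum.mkInternal _
    (fun _ _ h v w => inner_eq_zero_of_weights R h v.2 w.2)
    (iSup_circleWeightSpace_closure_eq_top hR hc).ge

end CircleAction

end TwistedCStar
end

noncomputable section

namespace TwistedCStar

/-! ### Direct sums of `C^*`-algebras -/

namespace C0Sum

variable {ι : Type*} {A : ι → Type*} [∀ i, NonUnitalCStarAlgebra (A i)]

theorem ext {x y : C0Sum A} (h : ∀ i, proj i x = proj i y) : x = y :=
  Subtype.ext (Subtype.ext (funext h))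

theorem proj_add (i : ι) (x y : C0Sum A) : proj i (x + y) = proj i x + proj i y := rfl

theorem proj_sub (i : ι) (x y : C0Sum A) : proj i (x - y) = proj i x - proj i y := rfl

theorem proj_zero (i : ι) : proj i (0 : C0Sum A) = 0 := rfl

theorem proj_mul (i : ι) (x y : C0Sum A) : proj i (x * y) = proj i x * proj i y := rfl

theorem proj_smul (i : ι) (c : ℂ) (x : C0Sum A) : proj i (c • x) = c • proj i x := rfl

theorem proj_star (i : ι) (x : C0Sum A) : proj i (star x) = star (proj i x) := rfl

theorem norm_proj_le (i : ι) (x : C0Sum A) : ‖proj i x‖ ≤ ‖x‖ :=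
  lp.norm_apply_le_norm ENNReal.top_ne_zero x.1 i

theorem norm_le {x : C0Sum A} {C : ℝ} (hC : 0 ≤ C) (h : ∀ i, ‖proj i x‖ ≤ C) : ‖x‖ ≤ C :=
  lp.norm_le_of_forall_le hC h

/-- The element of the direct sum with the given components. -/
def mk (x : ∀ i, A i) (hb : BddAbove (Set.range fun i => ‖x i‖))
    (h : Filter.Tendsto (fun i => ‖x i‖) Filter.cofinite (nhds 0)) : C0Sum A :=
  ⟨⟨x, memℓp_infty hb⟩, h⟩

variable (A) in
/-- The projection to a summand as an additive homomorphism. -/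
def projHom (i : ι) : C0Sum A →+ A i where
  toFun := proj i
  map_zero' := rfl
  map_add' _ _ := rfl

variable [DecidableEq ι]

/-- The inclusion of a summand into a direct sum. -/
def single (i : ι) (a : A i) : C0Sum A :=
  mk (Pi.single i a) (by
    refine ⟨‖a‖, ?_⟩
    rintro _ ⟨j, rfl⟩
    by_cases h : j = i
    · subst h; simp
    · simp [Pi.single_eq_of_ne h])
    (tendsto_const_nhds.congr' (by
      filter_upwards [(Set.finite_singleton i).compl_mem_cofinite] with j hj
      rw [Pi.single_eq_of_ne hj, norm_zero]))

theorem proj_single_same (i : ι) (a : A i) : proj i (single i a) = a := Pi.single_eq_same i a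

theorem proj_single_of_ne {i j : ι} (h : j ≠ i) (a : A i) : proj j (single i a) = 0 :=
  Pi.single_eq_of_ne h a

theorem isometry_single (i : ι) : Isometry (single i : A i → C0Sum A) :=
  Isometry.of_dist_eq fun a b => by
    rw [dist_eq_norm, dist_eq_norm]
    refine le_antisymm (norm_le (norm_nonneg _) fun j => ?_) ?_
    · rw [proj_sub]
      by_cases h : j = i
      · subst h; rw [proj_single_same, proj_single_same]
      · rw [proj_single_of_ne h, proj_single_of_ne h, sub_self, norm_zero]; exact norm_nonneg _
    · refine le_trans (le_of_eq ?_) (norm_proj_le i _)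
      rw [proj_sub, proj_single_same, proj_single_same]

/-- A closed additive submonoid which contains all the summands is everything. -/
theorem eq_top_of_single_mem {S : AddSubmonoid (C0Sum A)} (hS : IsClosed (S : Set (C0Sum A)))
    (h : ∀ i a, single i a ∈ S) (x : C0Sum A) : x ∈ S := by
  rw [← SetLike.mem_coe, ← hS.closure_eq, Metric.mem_closure_iff]
  intro ε hε
  have hx : Filter.Tendsto (fun i => ‖proj i x‖) Filter.cofinite (nhds 0) := x.2
  -- Only finitely many components have norm at least `ε / 2`; truncating to them changes `x` by at
  -- most `ε / 2` in the supremum norm.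
  have hF : {i | ¬ ‖proj i x‖ < ε / 2}.Finite := hx.eventually_lt_const (half_pos hε)
  refine ⟨∑ i ∈ hF.toFinset, single i (proj i x), S.sum_mem fun i _ => h i _, ?_⟩
  rw [dist_eq_norm]
  refine (norm_le (half_pos hε).le fun i => ?_).trans_lt (half_lt_self hε)
  have h1 : proj i (∑ j ∈ hF.toFinset, single j (proj j x)) =
      ∑ j ∈ hF.toFinset, proj i (single j (proj j x)) := map_sum (projHom A i) _ _
  rw [proj_sub, h1]
  by_cases hi : i ∈ hF.toFinset
  · rw [Finset.sum_eq_single_of_mem i hi fun j _ hj => proj_single_of_ne hj.symm _,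
      proj_single_same, sub_self, norm_zero]
    exact (half_pos hε).le
  · rw [Finset.sum_eq_zero fun j hj => proj_single_of_ne (by rintro rfl; exact hi hj) _, sub_zero]
    rw [Set.Finite.mem_toFinset, Set.mem_ofPred_eq, not_not] at hi
    exact hi.le

end C0Sum

/-! ### Intertwiners and invariant subspaces -/

/-- The restriction of a unitary operator to a reducing subspace. -/
def restrictIsometry {E : Type*} [NormedAddCommGroup E] [InnerProductSpace ℂ E]
    (U : E ≃ₗᵢ[ℂ] E) (S : Submodule ℂ E) (h : ∀ v ∈ S, U v ∈ S) (h' : ∀ v ∈ S, U.symm v ∈ S) :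
    S ≃ₗᵢ[ℂ] S :=
  LinearIsometryEquiv.ofSurjective
    { toLinearMap := U.toLinearEquiv.toLinearMap.restrict h
      norm_map' := fun v => U.norm_map v }
    fun v => ⟨⟨U.symm v, h' v v.2⟩, Subtype.ext (U.apply_symm_apply v)⟩

section

variable {Γ : Type} [Group Γ] [TopologicalSpace Γ] {σ : Cocycle Γ}

namespace TwistedRep

/-- Inverses differ from the operators `ρ(a⁻¹)` only by scalars of modulus one. Hence invariant
subspaces are automatically reducing. -/
theorem ρ_symm_apply (π : TwistedRep σ) (a : Γ) (v : π.H) :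
    (π.ρ a).symm v = starRingEnd ℂ (σ a a⁻¹ : ℂ) • π.ρ a⁻¹ v := by
  rw [LinearIsometryEquiv.symm_apply_eq, map_smul, π.ρ_mul, mul_inv_cancel, π.ρ_one, smul_smul,
    mul_comm, Complex.mul_conj]
  simp

/-- The restriction of a twisted representation to a closed invariant subspace. -/
def restrict (π : TwistedRep σ) (S : Submodule ℂ π.H) [CompleteSpace S]
    (hS : ∀ a, ∀ v ∈ S, π.ρ a v ∈ S) : TwistedRep σ where
  H := S
  ρ a := restrictIsometry (π.ρ a) S (hS a) fun v hv => by
    rw [ρ_symm_apply]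
    exact S.smul_mem _ (hS _ v hv)
  ρ_mul a b v := Subtype.ext (π.ρ_mul a b v)
  continuous_ρ v := (π.continuous_ρ v).subtype_mk _

end TwistedRep

variable [IsTopologicalGroup Γ]
  [LocallyCompactSpace Γ] [SecondCountableTopology Γ] [MeasurableSpace Γ] [BorelSpace Γ]
  (μ : Measure Γ) [μ.IsHaarMeasure] [μ.IsInvInvariant]

theorem TwistedRep.integrated_intertwine {π π' : TwistedRep σ} (V : π'.H →ₗᵢ[ℂ] π.H)
    (hV : ∀ a x, V (π'.ρ a x) = π.ρ a (V x)) (f : C_c(Γ, ℂ)) (x : π'.H) :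
    π.integrated μ f (V x) = V (π'.integrated μ f x) := by
  rw [integrated_apply, integrated_apply]
  have h := V.toContinuousLinearMap.integral_comp_comm (π'.integrable_smul_ρ μ f x)
  refine Eq.trans ?_ h
  refine integral_congr_ae (Filter.Eventually.of_forall fun a => ?_)
  change f a • π.ρ a (V x) = V (f a • π'.ρ a x)
  rw [map_smul, hV]

end

end TwistedCStar
end

noncomputable section

namespace TwistedCStar

/-! ### The group algebra of a central extension by the circle -/

/-- Multiplication by a complex number of modulus one. -/
def circleSMul {E : Type*} [NormedAddCommGroup E] [InnerProductSpace ℂ E] (z : Circle) :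
    E ≃ₗᵢ[ℂ] E where
  toFun v := (z : ℂ) • v
  invFun v := ((z⁻¹ : Circle) : ℂ) • v
  map_add' := smul_add _
  map_smul' c v := smul_comm _ _ _
  left_inv v := by
    change ((z⁻¹ : Circle) : ℂ) • (z : ℂ) • v = v
    rw [smul_smul, ← Circle.coe_mul, inv_mul_cancel, Circle.coe_one, one_smul]
  right_inv v := by
    change (z : ℂ) • ((z⁻¹ : Circle) : ℂ) • v = v
    rw [smul_smul, ← Circle.coe_mul, mul_inv_cancel, Circle.coe_one, one_smul]
  norm_map' v := by
    change ‖(z : ℂ) • v‖ = ‖v‖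
    rw [norm_smul, Circle.norm_coe, one_mul]

section CentralExtension

variable {Γ : Type} [Group Γ] [TopologicalSpace Γ] {σ : Cocycle Γ}

namespace CentralExt

/-- The element `(a, z)` of the central extension. -/
def of (σ : Cocycle Γ) (a : Γ) (z : Circle) : CentralExt σ := (a, z)

theorem continuous_of : Continuous fun p : Γ × Circle => of σ p.1 p.2 := continuous_id

theorem of_mul_of (a b : Γ) (z w : Circle) :
    of σ a z * of σ b w = of σ (a * b) (z * w * σ a b) := rfl

theorem of_one_mul (a : Γ) (z w : Circle) : of σ 1 z * of σ a w = of σ a (z * w) := by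
  rw [of_mul_of, one_mul, σ.one_left, mul_one]

theorem of_mul_one (a : Γ) (z w : Circle) : of σ a w * of σ 1 z = of σ a (z * w) := by
  rw [of_mul_of, mul_one, σ.one_right, mul_one, mul_comm w]

end CentralExt

open CentralExt

/-- The representation of a central extension attached to a twisted representation, in which the
central circle acts by the character `z ↦ z ^ n`. -/
def TwistedRep.inflate {σ' : Cocycle Γ} (n : ℤ) (hσ : ∀ a b, σ' a b = σ a b ^ n)
    (π : TwistedRep σ') : TwistedRep (1 : Cocycle (CentralExt σ)) where
  H := π.H
  ρ x := (π.ρ x.1).trans (circleSMul (x.2 ^ n))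
  ρ_mul x y v := by
    change ((x.2 ^ n : Circle) : ℂ) • π.ρ x.1 (((y.2 ^ n : Circle) : ℂ) • π.ρ y.1 v) =
      ((1 : Circle) : ℂ) • ((((x.2 * y.2 * σ x.1 y.1) ^ n : Circle) : ℂ) • π.ρ (x.1 * y.1) v)
    rw [map_smul, π.ρ_mul, Circle.coe_one, one_smul, smul_smul, smul_smul, mul_zpow, mul_zpow, hσ,
      Circle.coe_mul, Circle.coe_mul]
  continuous_ρ v := by
    have h1 : Continuous fun x : Γ × Circle => circleChar n x.2 :=
      (circleChar n).continuous.comp continuous_snd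
    exact h1.smul ((π.continuous_ρ v).comp continuous_fst)

/-- The action of the central circle in a representation of a central extension. -/
def TwistedRep.centralAction (π : TwistedRep (1 : Cocycle (CentralExt σ))) (z : Circle) :
    π.H ≃ₗᵢ[ℂ] π.H := π.ρ (of σ 1 z)

theorem TwistedRep.ρ_mul' (π : TwistedRep (1 : Cocycle (CentralExt σ))) (x y : CentralExt σ)
    (v : π.H) : π.ρ x (π.ρ y v) = π.ρ (x * y) v := by
  rw [π.ρ_mul]
  exact one_smul ℂ _

theorem TwistedRep.centralAction_mul (π : TwistedRep (1 : Cocycle (CentralExt σ)))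
    (z w : Circle) (v : π.H) :
    π.centralAction z (π.centralAction w v) = π.centralAction (z * w) v := by
  unfold centralAction
  rw [π.ρ_mul', of_one_mul]

theorem TwistedRep.continuous_centralAction (π : TwistedRep (1 : Cocycle (CentralExt σ)))
    (v : π.H) : Continuous fun z => π.centralAction z v :=
  (π.continuous_ρ v).comp (continuous_of.comp (by fun_prop : Continuous fun z : Circle =>
    ((1, z) : Γ × Circle)))

/-- This follows from `(a, z) = (a, 1)(1, z)`, whose second factor acts on `v` by `z ^ n`. -/
theorem TwistedRep.ρ_of_mem (π : TwistedRep (1 : Cocycle (CentralExt σ))) {n : ℤ} {v : π.H}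
    (hv : v ∈ circleWeightSpace π.centralAction n) (a : Γ) (z : Circle) :
    π.ρ (of σ a z) v = ((z ^ n : Circle) : ℂ) • π.ρ (of σ a 1) v := by
  rw [← map_smul, ← hv z]
  change _ = π.ρ _ (π.ρ (of σ 1 z) v)
  rw [π.ρ_mul', of_mul_one, mul_one]

/-- The circle is central, so the whole extension preserves its weight spaces. -/
theorem TwistedRep.ρ_mem_of_mem (π : TwistedRep (1 : Cocycle (CentralExt σ))) {n : ℤ} {v : π.H}
    (hv : v ∈ circleWeightSpace π.centralAction n) (a : Γ) (w : Circle) :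
    π.ρ (of σ a w) v ∈ circleWeightSpace π.centralAction n := fun z => by
  rw [← map_smul, ← hv z]
  change π.ρ (of σ 1 z) _ = π.ρ _ (π.ρ (of σ 1 z) v)
  rw [π.ρ_mul', π.ρ_mul', of_mul_one, of_one_mul]

/-- The twisted representation on the space of vectors of weight `n` for the central circle. -/
def TwistedRep.weightRep {σ' : Cocycle Γ} (n : ℤ) (hσ : ∀ a b, σ' a b = σ a b ^ n)
    (π : TwistedRep (1 : Cocycle (CentralExt σ))) : TwistedRep σ' where
  H := circleWeightSpace π.centralAction n
  ρ a := restrictIsometry (π.ρ (of σ a 1)) _ (fun v hv => π.ρ_mem_of_mem hv a 1)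
    (fun v hv => by
      rw [ρ_symm_apply]
      exact Submodule.smul_mem _ _ (π.ρ_mem_of_mem hv _ _))
  ρ_mul a b v := Subtype.ext (by
    change π.ρ (of σ a 1) (π.ρ (of σ b 1) v) = (σ' a b : ℂ) • π.ρ (of σ (a * b) 1) v
    rw [π.ρ_mul', of_mul_of, one_mul, one_mul, hσ, ← π.ρ_of_mem v.2])
  continuous_ρ v := ((π.continuous_ρ v).comp (continuous_of.comp
    (by fun_prop : Continuous fun a : Γ => ((a, 1) : Γ × Circle)))).subtype_mk _

variable [IsTopologicalGroup Γ]
  [LocallyCompactSpace Γ] [SecondCountableTopology Γ] [MeasurableSpace Γ] [BorelSpace Γ]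
  (μ : Measure Γ) [μ.IsHaarMeasure] [μ.IsInvInvariant] [SigmaFinite μ]

/-- Where the central circle acts by `z ↦ z ^ n`, the integrated form of a representation of a
central extension factors through the `n`-th weight component. -/
theorem TwistedRep.integrated_component {σ' : Cocycle Γ} {n : ℤ}
    {π : TwistedRep (1 : Cocycle (CentralExt σ))} {π' : TwistedRep σ'} (V : π'.H →ₗᵢ[ℂ] π.H)
    (hV : ∀ a z x, π.ρ (of σ a z) (V x) = ((z ^ n : Circle) : ℂ) • V (π'.ρ a x))
    (f : C_c(CentralExt σ, ℂ)) (x : π'.H) :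
    π.integrated (CentralExt.measure σ μ) f (V x) = V (π'.integrated μ (component σ n f) x) := by
  rw [integrated_apply, integrated_apply]
  have hint : Integrable (fun p : Γ × Circle => f (of σ p.1 p.2) • π.ρ (of σ p.1 p.2) (V x))
      (μ.prod circleHaar) := π.integrable_smul_ρ (CentralExt.measure σ μ) f (V x)
  -- Fubini isolates the integral over the central circle, in which the factor `z ^ n` turns `f(a,
  -- z)` into `f_n(a)`.
  have h1 : ∫ y, f y • π.ρ y (V x) ∂(CentralExt.measure σ μ) =
      ∫ a, ∫ z, f (of σ a z) • π.ρ (of σ a z) (V x) ∂circleHaar ∂μ := integral_prod _ hint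
  have h2 := V.toContinuousLinearMap.integral_comp_comm
    (π'.integrable_smul_ρ μ (component σ n f) x)
  refine h1.trans (Eq.trans ?_ h2)
  refine integral_congr_ae (Filter.Eventually.of_forall fun a => ?_)
  simp only [hV]
  change _ = V ((∫ z, f (of σ a z) * ((z ^ n : Circle) : ℂ) ∂circleHaar) • π'.ρ a x)
  rw [map_smul, ← integral_smul_const]
  simp only [mul_smul]

theorem TwistedRep.integrated_inflate {σ' : Cocycle Γ} (n : ℤ) (hσ : ∀ a b, σ' a b = σ a b ^ n)
    (π : TwistedRep σ') (f : C_c(CentralExt σ, ℂ)) :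
    (π.inflate n hσ).integrated (CentralExt.measure σ μ) f =
      π.integrated μ (component σ n f) := by
  ext x
  exact TwistedRep.integrated_component μ (π := π.inflate n hσ) (π' := π) LinearIsometry.id
    (fun _ _ _ => rfl) f x

/-- Riemann-Lebesgue for continuous functions: a trigonometric polynomial has only finitely many
nonzero coefficients, and a uniform error of size less than `ε` changes each coefficient by less
than `ε`. -/
theorem integral_zpow_mul_tendsto {g : Circle → ℂ} (hg : Continuous g) :
    Filter.Tendsto (fun n : ℤ => ∫ z, g z * ((z ^ n : Circle) : ℂ) ∂circleHaar)
      Filter.cofinite (nhds 0) := by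
  rw [Metric.tendsto_nhds]
  intro ε hε
  obtain ⟨p, hp, hpg⟩ := Metric.mem_closure_iff.1 (dense_span_circleChar ⟨g, hg⟩) ε hε
  have h0 : ∀ᶠ n : ℤ in Filter.cofinite, ∫ z, p z * ((z ^ n : Circle) : ℂ) ∂circleHaar = 0 := by
    have hint : ∀ (q : C(Circle, ℂ)) (n : ℤ),
        Integrable (fun z => q z * ((z ^ n : Circle) : ℂ)) circleHaar := fun q n =>
      integrable_circle (q.continuous.mul (circleChar n).continuous)
    refine Submodule.span_induction (p := fun q _ => ∀ᶠ n : ℤ in Filter.cofinite,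
      ∫ z, q z * ((z ^ n : Circle) : ℂ) ∂circleHaar = 0) ?_ ?_ ?_ ?_ hp
    · rintro _ ⟨m, rfl⟩
      filter_upwards [(Set.finite_singleton (-m)).compl_mem_cofinite] with n hn
      have h1 : ∀ z : Circle, circleChar m z * ((z ^ n : Circle) : ℂ) =
          ((z ^ (m + n) : Circle) : ℂ) := fun z => by
        rw [circleChar_apply, zpow_add, Circle.coe_mul]
      simp only [h1]
      rw [integral_zpow, if_neg]
      intro h
      exact hn (by rw [Set.mem_singleton_iff]; omega)
    · simp
    · intro q r _ _ hq hr
      filter_upwards [hq, hr] with n h1 h2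
      simp only [ContinuousMap.add_apply, add_mul]
      rw [integral_add (hint q n) (hint r n), h1, h2, add_zero]
    · intro c q _ hq
      filter_upwards [hq] with n h1
      simp only [ContinuousMap.smul_apply, smul_eq_mul, mul_assoc]
      rw [integral_const_mul, h1, mul_zero]
  filter_upwards [h0] with n hn
  rw [dist_zero_right]
  have h1 : ∫ z, g z * ((z ^ n : Circle) : ℂ) ∂circleHaar =
      ∫ z, (g z - p z) * ((z ^ n : Circle) : ℂ) ∂circleHaar := by
    simp only [sub_mul]
    rw [integral_sub, hn, sub_zero]
    · exact integrable_circle (hg.mul (circleChar n).continuous)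
    · exact integrable_circle (p.continuous.mul (circleChar n).continuous)
  rw [h1]
  refine lt_of_le_of_lt ?_ hpg
  refine (norm_integral_le_of_norm_le_const (C := dist (⟨g, hg⟩ : C(Circle, ℂ)) p)
    (Filter.Eventually.of_forall fun z => ?_)).trans (by simp)
  rw [norm_mul, Circle.norm_coe, mul_one, dist_eq_norm]
  exact ((⟨g, hg⟩ : C(Circle, ℂ)) - p).norm_coe_le_norm z

/-- The `L¹`-norm dominates the universal norm, so this places the family of components in the
`c₀`-sum. Convergence is pointwise by Riemann-Lebesgue and dominated by `a ↦ ∫ ‖f(a, z)‖ dz`. -/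
theorem tendsto_integral_norm_component (f : C_c(CentralExt σ, ℂ)) :
    Filter.Tendsto (fun n : ℤ => ∫ a, ‖component σ n f a‖ ∂μ) Filter.cofinite (nhds 0) := by
  have hf : Integrable (fun p : Γ × Circle => f (of σ p.1 p.2)) (μ.prod circleHaar) :=
    f.continuous.integrable_of_hasCompactSupport (μ := CentralExt.measure σ μ) f.hasCompactSupport
  have key : Filter.Tendsto (fun n : ℤ => ∫ a, ‖component σ n f a‖ ∂μ) Filter.cofinite
      (nhds (∫ _, 0 ∂μ)) := by
    -- Dominated convergence along a filter requires the filter to be countably generated.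
    have : (Filter.cofinite : Filter ℤ).IsCountablyGenerated := by
      rw [Int.cofinite_eq]; infer_instance
    refine tendsto_integral_filter_of_dominated_convergence
      (fun a => ∫ z, ‖f (of σ a z)‖ ∂circleHaar)
      (Filter.Eventually.of_forall fun n => (component σ n f).continuous.norm.aestronglyMeasurable)
      (Filter.Eventually.of_forall fun n => Filter.Eventually.of_forall fun a => ?_)
      hf.norm.integral_prod_left (Filter.Eventually.of_forall fun a => ?_)
    · rw [norm_norm]
      refine (norm_integral_le_integral_norm _).trans (le_of_eq ?_)
      refine integral_congr_ae (Filter.Eventually.of_forall fun z => ?_)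
      change ‖f (of σ a z) * _‖ = ‖f (of σ a z)‖
      rw [norm_mul, Circle.norm_coe, mul_one]
    · have hg : Continuous fun z => f (of σ a z) :=
        f.continuous.comp (continuous_of.comp (Continuous.prodMk_right a))
      have := (integral_zpow_mul_tendsto hg).norm
      rwa [norm_zero] at this
  simpa using key

/-- The function `(a, z) ↦ g(a) z⁻ⁿ` on the central extension. -/
def inflateFun (σ : Cocycle Γ) (n : ℤ) (g : C_c(Γ, ℂ)) : C_c(CentralExt σ, ℂ) where
  toFun x := g x.1 * ((x.2 ^ (-n) : Circle) : ℂ)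
  continuous_toFun := by
    have h1 : Continuous fun x : Γ × Circle => circleChar (-n) x.2 :=
      (circleChar (-n)).continuous.comp continuous_snd
    exact (g.continuous.comp continuous_fst).mul h1
  hasCompactSupport' := by
    refine HasCompactSupport.intro (α := Γ × Circle)
      (g.hasCompactSupport.isCompact.prod isCompact_univ) fun x hx => ?_
    have : x.1 ∉ tsupport g := fun h => hx ⟨h, Set.mem_univ _⟩
    rw [image_eq_zero_of_notMem_tsupport this, zero_mul]

/-- Orthogonality of characters makes `g(a) z⁻ⁿ` live in the `n`-th summand only. These functions
give the density of the image in the direct sum. -/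
theorem component_inflateFun (m n : ℤ) (g : C_c(Γ, ℂ)) :
    component σ m (inflateFun σ n g) = if m = n then g else 0 := by
  ext a
  change ∫ z, (g a * ((z ^ (-n) : Circle) : ℂ)) * ((z ^ m : Circle) : ℂ) ∂circleHaar = _
  have h1 : ∀ z : Circle, (g a * ((z ^ (-n) : Circle) : ℂ)) * ((z ^ m : Circle) : ℂ) =
      g a * ((z ^ (m - n) : Circle) : ℂ) := fun z => by
    rw [mul_assoc, ← Circle.coe_mul, ← zpow_add, neg_add_eq_sub]
  simp only [h1]
  rw [integral_const_mul, integral_zpow]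
  by_cases h : m = n
  · simp [h]
  · simp [h, sub_eq_zero]

/-- The group algebra of a central extension by the circle is the direct sum of the twisted group
algebras for the powers of the cocycle. -/
theorem exists_starAlgEquiv_centralExt (σ : Cocycle Γ) (σs : ℤ → Cocycle Γ)
    (hσ : ∀ n a b, σs n a b = σ a b ^ n) :
    ∃ Φ : GroupCStar (1 : Cocycle (CentralExt σ)) (CentralExt.measure σ μ)
        ≃⋆ₐ[ℂ] C0Sum (fun n : ℤ => GroupCStar (σs n) μ),
      ∀ (f : C_c(CentralExt σ, ℂ)) (n : ℤ),
        C0Sum.proj n (Φ (toCStar 1 (CentralExt.measure σ μ) f)) =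
          toCStar (σs n) μ (component σ n f) := by
  -- Every representation twisted by `σ ^ n` inflates to one of the extension, so it already
  -- contributes to the supremum on the right.
  have hle : ∀ (f : C_c(CentralExt σ, ℂ)) (n : ℤ), ‖toCStar (σs n) μ (component σ n f)‖ ≤
      ‖toCStar 1 (CentralExt.measure σ μ) f‖ := fun f n =>
    norm_toCStar_le _ _ (norm_nonneg _) fun π => by
      rw [← TwistedRep.integrated_inflate μ n (hσ n)]
      exact norm_integrated_le_norm_toCStar _ _ _
  let φ : C_c(CentralExt σ, ℂ) → C0Sum (fun n : ℤ => GroupCStar (σs n) μ) := fun f =>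
    C0Sum.mk (fun n => toCStar (σs n) μ (component σ n f))
      ⟨‖toCStar 1 (CentralExt.measure σ μ) f‖, by rintro _ ⟨n, rfl⟩; exact hle f n⟩
      (squeeze_zero (fun _ => norm_nonneg _) (fun n => norm_toCStar_le_integral _ _ _)
        (tendsto_integral_norm_component μ f))
  -- Evaluated at `π`, the `n`-th component is the integrated form of the inflation of `π`. So all
  -- algebraic identities for components follow from those of integrated forms, with no computation
  -- of convolutions on the extension.
  have hcomp : ∀ (f : C_c(CentralExt σ, ℂ)) (n : ℤ) (π : TwistedRep (σs n)),
      (toCStar (σs n) μ (component σ n f)).1 π =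
        (π.inflate n (hσ n)).integrated (CentralExt.measure σ μ) f := fun f n π =>
    (TwistedRep.integrated_inflate μ n (hσ n) π f).symm
  have hadd : ∀ f g, φ (f + g) = φ f + φ g := fun f g =>
    C0Sum.ext fun n => Subtype.ext (Subtype.ext (funext fun π => by
      change (toCStar (σs n) μ (component σ n (f + g))).1 π =
        (toCStar (σs n) μ (component σ n f)).1 π + (toCStar (σs n) μ (component σ n g)).1 π
      rw [hcomp, hcomp, hcomp, TwistedRep.integrated_add]; rfl))
  have hφ0 : φ 0 = 0 := by
    have := hadd 0 0
    rw [add_zero] at this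
    exact left_eq_add.1 this
  refine Exists.imp (fun Φ hΦ f n => congrArg (C0Sum.proj n) (hΦ f))
    (exists_starAlgEquiv_groupCStar (1 : Cocycle (CentralExt σ)) (CentralExt.measure σ μ) φ
      ?_ hadd ?_ ?_ ?_ ?_)
  · let S : AddSubmonoid (C0Sum (fun n : ℤ => GroupCStar (σs n) μ)) :=
      { carrier := Set.range φ
        zero_mem' := ⟨0, hφ0⟩
        add_mem' := by
          rintro _ _ ⟨f, rfl⟩ ⟨g, rfl⟩
          exact ⟨f + g, hadd f g⟩ }
    refine fun x => C0Sum.eq_top_of_single_mem (S := S.topologicalClosure)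
      S.isClosed_topologicalClosure (fun n a => ?_) x
    refine (denseRange_toCStar (σs n) μ).induction_on
      (p := fun a => C0Sum.single n a ∈ S.topologicalClosure) a ?_ fun g => ?_
    · exact S.isClosed_topologicalClosure.preimage (C0Sum.isometry_single n).continuous
    · refine S.le_topologicalClosure ⟨inflateFun σ n g, C0Sum.ext fun m => ?_⟩
      change toCStar (σs m) μ (component σ m (inflateFun σ n g)) = _
      rw [component_inflateFun]
      by_cases h : m = n
      · subst h
        rw [if_pos rfl, C0Sum.proj_single_same]
      · rw [if_neg h, C0Sum.proj_single_of_ne h]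
        have := toCStar_smul (σs m) μ 0 0
        rwa [zero_smul, zero_smul] at this
  · exact fun c f => C0Sum.ext fun n => Subtype.ext (Subtype.ext (funext fun π => by
      change (toCStar (σs n) μ (component σ n (c • f))).1 π =
        c • (toCStar (σs n) μ (component σ n f)).1 π
      rw [hcomp, hcomp, TwistedRep.integrated_smul]; rfl))
  · exact fun f g => C0Sum.ext fun n => Subtype.ext (Subtype.ext (funext fun π => by
      change (toCStar (σs n) μ (component σ n (conv 1 (CentralExt.measure σ μ) f g))).1 π =
        (toCStar (σs n) μ (component σ n f)).1 π * (toCStar (σs n) μ (component σ n g)).1 π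
      rw [hcomp, hcomp, hcomp, TwistedRep.integrated_conv]; rfl))
  · exact fun f => C0Sum.ext fun n => Subtype.ext (Subtype.ext (funext fun π => by
      change (toCStar (σs n) μ (component σ n (invol 1 f))).1 π =
        star ((toCStar (σs n) μ (component σ n f)).1 π)
      rw [hcomp, hcomp, TwistedRep.integrated_invol]; rfl))
  · intro f
    refine le_antisymm (C0Sum.norm_le (norm_nonneg _) (hle f)) ?_
    -- Conversely, an arbitrary representation of the extension splits into weight spaces of the
    -- central circle, and on weight `n` the operator is the integrated form of a twisted
    -- representation at `f_n`.
    refine norm_toCStar_le _ _ (norm_nonneg _) fun π => ?_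
    refine opNorm_le_of_isHilbertSum
      (isHilbertSum_circleWeightSpace π.centralAction_mul π.continuous_centralAction)
      _ (fun n => (π.weightRep n (hσ n)).integrated μ (component σ n f)) (fun n x => ?_)
      (norm_nonneg _) (fun n => ?_)
    · exact TwistedRep.integrated_component μ (π' := π.weightRep n (hσ n))
        (circleWeightSpace π.centralAction n).subtypeₗᵢ (fun a z x => π.ρ_of_mem x.2 a z) f x
    · exact (norm_integrated_le_norm_toCStar _ _ _).trans (C0Sum.norm_proj_le n (φ f))

end CentralExtension

end TwistedCStar
end

noncomputable section

namespace TwistedCStar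

open InnerProductSpace (rankOne)

/-! ### Compact operators -/

section CompactOperators

variable {H : Type*} [NormedAddCommGroup H] [InnerProductSpace ℂ H] [CompleteSpace H]

namespace CompactOps

/-- A compact operator as an element of the algebra of compact operators. -/
def mk (T : H →L[ℂ] H) (hT : IsCompactOperator T) : CompactOps H := ⟨T, hT⟩

theorem ext {S T : CompactOps H} (h : S.toCLM = T.toCLM) : S = T := Subtype.ext h

theorem toCLM_add (S T : CompactOps H) : (S + T).toCLM = S.toCLM + T.toCLM := rfl

theorem toCLM_sub (S T : CompactOps H) : (S - T).toCLM = S.toCLM - T.toCLM := rfl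

theorem toCLM_zero : (0 : CompactOps H).toCLM = 0 := rfl

theorem toCLM_smul (c : ℂ) (T : CompactOps H) : (c • T).toCLM = c • T.toCLM := rfl

theorem norm_toCLM (T : CompactOps H) : ‖T.toCLM‖ = ‖T‖ := rfl

theorem isCompactOperator (T : CompactOps H) : IsCompactOperator T.toCLM := T.2

/-- The inclusion of the compact operators into the bounded operators. -/
def toCLMHom (H : Type*) [NormedAddCommGroup H] [InnerProductSpace ℂ H] [CompleteSpace H] :
    CompactOps H →⋆ₙₐ[ℂ] (H →L[ℂ] H) where
  toFun := toCLM
  map_smul' _ _ := rfl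
  map_zero' := rfl
  map_add' _ _ := rfl
  map_mul' _ _ := rfl
  map_star' _ := rfl

end CompactOps

theorem isCompactOperator_rankOne (x y : H) : IsCompactOperator (rankOne ℂ x y) := by
  rw [InnerProductSpace.rankOne_def']
  have h : IsCompactOperator (innerSL ℂ y : H →L[ℂ] ℂ) :=
    isCompactOperator_of_locallyCompactSpace_dom _
  exact h.clm_comp (ContinuousLinearMap.toSpanSingleton ℂ x)

/-- The operator `v ↦ ⟪y, v⟫ x`, as a compact operator. -/
def CompactOps.rankOne (x y : H) : CompactOps H :=
  CompactOps.mk (InnerProductSpace.rankOne ℂ x y) (isCompactOperator_rankOne x y)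

theorem CompactOps.toCLM_rankOne (x y : H) :
    (CompactOps.rankOne x y).toCLM = InnerProductSpace.rankOne ℂ x y := rfl

theorem CompactOps.star_rankOne (x y : H) :
    star (CompactOps.rankOne x y) = CompactOps.rankOne y x :=
  CompactOps.ext (InnerProductSpace.adjoint_rankOne x y)

theorem CompactOps.rankOne_mul_rankOne (x y z w : H) :
    CompactOps.rankOne x y * CompactOps.rankOne z w = ⟪y, z⟫_ℂ • CompactOps.rankOne x w :=
  CompactOps.ext (InnerProductSpace.rankOne_comp_rankOne x y z w)

/-- A compact operator is approximated by its compressions to finite-dimensional subspaces of the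
target. -/
theorem exists_finiteDimensional_norm_sub_le {T : H →L[ℂ] H} (hT : IsCompactOperator T) {ε : ℝ}
    (hε : 0 < ε) : ∃ U : Submodule ℂ H, ∃ _ : FiniteDimensional ℂ U,
      ‖T - U.starProjection * T‖ ≤ ε := by
  have htb : TotallyBounded (T '' Metric.closedBall 0 1) :=
    ((isCompactOperator_iff_isCompact_closure_image_closedBall
      (T : H →ₗ[ℂ] H) one_pos).1 hT).totallyBounded.subset subset_closure
  -- The subspace is the span of a finite `ε`-net of the image of the unit ball. The distance from
  -- `T x` to the span is at most its distance to the net.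
  obtain ⟨t, htf, htc⟩ := Metric.totallyBounded_iff.1 htb ε hε
  have hfin : FiniteDimensional ℂ (Submodule.span ℂ t) := FiniteDimensional.span_of_finite ℂ htf
  refine ⟨Submodule.span ℂ t, hfin, ?_⟩
  refine ContinuousLinearMap.opNorm_le_of_unit_norm hε.le fun x hx => ?_
  obtain ⟨y, hy, hxy⟩ := Set.mem_iUnion₂.1
    (htc ⟨x, by rw [mem_closedBall_zero_iff]; exact hx.le, rfl⟩)
  change ‖T x - (Submodule.span ℂ t).starProjection (T x)‖ ≤ ε
  have hy' : dist (T x) y < ε := hxy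
  rw [dist_eq_norm] at hy'
  rw [(Submodule.span ℂ t).starProjection_minimal (T x)]
  refine (ciInf_le ⟨0, ?_⟩ (⟨y, Submodule.subset_span hy⟩ : Submodule.span ℂ t)).trans hy'.le
  rintro _ ⟨w, rfl⟩
  exact norm_nonneg _

/-- A closed linear space of compact operators which contains the operators `e ↦ ⟪b, e⟫ a` for `a`,
`b` in a total set is everything. -/
theorem CompactOps.eq_top_of_rankOne_mem {M : Submodule ℂ (CompactOps H)}
    (hM : IsClosed (M : Set (CompactOps H))) {s : Set H}
    (hs : (Submodule.span ℂ s).topologicalClosure = ⊤)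
    (h : ∀ a ∈ s, ∀ b ∈ s, CompactOps.rankOne a b ∈ M) (T : CompactOps H) : T ∈ M := by
  have hdense : ∀ (N : Submodule ℂ H), IsClosed (N : Set H) → s ⊆ N → ∀ x, x ∈ N := by
    intro N hN hsN x
    have h1 : (Submodule.span ℂ s).topologicalClosure ≤ N :=
      Submodule.topologicalClosure_minimal _ (Submodule.span_le.2 hsN) hN
    exact h1 (hs ▸ Submodule.mem_top)
  have hisom : ∀ x y : H, ‖CompactOps.rankOne x y‖ = ‖x‖ * ‖y‖ := fun x y =>
    InnerProductSpace.norm_rankOne x y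
  have hadd1 : ∀ x x' y : H, CompactOps.rankOne (x + x') y =
      CompactOps.rankOne x y + CompactOps.rankOne x' y := fun x x' y =>
    CompactOps.ext (by simp [CompactOps.toCLM_rankOne, CompactOps.toCLM_add])
  have hsmul1 : ∀ (c : ℂ) (x y : H), CompactOps.rankOne (c • x) y =
      c • CompactOps.rankOne x y := fun c x y =>
    CompactOps.ext (by simp [CompactOps.toCLM_rankOne, CompactOps.toCLM_smul])
  have hadd2 : ∀ x y y' : H, CompactOps.rankOne x (y + y') =
      CompactOps.rankOne x y + CompactOps.rankOne x y' := fun x y y' =>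
    CompactOps.ext (by simp [CompactOps.toCLM_rankOne, CompactOps.toCLM_add])
  have hsmul2 : ∀ (c : ℂ) (x y : H), CompactOps.rankOne x (c • y) =
      starRingEnd ℂ c • CompactOps.rankOne x y := fun c x y =>
    CompactOps.ext (by simp [CompactOps.toCLM_rankOne, CompactOps.toCLM_smul])
  have h0 : ∀ x y : H, x = 0 ∨ y = 0 → CompactOps.rankOne x y = 0 := by
    rintro x y (rfl | rfl) <;>
    exact CompactOps.ext (by simp [CompactOps.toCLM_rankOne, CompactOps.toCLM_zero])
  have hc1 : ∀ y : H, Continuous fun x => CompactOps.rankOne x y := fun y => by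
    let L : H →ₗ[ℂ] CompactOps H :=
      { toFun := fun x => CompactOps.rankOne x y
        map_add' := fun x x' => hadd1 x x' y
        map_smul' := fun c x => hsmul1 c x y }
    exact AddMonoidHomClass.continuous_of_bound L ‖y‖ fun x => by
      rw [mul_comm]; exact (hisom x y).le
  have hc2 : ∀ x : H, Continuous fun y => CompactOps.rankOne x y := fun x => by
    have h1 : (fun y => CompactOps.rankOne x y) = fun y => star (CompactOps.rankOne y x) :=
      funext fun y => (CompactOps.star_rankOne y x).symm
    rw [h1]
    exact (hc1 x).star
  -- Membership extends from `s` to all vectors one argument at a time: for a fixed other argument,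
  -- the admissible vectors form a closed subspace containing `s`.
  have hr1 : ∀ b ∈ s, ∀ x, CompactOps.rankOne x b ∈ M := fun b hb =>
    hdense
      { carrier := {x | CompactOps.rankOne x b ∈ M}
        add_mem' := fun {x y} hx hy => by
          rw [Set.mem_ofPred_eq, hadd1]; exact M.add_mem hx hy
        zero_mem' := by rw [Set.mem_ofPred_eq, h0 _ _ (Or.inl rfl)]; exact M.zero_mem
        smul_mem' := fun c x hx => by rw [Set.mem_ofPred_eq, hsmul1]; exact M.smul_mem c hx }
      (hM.preimage (hc1 b)) fun a ha => h a ha b hb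
  have hr2 : ∀ x y, CompactOps.rankOne x y ∈ M := fun x =>
    hdense
      { carrier := {y | CompactOps.rankOne x y ∈ M}
        add_mem' := fun {y z} hy hz => by
          rw [Set.mem_ofPred_eq, hadd2]; exact M.add_mem hy hz
        zero_mem' := by rw [Set.mem_ofPred_eq, h0 _ _ (Or.inr rfl)]; exact M.zero_mem
        smul_mem' := fun c y hy => by rw [Set.mem_ofPred_eq, hsmul2]; exact M.smul_mem _ hy }
      (hM.preimage (hc2 x)) fun b hb => hr1 b hb x
  rw [← SetLike.mem_coe, ← hM.closure_eq, Metric.mem_closure_iff]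
  intro ε hε
  obtain ⟨U, hU, hUT⟩ := exists_finiteDimensional_norm_sub_le T.isCompactOperator (half_pos hε)
  let b := stdOrthonormalBasis ℂ U
  refine ⟨∑ i, CompactOps.rankOne (b i : H) (star T.toCLM (b i)),
    M.sum_mem fun i _ => hr2 _ _, ?_⟩
  -- Expanding the projection to `U` in an orthonormal basis `b` exhibits the compression of `T` as
  -- the finite sum of the operators `v ↦ ⟪T^* b_i, v⟫ b_i`.
  have h1 : (∑ i, CompactOps.rankOne (b i : H) (star T.toCLM (b i))).toCLM =
      U.starProjection * T.toCLM := by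
    have h2 : (∑ i, CompactOps.rankOne (b i : H) (star T.toCLM (b i))).toCLM =
      ∑ i, (CompactOps.rankOne (b i : H) (star T.toCLM (b i))).toCLM :=
        map_sum (CompactOps.toCLMHom H) _ _
    rw [h2, b.starProjection_eq_sum_rankOne, Finset.sum_mul]
    refine Finset.sum_congr rfl fun i _ => ?_
    ext v
    change ⟪star T.toCLM (b i), v⟫_ℂ • (b i : H) = ⟪(b i : H), T.toCLM v⟫_ℂ • (b i : H)
    rw [ContinuousLinearMap.star_eq_adjoint, ContinuousLinearMap.adjoint_inner_left]
  rw [dist_eq_norm, ← CompactOps.norm_toCLM, CompactOps.toCLM_sub, h1]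
  exact hUT.trans_lt (half_lt_self hε)

end CompactOperators

end TwistedCStar
end

noncomputable section

namespace TwistedCStar

/-! ### Monomials on `T × Π_T` -/

section Monomials

/-- The element `(t, m)` of `T × Π_T`. -/
def tpi (t : Circle) (m : ℤ) : TPi := (t, Multiplicative.ofAdd m)

theorem continuous_tpi (m : ℤ) : Continuous fun t => tpi t m := by
  unfold tpi; fun_prop

theorem tpi_eta (a : TPi) : tpi a.1 (Multiplicative.toAdd a.2) = a := rfl

/-- The function on `T × Π_T` given by `p` on `T × {m}` and vanishing elsewhere. -/
def slice (m : ℤ) (p : C(Circle, ℂ)) : C_c(TPi, ℂ) where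
  toFun a := if Multiplicative.toAdd a.2 = m then p a.1 else 0
  continuous_toFun := by
    refine continuous_prod_of_discrete_right.2 fun n => ?_
    by_cases h : Multiplicative.toAdd n = m
    · simpa only [if_pos h] using p.continuous
    · simpa only [if_neg h] using continuous_const
  hasCompactSupport' := by
    refine HasCompactSupport.intro (K := Set.univ ×ˢ {Multiplicative.ofAdd m})
      (isCompact_univ.prod isCompact_singleton) fun a ha => if_neg fun h => ha ?_
    exact ⟨Set.mem_univ _, h⟩

theorem slice_apply (m : ℤ) (p : C(Circle, ℂ)) (a : TPi) :
    slice m p a = if Multiplicative.toAdd a.2 = m then p a.1 else 0 := rfl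

theorem slice_tpi (m n : ℤ) (p : C(Circle, ℂ)) (t : Circle) :
    slice m p (tpi t n) = if n = m then p t else 0 := rfl

theorem slice_add (m : ℤ) (p q : C(Circle, ℂ)) : slice m (p + q) = slice m p + slice m q := by
  ext a
  change slice m (p + q) a = slice m p a + slice m q a
  simp only [slice_apply, ContinuousMap.add_apply]
  split_ifs <;> simp

theorem slice_smul (m : ℤ) (c : ℂ) (p : C(Circle, ℂ)) : slice m (c • p) = c • slice m p := by
  ext a
  change slice m (c • p) a = c • slice m p a
  simp only [slice_apply, ContinuousMap.smul_apply]
  split_ifs <;> simp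

/-- The monomial `t ↦ t ^ j` on `T × {m}`. -/
def torusMonomial (j m : ℤ) : C_c(TPi, ℂ) := slice m (circleChar j)

theorem integral_eq_of_supported {E : Type*} [NormedAddCommGroup E] [NormedSpace ℝ E]
    [CompleteSpace E] {F : TPi → E} (hF : Integrable F haarTPi) (m : ℤ)
    (h : ∀ t n, n ≠ m → F (tpi t n) = 0) :
    ∫ a, F a ∂haarTPi = ∫ t, F (tpi t m) ∂circleHaar := by
  refine (integral_prod F hF).trans (integral_congr_ae (Filter.Eventually.of_forall fun t => ?_))
  change ∫ n, F (tpi t (Multiplicative.toAdd n)) ∂Measure.count = F (tpi t m)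
  rw [← setIntegral_eq_integral_of_forall_compl_eq_zero (s := {Multiplicative.ofAdd m})
    fun n hn => h t (Multiplicative.toAdd n) hn, integral_singleton]
  simp [tpi, Measure.real]

theorem integral_norm_slice_le (m : ℤ) (p : C(Circle, ℂ)) :
    ∫ a, ‖slice m p a‖ ∂haarTPi ≤ ‖p‖ := by
  have hint : Integrable (fun a => ‖slice m p a‖) haarTPi :=
    ((slice m p).continuous.integrable_of_hasCompactSupport (slice m p).hasCompactSupport).norm
  rw [integral_eq_of_supported hint m fun t n hn => by rw [slice_tpi, if_neg hn, norm_zero]]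
  have h1 : ∀ t, ‖‖slice m p (tpi t m)‖‖ ≤ ‖p‖ := fun t => by
    rw [norm_norm, slice_tpi, if_pos rfl]
    exact p.norm_coe_le_norm t
  refine (le_abs_self _).trans ((norm_integral_le_of_norm_le_const
    (Filter.Eventually.of_forall h1)).trans (by simp))

/-- A linear property of functions in `C_c(T × Π_T)` which is closed in the `L¹`-norm holds for
every function once it holds for the monomials. -/
theorem torusMonomial_induction {P : C_c(TPi, ℂ) → Prop} (hmon : ∀ j m, P (torusMonomial j m))
    (hadd : ∀ f g, P f → P g → P (f + g)) (hsmul : ∀ (c : ℂ) f, P f → P (c • f))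
    (hclosed : ∀ f, (∀ ε > 0, ∃ g, P g ∧ ∫ a, ‖f a - g a‖ ∂haarTPi < ε) → P f)
    (f : C_c(TPi, ℂ)) : P f := by
  have h0 : P 0 := by simpa using hsmul 0 _ (hmon 0 0)
  have hslice : ∀ m p, P (slice m p) := fun m p => by
    refine hclosed _ fun ε hε => ?_
    -- On a single copy of `T`, which has mass one, uniform approximation by trigonometric
    -- polynomials is also `L¹`-approximation.
    obtain ⟨q, hq, hpq⟩ := Metric.mem_closure_iff.1 (dense_span_circleChar p) ε hε
    refine ⟨slice m q, ?_, ?_⟩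
    · refine Submodule.span_induction (p := fun q _ => P (slice m q)) ?_ ?_ ?_ ?_ hq
      · rintro _ ⟨j, rfl⟩
        exact hmon j m
      · have : slice m 0 = 0 := by
          simpa using slice_smul m 0 0
        rwa [this]
      · intro q r _ _ h1 h2
        rw [slice_add]
        exact hadd _ _ h1 h2
      · intro c q _ h1
        rw [slice_smul]
        exact hsmul _ _ h1
    · refine lt_of_le_of_lt ?_ hpq
      rw [dist_eq_norm]
      refine le_trans (le_of_eq ?_) (integral_norm_slice_le m (p - q))
      refine integral_congr_ae (Filter.Eventually.of_forall fun a => ?_)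
      simp only [slice_apply, ContinuousMap.sub_apply]
      split_ifs <;> simp
  -- A compact set meets only finitely many of the copies `T × {m}`, so `f` is a finite sum of
  -- slices.
  have hK : ((fun a : TPi => Multiplicative.toAdd a.2) '' tsupport f).Finite :=
    (isCompact_iff_finite (X := ℤ)).1
      (f.hasCompactSupport.isCompact.image (continuous_of_discreteTopology.comp continuous_snd))
  have hf : f = ∑ m ∈ hK.toFinset, slice m ⟨fun t => f (tpi t m),
      f.continuous.comp (continuous_tpi m)⟩ := by
    ext a
    rw [CompactlySupportedContinuousMap.coe_sum, Finset.sum_apply]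
    simp only [slice_apply, ContinuousMap.coe_mk]
    rw [Finset.sum_ite_eq]
    split_ifs with h
    · rfl
    · refine image_eq_zero_of_notMem_tsupport fun h' => h ?_
      rw [Set.Finite.mem_toFinset]
      exact ⟨a, h', rfl⟩
  rw [hf]
  exact Finset.sum_induction _ P hadd h0 fun m _ => hslice m _

end Monomials

/-! ### Weight spaces of twisted representations of `T × Π_T` -/

section Weights

variable {κ : ℤ →+ ℤ} (π : TwistedRep (tau κ))

/-- The action of `T` in a twisted representation of `T × Π_T`. -/
def TwistedRep.torusAction (t : Circle) : π.H ≃ₗᵢ[ℂ] π.H := π.ρ (t, 1)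

theorem mem_weightSpace {l : ℤ} {v : π.H} :
    v ∈ weightSpace π l ↔ ∀ t, π.ρ (tpi t 0) v = ((t ^ l : Circle) : ℂ) • v := Iff.rfl

theorem TwistedRep.ρ_tpi_tpi (s t : Circle) (m n : ℤ) (v : π.H) :
    π.ρ (tpi s m) (π.ρ (tpi t n) v) = ((t ^ κ m : Circle) : ℂ) • π.ρ (tpi (s * t) (m + n)) v :=
  π.ρ_mul _ _ v

theorem TwistedRep.ρ_torus_mul (t : Circle) (m n : ℤ) (v : π.H) :
    π.ρ (tpi t m) (π.ρ (tpi 1 n) v) = π.ρ (tpi t (m + n)) v := by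
  rw [ρ_tpi_tpi, one_zpow, Circle.coe_one, one_smul, mul_one]

theorem TwistedRep.torusAction_mul (s t : Circle) (v : π.H) :
    π.torusAction s (π.torusAction t v) = π.torusAction (s * t) v := by
  have h := π.ρ_tpi_tpi s t 0 0 v
  rw [map_zero, zpow_zero, Circle.coe_one, one_smul] at h
  exact h

theorem TwistedRep.continuous_torusAction (v : π.H) : Continuous fun t => π.torusAction t v :=
  (π.continuous_ρ v).comp (continuous_tpi 0)

instance (l : ℤ) : CompleteSpace (weightSpace π l) :=
  inferInstanceAs (CompleteSpace (circleWeightSpace π.torusAction l))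

theorem isHilbertSum_weightSpace :
    IsHilbertSum ℂ (fun l => weightSpace π l) fun l => (weightSpace π l).subtypeₗᵢ :=
  isHilbertSum_circleWeightSpace π.torusAction_mul π.continuous_torusAction

variable {π}

/-- Compare the two evaluations of `ρ(1, m) ρ(t, 0) v`: the weight gives `t^l ρ(1, m) v`, and the
cocycle gives `t^κ(m) ρ(t, m) v`. -/
theorem ρ_tpi_of_mem_weightSpace {l : ℤ} {v : π.H} (hv : v ∈ weightSpace π l) (t : Circle)
    (m : ℤ) : π.ρ (tpi t m) v = ((t ^ (l - κ m) : Circle) : ℂ) • π.ρ (tpi 1 m) v := by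
  have h1 := π.ρ_tpi_tpi 1 t m 0 v
  rw [(mem_weightSpace π).1 hv t, map_smul, one_mul, add_zero] at h1
  rw [sub_eq_neg_add, zpow_add, Circle.coe_mul, mul_smul, h1, smul_smul, ← Circle.coe_mul,
    ← zpow_add, neg_add_cancel, zpow_zero, Circle.coe_one, one_smul]

theorem ρ_tpi_one_mem_weightSpace {l : ℤ} {v : π.H} (hv : v ∈ weightSpace π l) (m : ℤ) :
    π.ρ (tpi 1 m) v ∈ weightSpace π (l - κ m) := by
  rw [mem_weightSpace]
  intro t
  rw [π.ρ_torus_mul, zero_add, ρ_tpi_of_mem_weightSpace hv]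

theorem inner_eq_zero_of_mem_weightSpace {l l' : ℤ} (h : l ≠ l') {v w : π.H}
    (hv : v ∈ weightSpace π l) (hw : w ∈ weightSpace π l') : ⟪v, w⟫_ℂ = 0 :=
  inner_eq_zero_of_weights π.torusAction h hv hw

/-- On weight `l` the integrand is `t^(j + l - κ(m))` times a constant vector, so the integral
selects one weight. -/
theorem integrated_torusMonomial (j m : ℤ) {l : ℤ} {v : π.H} (hv : v ∈ weightSpace π l) :
    π.integrated haarTPi (torusMonomial j m) v =
      if l = κ m - j then π.ρ (tpi 1 m) v else 0 := by
  rw [TwistedRep.integrated_apply, integral_eq_of_supported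
    (π.integrable_smul_ρ haarTPi (torusMonomial j m) v) m fun t n hn => by
      rw [torusMonomial, slice_tpi, if_neg hn, zero_smul]]
  have h1 : ∀ t, torusMonomial j m (tpi t m) • π.ρ (tpi t m) v =
      ((t ^ (j + (l - κ m)) : Circle) : ℂ) • π.ρ (tpi 1 m) v := fun t => by
    rw [torusMonomial, slice_tpi, if_pos rfl, ρ_tpi_of_mem_weightSpace hv, smul_smul,
      circleChar_apply, ← Circle.coe_mul, ← zpow_add]
  simp only [h1]
  rw [integral_smul_const, integral_zpow]
  by_cases h : l = κ m - j
  · rw [if_pos h, if_pos (by omega), one_smul]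
  · rw [if_neg h, if_neg (by omega), zero_smul]

end Weights

end TwistedCStar
end

noncomputable section

namespace TwistedCStar

/-! ### The representations `V_{[λ]}` -/

section Irreducibles

variable {κ : ℤ →+ ℤ}

theorem apply_eq_mul (κ : ℤ →+ ℤ) (m : ℤ) : κ m = m * κ 1 := by
  have h := map_zsmul κ m 1
  rwa [smul_eq_mul, mul_one, smul_eq_mul] at h

theorem injective_of_ne_zero (hκ : κ ≠ 0) : Function.Injective κ := by
  have h1 : κ 1 ≠ 0 := fun h => hκ (AddMonoidHom.ext_int h)
  intro m n h
  rw [apply_eq_mul κ m, apply_eq_mul κ n] at h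
  exact mul_right_cancel₀ h1 h

/-- The subgroup generated by `κ(1) ≠ 0` has index `|κ(1)|` and lies in the image of `κ`. -/
theorem finite_quotient_range (hκ : κ ≠ 0) : Finite (ℤ ⧸ κ.range) := by
  have h1 : κ 1 ≠ 0 := fun h => hκ (AddMonoidHom.ext_int h)
  have h2 : AddSubgroup.zmultiples (κ 1) ≤ κ.range := by
    rw [AddSubgroup.zmultiples_le]
    exact ⟨1, rfl⟩
  have h3 : (AddSubgroup.zmultiples (κ 1)).FiniteIndex :=
    ⟨by rw [Int.index_zmultiples]; exact Int.natAbs_ne_zero.2 h1⟩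
  have h4 : κ.range.FiniteIndex := AddSubgroup.finiteIndex_of_le h2
  infer_instance

variable {c : ℤ ⧸ κ.range}

theorem exists_sub_eq (l l' : Weights κ c) : ∃ m, l.1 - κ m = l'.1 := by
  obtain ⟨k, hk⟩ := QuotientAddGroup.eq.1 (l.2.trans l'.2.symm)
  exact ⟨-k, by rw [map_neg, hk]; abel⟩

theorem nonempty_weights (c : ℤ ⧸ κ.range) : Nonempty (Weights κ c) :=
  ⟨⟨c.out, QuotientAddGroup.out_eq' c⟩⟩

/-- The basis vector of weight `l`. -/
def basisVec (l : Weights κ c) : (V κ c).H := (lp.single 2 l 1 : VSpace κ c)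

theorem norm_basisVec (l : Weights κ c) : ‖basisVec l‖ = 1 := by
  have h : ‖(lp.single 2 l 1 : VSpace κ c)‖ = ‖(1 : ℂ)‖ :=
    lp.norm_single (E := fun _ : Weights κ c => ℂ) (p := 2) (by norm_num) l 1
  rwa [norm_one] at h

theorem V_ρ_basisVec (l : Weights κ c) (t : Circle) (m : ℤ) :
    (V κ c).ρ (tpi t m) (basisVec l) =
      ((t ^ (l.1 - κ m) : Circle) : ℂ) • basisVec ((shift κ c m).symm l) := by
  change action t m (lp.single 2 l 1 : VSpace κ c) =
    ((t ^ (l.1 - κ m) : Circle) : ℂ) • (lp.single 2 ((shift κ c m).symm l) 1 : VSpace κ c)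
  ext l'
  rw [action_apply, lp.coeFn_smul, Pi.smul_apply, lp.single_apply, lp.single_apply, smul_eq_mul]
  by_cases h : l' = (shift κ c m).symm l
  · subst h
    rw [Equiv.apply_symm_apply, Pi.single_eq_same, Pi.single_eq_same]
    rfl
  · rw [Pi.single_eq_of_ne h, Pi.single_eq_of_ne fun h' => h ((Equiv.symm_apply_eq _).2 h'.symm).symm]
    simp

theorem basisVec_mem_weightSpace (l : Weights κ c) : basisVec l ∈ weightSpace (V κ c) l.1 := by
  rw [mem_weightSpace]
  intro t
  rw [V_ρ_basisVec]
  congr 2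
  · simp
    rfl
  · rw [Equiv.symm_apply_eq]
    ext
    change l.1 = l.1 + κ 0
    simp

theorem inner_basisVec (l l' : Weights κ c) :
    ⟪basisVec l, basisVec l'⟫_ℂ = if l = l' then 1 else 0 := by
  split_ifs with h
  · rw [h, inner_self_eq_norm_sq_to_K, norm_basisVec]; simp
  · exact inner_eq_zero_of_mem_weightSpace (fun e => h (Subtype.ext e))
      (basisVec_mem_weightSpace l) (basisVec_mem_weightSpace l')

theorem clm_ext_basisVec {F : Type*} [NormedAddCommGroup F] [NormedSpace ℂ F]
    {S T : (V κ c).H →L[ℂ] F} (h : ∀ l, S (basisVec l) = T (basisVec l)) : S = T := by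
  refine lp.ext_continuousLinearMap (E := fun _ : Weights κ c => ℂ) (p := 2) (by norm_num)
    fun l => ?_
  ext
  exact h l

theorem span_basisVec_closure (c : ℤ ⧸ κ.range) :
    (Submodule.span ℂ (Set.range (basisVec (c := c)))).topologicalClosure = ⊤ := by
  rw [eq_top_iff]
  intro y _
  let x : VSpace κ c := y
  have hx := lp.hasSum_single (E := fun _ : Weights κ c => ℂ) (p := 2) (by norm_num) x
  refine mem_closure_of_tendsto hx (Filter.Eventually.of_forall fun s => ?_)
  refine Submodule.sum_mem _ fun l _ => ?_
  have h1 : (lp.single 2 l (x l) : VSpace κ c) = (x l) • (lp.single 2 l 1 : VSpace κ c) := by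
    rw [← lp.single_smul, smul_eq_mul, mul_one]
  have h2 : x l • basisVec l ∈ Submodule.span ℂ (Set.range (basisVec (c := c))) :=
    Submodule.smul_mem _ _ (Submodule.subset_span ⟨l, rfl⟩)
  rw [h1]
  exact h2

/-- A unit vector of weight `l₀` in a twisted representation generates a copy of `V_{[l₀]}`. -/
theorem exists_intertwiner (hκ : κ ≠ 0) (π : TwistedRep (tau κ)) (l₀ : Weights κ c) {v : π.H}
    (hv : v ∈ weightSpace π l₀.1) (hv1 : ‖v‖ = 1) :
    ∃ W : (V κ c).H →ₗᵢ[ℂ] π.H, (∀ a x, W ((V κ c).ρ a x) = π.ρ a (W x)) ∧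
      W (basisVec l₀) = v := by
  have hinj := injective_of_ne_zero hκ
  -- The integer `m l` translates `l₀` to `l`. By injectivity of `κ` it is unique, which makes the
  -- translates `u l` compatible with the action of `Π_T` and gives `u l₀ = v`.
  choose m hm using exists_sub_eq l₀
  let u : Weights κ c → π.H := fun l => π.ρ (tpi 1 (m l)) v
  have hu1 : ∀ l, ‖u l‖ = 1 := fun l => by rw [LinearIsometryEquiv.norm_map, hv1]
  have hu : ∀ l, u l ∈ weightSpace π l.1 := fun l => by
    have := ρ_tpi_one_mem_weightSpace hv (m l)
    rwa [hm] at this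
  have hort : OrthogonalFamily ℂ (fun _ : Weights κ c => ℂ)
      fun l => LinearIsometry.toSpanSingleton ℂ π.H (hu1 l) := by
    intro l l' h a b
    rw [LinearIsometry.toSpanSingleton_apply, LinearIsometry.toSpanSingleton_apply,
      inner_smul_left, inner_smul_right,
      inner_eq_zero_of_mem_weightSpace (fun e => h (Subtype.ext e)) (hu l) (hu l'), mul_zero,
      mul_zero]
  let W : (V κ c).H →ₗᵢ[ℂ] π.H := hort.linearIsometry
  have hW : ∀ l, W (basisVec l) = u l := fun l => by
    refine (hort.linearIsometry_apply_single (i := l) (1 : ℂ)).trans ?_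
    rw [LinearIsometry.toSpanSingleton_apply, one_smul]
  have hshift : ∀ l k, u ((shift κ c k).symm l) = π.ρ (tpi 1 k) (u l) := fun l k => by
    change π.ρ _ v = π.ρ _ (π.ρ _ v)
    rw [π.ρ_torus_mul]
    congr 2
    refine congrArg _ (hinj ?_)
    have h1 : l₀.1 - κ (m ((shift κ c k).symm l)) = l.1 - κ k := hm _
    have h2 := hm l
    rw [map_add]
    omega
  refine ⟨W, fun a x => ?_, ?_⟩
  · have key : W.toContinuousLinearMap ∘L
        ((V κ c).ρ a).toContinuousLinearEquiv.toContinuousLinearMap =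
        (π.ρ a).toContinuousLinearEquiv.toContinuousLinearMap ∘L W.toContinuousLinearMap := by
      refine clm_ext_basisVec fun l => ?_
      change W ((V κ c).ρ a (basisVec l)) = π.ρ a (W (basisVec l))
      rw [← tpi_eta a, V_ρ_basisVec, map_smul, hW, hW, hshift, ← ρ_tpi_of_mem_weightSpace (hu l)]
    exact DFunLike.congr_fun key x
  · rw [hW]
    change π.ρ _ v = v
    have h1 : m l₀ = 0 := hinj (by have := hm l₀; rw [map_zero]; omega)
    rw [h1]
    exact π.ρ_one v

theorem integrated_V_torusMonomial (c : ℤ ⧸ κ.range) (j m : ℤ) (l : Weights κ c) :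
    (V κ c).integrated haarTPi (torusMonomial j m) (basisVec l) =
      if l.1 = κ m - j then basisVec ((shift κ c m).symm l) else 0 := by
  rw [integrated_torusMonomial j m (basisVec_mem_weightSpace l), V_ρ_basisVec, one_zpow,
    Circle.coe_one, one_smul]

/-- The monomials act in `V_{[λ]}` as matrix units. -/
theorem integrated_V_torusMonomial_eq_rankOne (m : ℤ) (l : Weights κ c) :
    (V κ c).integrated haarTPi (torusMonomial (κ m - l.1) m) =
      InnerProductSpace.rankOne ℂ (basisVec ((shift κ c m).symm l)) (basisVec l) := by
  refine clm_ext_basisVec fun l' => ?_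
  rw [integrated_V_torusMonomial, InnerProductSpace.rankOne_apply, inner_basisVec]
  by_cases h : l = l'
  · subst h
    rw [if_pos (by omega), if_pos rfl, one_smul]
  · rw [if_neg fun e => h (Subtype.ext (by omega)), if_neg h, zero_smul]

theorem integrated_V_torusMonomial_eq_zero (j m : ℤ) (h : ((κ m - j : ℤ) : ℤ ⧸ κ.range) ≠ c) :
    (V κ c).integrated haarTPi (torusMonomial j m) = 0 := by
  refine clm_ext_basisVec fun l => ?_
  rw [integrated_V_torusMonomial, if_neg]
  · rfl
  · intro e
    exact h (by rw [← e]; exact l.2)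

/-- A monomial acts with rank at most one, and compactness survives `L¹`-limits of functions because
the operator norm is bounded by the `L¹`-norm. -/
theorem isCompactOperator_integrated_V (c : ℤ ⧸ κ.range) (f : C_c(TPi, ℂ)) :
    IsCompactOperator ((V κ c).integrated haarTPi f) := by
  refine torusMonomial_induction (P := fun f => IsCompactOperator ((V κ c).integrated haarTPi f))
    (fun j m => ?_) (fun f g hf hg => ?_) (fun a f hf => ?_) (fun f hf => ?_) f
  · by_cases h : ((κ m - j : ℤ) : ℤ ⧸ κ.range) = c
    · have h1 := integrated_V_torusMonomial_eq_rankOne m (⟨κ m - j, h⟩ : Weights κ c)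
      rw [sub_sub_cancel] at h1
      rw [h1]
      exact isCompactOperator_rankOne _ _
    · rw [integrated_V_torusMonomial_eq_zero j m h]
      exact isCompactOperator_zero
  · rw [TwistedRep.integrated_add]
    exact hf.add hg
  · rw [TwistedRep.integrated_smul]
    exact hf.smul a
  · have hcl : IsClosed {T : (V κ c).H →L[ℂ] (V κ c).H | IsCompactOperator T} :=
      isClosed_setOfPred_isCompactOperator
    refine hcl.closure_subset (Metric.mem_closure_iff.2 fun ε hε => ?_)
    obtain ⟨g, hg, hfg⟩ := hf ε hε
    refine ⟨_, hg, lt_of_le_of_lt ?_ hfg⟩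
    have h1 : (V κ c).integrated haarTPi f - (V κ c).integrated haarTPi g =
        (V κ c).integrated haarTPi (f + (-1 : ℂ) • g) := by
      rw [TwistedRep.integrated_add, TwistedRep.integrated_smul, neg_one_smul, sub_eq_add_neg]
    rw [dist_eq_norm, h1]
    refine ((V κ c).norm_integrated_le haarTPi _).trans (le_of_eq ?_)
    refine integral_congr_ae (Filter.Eventually.of_forall fun a => ?_)
    change ‖f a + (-1 : ℂ) • g a‖ = ‖f a - g a‖
    rw [neg_one_smul, sub_eq_add_neg]

/-- Every twisted representation is a Hilbert sum of copies of the `V_{[λ]}`. -/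
theorem exists_isHilbertSum_V (hκ : κ ≠ 0) (π : TwistedRep (tau κ)) :
    ∃ (ι : Type) (c : ι → ℤ ⧸ κ.range) (W : ∀ i, (V κ (c i)).H →ₗᵢ[ℂ] π.H),
      (∀ i a x, W i ((V κ (c i)).ρ a x) = π.ρ a (W i x)) ∧
        IsHilbertSum ℂ (fun i => (V κ (c i)).H) W := by
  -- In each coset one weight is fixed, together with a Hilbert basis of its weight space. Each
  -- basis vector generates one copy of the corresponding `V_{[λ]}`.
  let l : ∀ c : ℤ ⧸ κ.range, Weights κ c := fun c => (nonempty_weights c).some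
  have hb : ∀ c, ∃ (w : Set (weightSpace π (l c).1)) (b : HilbertBasis w ℂ (weightSpace π (l c).1)),
      ⇑b = ((↑) : w → weightSpace π (l c).1) := fun c => exists_hilbertBasis _ _
  choose w b hb using hb
  have hW : ∀ i : Σ c, w c, ∃ W : (V κ i.1).H →ₗᵢ[ℂ] π.H,
      (∀ a x, W ((V κ i.1).ρ a x) = π.ρ a (W x)) ∧ W (basisVec (l i.1)) = (b i.1 i.2).1 :=
    fun i => exists_intertwiner hκ π (l i.1) (b i.1 i.2).2 ((b i.1).orthonormal.1 i.2)
  choose W hWρ hWl using hW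
  have hWmem : ∀ i (k : Weights κ i.1), W i (basisVec k) ∈ weightSpace π k.1 := fun i k => by
    rw [mem_weightSpace]
    intro t
    rw [← hWρ, (mem_weightSpace _).1 (basisVec_mem_weightSpace k), map_smul]
  have hort : OrthogonalFamily ℂ (fun i : Σ c, w c => (V κ i.1).H) W := by
    intro i j hij x y
    have h1 : ∀ k k', ⟪W i (basisVec k), W j (basisVec k')⟫_ℂ = 0 := by
      intro k k'
      by_cases hk : k.1 = k'.1
      · obtain ⟨c, i⟩ := i
        obtain ⟨c', j⟩ := j
        have hc : c = c' := k.2.symm.trans ((congrArg _ hk).trans k'.2)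
        subst hc
        obtain rfl : k = k' := Subtype.ext hk
        -- Both vectors are images under the same unitary `ρ(1, m)` of basis vectors of the chosen
        -- weight space, where distinct ones are orthogonal.
        obtain ⟨m, hm⟩ := exists_sub_eq (l c) k
        have h2 : basisVec k = (V κ c).ρ (tpi 1 m) (basisVec (l c)) := by
          rw [V_ρ_basisVec, one_zpow, Circle.coe_one, one_smul]
          congr 1
          exact Subtype.ext hm.symm
        rw [h2, hWρ, hWρ, LinearIsometryEquiv.inner_map_map, hWl, hWl]
        have h3 := (b c).orthonormal.2 (fun e : i = j => hij (by rw [e]))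
        exact h3
      · exact inner_eq_zero_of_mem_weightSpace hk (hWmem i k) (hWmem j k')
    have h2 : ∀ k y, ⟪W i (basisVec k), W j y⟫_ℂ = 0 := fun k y => by
      have : (innerSL ℂ (W i (basisVec k))) ∘L (W j).toContinuousLinearMap = 0 :=
        clm_ext_basisVec fun k' => h1 k k'
      exact DFunLike.congr_fun this y
    rw [← inner_conj_symm]
    have : (innerSL ℂ (W j y)) ∘L (W i).toContinuousLinearMap = 0 :=
      clm_ext_basisVec fun k => by
        change ⟪W j y, W i (basisVec k)⟫_ℂ = 0
        rw [← inner_conj_symm, h2, map_zero]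
    rw [show ⟪W j y, W i x⟫_ℂ = 0 from DFunLike.congr_fun this x, map_zero]
  refine ⟨Σ c, w c, fun i => i.1, W, hWρ, IsHilbertSum.mk hort ?_⟩
  -- Totality: the closed span `S` of the copies is invariant and contains the chosen weight spaces.
  -- Any other weight space is carried into a chosen one by some `ρ(1, m)` and back by `ρ(1, -m)`,
  -- so it lies in `S` too.
  let S : Submodule ℂ π.H := (⨆ i, LinearMap.range (W i).toLinearMap).topologicalClosure
  have hS : IsClosed (S : Set π.H) := Submodule.isClosed_topologicalClosure _
  have hWS : ∀ i x, W i x ∈ S := fun i x =>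
    Submodule.le_topologicalClosure _ (Submodule.mem_iSup_of_mem i ⟨x, rfl⟩)
  have hρS : ∀ a, ∀ v ∈ S, π.ρ a v ∈ S := fun a => by
    have h1 : S ≤ S.comap (π.ρ a).toLinearEquiv.toLinearMap := by
      refine Submodule.topologicalClosure_minimal _ (iSup_le fun i => ?_)
        (hS.preimage (π.ρ a).continuous)
      rintro _ ⟨x, rfl⟩
      change π.ρ a (W i x) ∈ S
      rw [← hWρ]
      exact hWS _ _
    exact fun v hv => h1 hv
  have hl : ∀ c, ∀ v ∈ weightSpace π (l c).1, v ∈ S := fun c v hv => by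
    have h1 : (Submodule.span ℂ (Set.range (b c))).topologicalClosure ≤
        S.comap (weightSpace π (l c).1).subtype := by
      refine Submodule.topologicalClosure_minimal _ (Submodule.span_le.2 ?_)
        (hS.preimage continuous_subtype_val)
      rintro _ ⟨i, rfl⟩
      change (b c i).1 ∈ S
      rw [← hWl ⟨c, i⟩]
      exact hWS _ _
    rw [(b c).dense_span] at h1
    exact h1 (x := ⟨v, hv⟩) Submodule.mem_top
  have hall : ∀ n : ℤ, weightSpace π n ≤ S := fun n v hv => by
    obtain ⟨m, hm⟩ := exists_sub_eq (⟨n, rfl⟩ : Weights κ (n : ℤ ⧸ κ.range)) (l n)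
    have h1 := hl _ _ (hm ▸ ρ_tpi_one_mem_weightSpace hv m)
    have h2 := hρS (tpi 1 (-m)) _ h1
    rw [π.ρ_torus_mul, neg_add_cancel] at h2
    rwa [show π.ρ (tpi 1 0) v = v from π.ρ_one v] at h2
  have h1 : (⨆ n, weightSpace π n).topologicalClosure ≤ S :=
    Submodule.topologicalClosure_minimal _ (iSup_le hall) hS
  rwa [show (⨆ n, weightSpace π n).topologicalClosure = ⊤ from
    iSup_circleWeightSpace_closure_eq_top π.torusAction_mul π.continuous_torusAction] at h1

/-- For a nonzero `κ`, the twisted group algebra is the direct sum of the algebras of compact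
operators on the `V_{[λ]}`. -/
theorem exists_starAlgEquiv_compactOps (hκ : κ ≠ 0) :
    ∃ Ψ : GroupCStar (tau κ) haarTPi ≃⋆ₐ[ℂ]
        C0Sum (fun c : ℤ ⧸ κ.range => CompactOps (V κ c).H),
      ∀ (f : C_c(TPi, ℂ)) (c : ℤ ⧸ κ.range),
        (C0Sum.proj c (Ψ (toCStar (tau κ) haarTPi f))).toCLM = (V κ c).integrated haarTPi f := by
  classical
  have hfin := finite_quotient_range hκ
  let φ : C_c(TPi, ℂ) → C0Sum (fun c : ℤ ⧸ κ.range => CompactOps (V κ c).H) := fun f =>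
    C0Sum.mk (fun c => CompactOps.mk ((V κ c).integrated haarTPi f)
      (isCompactOperator_integrated_V c f)) (Set.finite_range _).bddAbove
      -- There are finitely many cosets, so the decay condition is empty.
      (by rw [Filter.cofinite_eq_bot]; exact Filter.tendsto_bot)
  have hadd : ∀ f g, φ (f + g) = φ f + φ g := fun f g =>
    C0Sum.ext fun c => CompactOps.ext ((V κ c).integrated_add haarTPi f g)
  have hsmul : ∀ (a : ℂ) f, φ (a • f) = a • φ f := fun a f =>
    C0Sum.ext fun c => CompactOps.ext ((V κ c).integrated_smul haarTPi a f)
  have hφ0 : φ 0 = 0 := by simpa using hsmul 0 0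
  refine Exists.imp (fun Ψ hΨ f c => congrArg (fun x => (C0Sum.proj c x).toCLM) (hΨ f))
    (exists_starAlgEquiv_groupCStar (tau κ) haarTPi φ ?_ hadd hsmul ?_ ?_ ?_)
  · let S : Submodule ℂ (C0Sum (fun c : ℤ ⧸ κ.range => CompactOps (V κ c).H)) :=
      { carrier := Set.range φ
        zero_mem' := ⟨0, hφ0⟩
        add_mem' := by
          rintro _ _ ⟨f, rfl⟩ ⟨g, rfl⟩
          exact ⟨f + g, hadd f g⟩
        smul_mem' := by
          rintro a _ ⟨f, rfl⟩
          exact ⟨a • f, hsmul a f⟩ }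
    have hS : IsClosed (S.topologicalClosure :
        Set (C0Sum (fun c : ℤ ⧸ κ.range => CompactOps (V κ c).H))) :=
      S.isClosed_topologicalClosure
    refine fun x => C0Sum.eq_top_of_single_mem (S := S.topologicalClosure.toAddSubmonoid) hS
      (fun c T => ?_) x
    refine CompactOps.eq_top_of_rankOne_mem
      (M :=
        { carrier := {T | C0Sum.single c T ∈ S.topologicalClosure}
          zero_mem' := ?_
          add_mem' := fun {T T'} hT hT' => ?_
          smul_mem' := fun a T hT => ?_ })
      (hS.preimage (C0Sum.isometry_single c).continuous) (span_basisVec_closure c) ?_ T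
    · rw [Set.mem_ofPred_eq]
      convert S.topologicalClosure.add_mem hT hT' using 1
      refine C0Sum.ext fun d => ?_
      rw [C0Sum.proj_add]
      by_cases h : d = c
      · subst h; simp only [C0Sum.proj_single_same]
      · simp only [C0Sum.proj_single_of_ne h, add_zero]
    · rw [Set.mem_ofPred_eq]
      convert S.topologicalClosure.zero_mem using 1
      refine C0Sum.ext fun d => ?_
      rw [C0Sum.proj_zero]
      by_cases h : d = c
      · subst h; simp only [C0Sum.proj_single_same]
      · simp only [C0Sum.proj_single_of_ne h]
    · rw [Set.mem_ofPred_eq]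
      convert S.topologicalClosure.smul_mem a hT using 1
      refine C0Sum.ext fun d => ?_
      rw [C0Sum.proj_smul]
      by_cases h : d = c
      · subst h; simp only [C0Sum.proj_single_same]
      · simp only [C0Sum.proj_single_of_ne h, smul_zero]
    · rintro _ ⟨l, rfl⟩ _ ⟨l', rfl⟩
      -- With `l' - κ(m) = l` the monomial `t^(κ(m) - l')` on `T × {m}` is the matrix unit from `l'`
      -- to `l` in `V_c`, and it acts as zero in every other summand.
      obtain ⟨m, hm⟩ := exists_sub_eq l' l
      refine S.le_topologicalClosure ⟨torusMonomial (κ m - l'.1) m, C0Sum.ext fun d =>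
        CompactOps.ext ?_⟩
      change (V κ d).integrated haarTPi _ = _
      by_cases h : d = c
      · subst h
        rw [C0Sum.proj_single_same, integrated_V_torusMonomial_eq_rankOne, CompactOps.toCLM_rankOne]
        congr 3
        exact Subtype.ext hm
      · rw [C0Sum.proj_single_of_ne h, integrated_V_torusMonomial_eq_zero]
        · rfl
        · rw [sub_sub_cancel]
          intro e
          exact h (e.symm.trans l'.2)
  · exact fun f g => C0Sum.ext fun c => CompactOps.ext ((V κ c).integrated_conv haarTPi f g)
  · exact fun f => C0Sum.ext fun c => CompactOps.ext ((V κ c).integrated_invol haarTPi f)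
  · intro f
    refine le_antisymm (C0Sum.norm_le (norm_nonneg _) fun c =>
      norm_integrated_le_norm_toCStar haarTPi (V κ c) f) ?_
    refine norm_toCStar_le _ _ (norm_nonneg _) fun π => ?_
    -- Any `π` is a Hilbert sum of copies of the `V_{[λ]}`, so no representation gives a larger norm
    -- than these.
    obtain ⟨ι, c, W, hW, hsum⟩ := exists_isHilbertSum_V hκ π
    exact opNorm_le_of_isHilbertSum hsum _ (fun i => (V κ (c i)).integrated haarTPi f)
      (fun i x => TwistedRep.integrated_intertwine haarTPi (W i) (hW i) f x) (norm_nonneg _)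
      fun i => C0Sum.norm_proj_le (c i) (φ f)

end Irreducibles

end TwistedCStar
end

noncomputable section

namespace TwistedCStar

/-! ### The untwisted algebra -/

section Untwisted

/-- The character `(t, m) ↦ t ^ l w ^ m` of `T × Π_T`. -/
def charRep (l : ℤ) (w : Circle) : TwistedRep (tau 0) where
  H := ℂ
  ρ a := circleSMul (a.1 ^ l * w ^ Multiplicative.toAdd a.2)
  ρ_mul a b v := by
    change ((a.1 ^ l * w ^ Multiplicative.toAdd a.2 : Circle) : ℂ) •
      (((b.1 ^ l * w ^ Multiplicative.toAdd b.2 : Circle) : ℂ) • v) =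
      ((b.1 ^ (0 : ℤ) : Circle) : ℂ) • (((a.1 * b.1) ^ l *
        w ^ (Multiplicative.toAdd a.2 + Multiplicative.toAdd b.2) : Circle) : ℂ) • v
    rw [zpow_zero, Circle.coe_one, one_smul, smul_smul, ← Circle.coe_mul, mul_zpow, zpow_add,
      mul_mul_mul_comm]
  continuous_ρ v := by
    refine continuous_prod_of_discrete_right.2 fun m => ?_
    change Continuous fun t : Circle => ((t ^ l * w ^ Multiplicative.toAdd m : Circle) : ℂ) • v
    have h : Continuous fun t : Circle => t ^ l * w ^ Multiplicative.toAdd m :=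
      (continuous_zpow l).mul continuous_const
    exact (continuous_subtype_val.comp h).smul continuous_const

theorem charRep_ρ_tpi (l : ℤ) (w t : Circle) (m : ℤ) (z : ℂ) :
    (charRep l w).ρ (tpi t m) z = ((t ^ l * w ^ m : Circle) : ℂ) * z := rfl

/-- The Fourier transform `f ↦ ∫ f(t, m) t ^ l w ^ m` on `T × Π_T`. -/
def fourier (f : C_c(TPi, ℂ)) (p : Multiplicative ℤ × Circle) : ℂ :=
  (charRep (Multiplicative.toAdd p.1) p.2).integrated haarTPi f (1 : ℂ)

theorem charRep_integrated_apply (f : C_c(TPi, ℂ)) (p : Multiplicative ℤ × Circle) (z : ℂ) :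
    (charRep (Multiplicative.toAdd p.1) p.2).integrated haarTPi f z = z * fourier f p := by
  have h := ((charRep (Multiplicative.toAdd p.1) p.2).integrated haarTPi f).map_smul z (1 : ℂ)
  refine Eq.trans (congrArg _ ?_) h
  exact (mul_one z).symm

theorem fourier_add (f g : C_c(TPi, ℂ)) (p) : fourier (f + g) p = fourier f p + fourier g p :=
  DFunLike.congr_fun (TwistedRep.integrated_add haarTPi _ f g) (1 : ℂ)

theorem fourier_smul (c : ℂ) (f : C_c(TPi, ℂ)) (p) : fourier (c • f) p = c * fourier f p :=
  DFunLike.congr_fun (TwistedRep.integrated_smul haarTPi _ c f) (1 : ℂ)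

theorem fourier_conv (f g : C_c(TPi, ℂ)) (p) :
    fourier (conv (tau 0) haarTPi f g) p = fourier f p * fourier g p := by
  refine (DFunLike.congr_fun (TwistedRep.integrated_conv haarTPi
    (charRep (Multiplicative.toAdd p.1) p.2) f g) (1 : ℂ)).trans ?_
  refine (charRep_integrated_apply f p (fourier g p)).trans ?_
  exact mul_comm (fourier g p) (fourier f p)

theorem fourier_invol (f : C_c(TPi, ℂ)) (p) :
    fourier (invol (tau 0) f) p = starRingEnd ℂ (fourier f p) := by
  let T : ℂ →L[ℂ] ℂ := (charRep (Multiplicative.toAdd p.1) p.2).integrated haarTPi f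
  have h1 : fourier (invol (tau 0) f) p = (star T) 1 :=
    DFunLike.congr_fun (TwistedRep.integrated_invol haarTPi
      (charRep (Multiplicative.toAdd p.1) p.2) f) (1 : ℂ)
  rw [h1]
  have h2 : (ContinuousLinearMap.adjoint T) 1 * starRingEnd ℂ 1 = 1 * starRingEnd ℂ (T 1) :=
    ContinuousLinearMap.adjoint_inner_right T 1 1
  rw [RingHom.map_one, mul_one, one_mul] at h2
  exact h2

theorem norm_fourier_le_norm_toCStar (f : C_c(TPi, ℂ)) (p) :
    ‖fourier f p‖ ≤ ‖toCStar (tau 0) haarTPi f‖ := by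
  refine le_trans ?_ (norm_integrated_le_norm_toCStar haarTPi
    (charRep (Multiplicative.toAdd p.1) p.2) f)
  refine (ContinuousLinearMap.le_opNorm _ (1 : ℂ)).trans (le_of_eq ?_)
  have : ‖(1 : ℂ)‖ = 1 := norm_one
  refine (congrArg _ this).trans (mul_one _)

theorem norm_toCStar_sub_le (f g : C_c(TPi, ℂ)) :
    ‖toCStar (tau 0) haarTPi (f + (-1 : ℂ) • g)‖ ≤ ∫ a, ‖f a - g a‖ ∂haarTPi := by
  refine (norm_toCStar_le_integral _ _ _).trans (le_of_eq ?_)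
  refine integral_congr_ae (Filter.Eventually.of_forall fun a => ?_)
  change ‖f a + (-1 : ℂ) • g a‖ = ‖f a - g a‖
  rw [neg_one_smul, sub_eq_add_neg]

theorem norm_fourier_sub_le (f g : C_c(TPi, ℂ)) (p) :
    ‖fourier f p - fourier g p‖ ≤ ∫ a, ‖f a - g a‖ ∂haarTPi := by
  refine le_trans (le_of_eq ?_) ((norm_fourier_le_norm_toCStar (f + (-1 : ℂ) • g) p).trans
    (norm_toCStar_sub_le f g))
  rw [fourier_add, fourier_smul, neg_one_mul, sub_eq_add_neg]

/-- The vector `1` has weight `l` in the character indexed by `(l, w)`, so the formula on weight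
vectors applies with `κ = 0`. -/
theorem fourier_torusMonomial (j m : ℤ) (p : Multiplicative ℤ × Circle) :
    fourier (torusMonomial j m) p =
      if Multiplicative.toAdd p.1 = -j then ((p.2 ^ m : Circle) : ℂ) else 0 := by
  have hmem : (show (charRep (Multiplicative.toAdd p.1) p.2).H from (1 : ℂ)) ∈
      weightSpace (charRep (Multiplicative.toAdd p.1) p.2) (Multiplicative.toAdd p.1) := by
    rw [mem_weightSpace]
    intro t
    refine (charRep_ρ_tpi _ _ _ _ _).trans ?_
    rw [zpow_zero, mul_one]
    rfl
  refine (integrated_torusMonomial j m hmem).trans ?_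
  have h1 : (0 : ℤ →+ ℤ) m - j = -j := by simp
  rw [h1]
  split_ifs with h
  · refine (charRep_ρ_tpi _ _ _ _ _).trans ?_
    rw [one_zpow, one_mul, mul_one]
  · rfl

/-- The function on `Π_T × T` given by `q` on `{l} × T` and vanishing elsewhere. -/
def sliceZero (l : Multiplicative ℤ) (q : C(Circle, ℂ)) : C₀(Multiplicative ℤ × Circle, ℂ) where
  toFun p := if p.1 = l then q p.2 else 0
  continuous_toFun := by
    refine continuous_prod_of_discrete_left.2 fun n => ?_
    by_cases h : n = l
    · simpa only [if_pos h] using q.continuous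
    · simpa only [if_neg h] using continuous_const
  zero_at_infty' := by
    refine HasCompactSupport.is_zero_at_infty (HasCompactSupport.intro (K := {l} ×ˢ Set.univ)
      (isCompact_singleton.prod isCompact_univ) fun p hp => if_neg fun h => hp ?_)
    exact ⟨h, Set.mem_univ _⟩

theorem sliceZero_apply (l : Multiplicative ℤ) (q : C(Circle, ℂ)) (p : Multiplicative ℤ × Circle) :
    sliceZero l q p = if p.1 = l then q p.2 else 0 := rfl

theorem norm_zeroAtInfty_le {X : Type*} [TopologicalSpace X] {F : C₀(X, ℂ)} {C : ℝ} (hC : 0 ≤ C)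
    (h : ∀ x, ‖F x‖ ≤ C) : ‖F‖ ≤ C := by
  rw [← ZeroAtInftyContinuousMap.norm_toBCF_eq_norm]
  exact (BoundedContinuousFunction.norm_le hC).2 h

theorem norm_apply_le_norm_zeroAtInfty {X : Type*} [TopologicalSpace X] (F : C₀(X, ℂ)) (x : X) :
    ‖F x‖ ≤ ‖F‖ := by
  rw [← ZeroAtInftyContinuousMap.norm_toBCF_eq_norm]
  exact F.toBCF.norm_coe_le_norm x

theorem continuous_sliceZero (l : Multiplicative ℤ) : Continuous (sliceZero l) := by
  refine (LipschitzWith.of_dist_le_mul (K := 1) fun q r => ?_).continuous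
  rw [NNReal.coe_one, one_mul, dist_eq_norm, dist_eq_norm]
  refine norm_zeroAtInfty_le (norm_nonneg _) fun p => ?_
  change ‖sliceZero l q p - sliceZero l r p‖ ≤ _
  rw [sliceZero_apply, sliceZero_apply]
  split_ifs
  · exact (q - r).norm_coe_le_norm p.2
  · rw [sub_zero, norm_zero]
    exact norm_nonneg _

/-- Both properties pass to uniform limits, and the supremum norm of the Fourier transform is
bounded by the `L¹`-norm. Hence monomials, whose transforms are supported on one circle, suffice. -/
theorem continuous_fourier_and_tendsto (f : C_c(TPi, ℂ)) :
    Continuous (fourier f) ∧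
      Filter.Tendsto (fourier f) (Filter.cocompact _) (nhds 0) := by
  refine torusMonomial_induction (P := fun f => Continuous (fourier f) ∧
      Filter.Tendsto (fourier f) (Filter.cocompact _) (nhds 0)) ?_ ?_ ?_ ?_ f
  · intro j m
    have h1 : fourier (torusMonomial j m) =
        sliceZero (Multiplicative.ofAdd (-j)) (circleChar m) := by
      funext p
      rw [fourier_torusMonomial, sliceZero_apply]
      rfl
    rw [h1]
    exact ⟨map_continuous _, zero_at_infty _⟩
  · intro f g hf hg
    have h1 : fourier (f + g) = fun p => fourier f p + fourier g p :=
      funext fun p => fourier_add f g p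
    rw [h1]
    exact ⟨hf.1.add hg.1, by simpa using hf.2.add hg.2⟩
  · intro c f hf
    have h1 : fourier (c • f) = fun p => c * fourier f p := funext fun p => fourier_smul c f p
    rw [h1]
    exact ⟨continuous_const.mul hf.1, by simpa using hf.2.const_mul c⟩
  · intro f hf
    constructor
    · refine continuous_of_uniform_approx_of_continuous fun u hu => ?_
      obtain ⟨ε, hε, hu'⟩ := Metric.mem_uniformity_dist.1 hu
      obtain ⟨g, hg, hfg⟩ := hf ε hε
      refine ⟨fourier g, hg.1, fun p => hu' ?_⟩
      rw [dist_eq_norm]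
      exact (norm_fourier_sub_le f g p).trans_lt hfg
    · rw [Metric.tendsto_nhds]
      intro ε hε
      obtain ⟨g, hg, hfg⟩ := hf (ε / 2) (half_pos hε)
      filter_upwards [Metric.tendsto_nhds.1 hg.2 (ε / 2) (half_pos hε)] with p hp
      rw [dist_zero_right] at hp ⊢
      have h1 := norm_fourier_sub_le f g p
      have h2 : ‖fourier f p‖ ≤ ‖fourier f p - fourier g p‖ + ‖fourier g p‖ := by
        simpa using norm_add_le (fourier f p - fourier g p) (fourier g p)
      linarith

/-- The Fourier transform on `T × Π_T` as a map to functions vanishing at infinity. -/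
def fourierZero (f : C_c(TPi, ℂ)) : C₀(Multiplicative ℤ × Circle, ℂ) where
  toFun := fourier f
  continuous_toFun := (continuous_fourier_and_tendsto f).1
  zero_at_infty' := (continuous_fourier_and_tendsto f).2

theorem fourierZero_apply (f : C_c(TPi, ℂ)) (p) : fourierZero f p = fourier f p := rfl

theorem fourierZero_torusMonomial (j m : ℤ) :
    fourierZero (torusMonomial j m) = sliceZero (Multiplicative.ofAdd (-j)) (circleChar m) := by
  ext p
  rw [fourierZero_apply, fourier_torusMonomial, sliceZero_apply]
  rfl

theorem denseRange_fourierZero : DenseRange fourierZero := by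
  let S : Submodule ℂ C₀(Multiplicative ℤ × Circle, ℂ) :=
    { carrier := Set.range fourierZero
      zero_mem' := ⟨0, by
        ext p
        rw [fourierZero_apply]
        have := fourier_smul 0 0 p
        rw [zero_smul, zero_mul] at this
        exact this⟩
      add_mem' := by
        rintro _ _ ⟨f, rfl⟩ ⟨g, rfl⟩
        exact ⟨f + g, by ext p; exact fourier_add f g p⟩
      smul_mem' := by
        rintro c _ ⟨f, rfl⟩
        exact ⟨c • f, by ext p; exact fourier_smul c f p⟩ }
  have hslice : ∀ l q, sliceZero l q ∈ S.topologicalClosure := fun l => by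
    let M : Submodule ℂ C(Circle, ℂ) :=
      { carrier := {q | sliceZero l q ∈ S.topologicalClosure}
        zero_mem' := by
          rw [Set.mem_ofPred_eq]
          convert S.topologicalClosure.zero_mem using 1
          ext p
          rw [sliceZero_apply]
          simp
        add_mem' := fun {q r} hq hr => by
          rw [Set.mem_ofPred_eq]
          convert S.topologicalClosure.add_mem hq hr using 1
          ext p
          rw [ZeroAtInftyContinuousMap.add_apply, sliceZero_apply, sliceZero_apply,
            sliceZero_apply]
          split_ifs <;> simp
        smul_mem' := fun c q hq => by
          rw [Set.mem_ofPred_eq]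
          convert S.topologicalClosure.smul_mem c hq using 1
          ext p
          rw [ZeroAtInftyContinuousMap.smul_apply, sliceZero_apply, sliceZero_apply]
          split_ifs <;> simp }
    have hM : IsClosed (M : Set C(Circle, ℂ)) :=
      S.isClosed_topologicalClosure.preimage (continuous_sliceZero l)
    have h1 : (Submodule.span ℂ (Set.range circleChar)).topologicalClosure ≤ M := by
      refine Submodule.topologicalClosure_minimal _ (Submodule.span_le.2 ?_) hM
      rintro _ ⟨m, rfl⟩
      refine S.le_topologicalClosure ⟨torusMonomial (-Multiplicative.toAdd l) m, ?_⟩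
      rw [fourierZero_torusMonomial, neg_neg]
      rfl
    intro q
    rw [span_circleChar_closure_eq_top] at h1
    exact h1 (x := q) Submodule.mem_top
  intro F
  change F ∈ S.topologicalClosure
  rw [← SetLike.mem_coe, ← S.isClosed_topologicalClosure.closure_eq, Metric.mem_closure_iff]
  intro ε hε
  obtain ⟨K, hK, hFK⟩ := Filter.mem_cocompact.1
    (Metric.tendsto_nhds.1 F.zero_at_infty' (ε / 2) (half_pos hε))
  -- Outside the finitely many circles met by `K`, the function `F` is smaller than `ε / 2`; it is
  -- approximated by its restriction to these circles.
  have hL : (Prod.fst '' K).Finite := (hK.image continuous_fst).finite_of_discrete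
  refine ⟨∑ l ∈ hL.toFinset, sliceZero l ⟨fun w => F (l, w), by fun_prop⟩,
    S.topologicalClosure.sum_mem fun l _ => hslice l _, ?_⟩
  rw [dist_eq_norm]
  refine (norm_zeroAtInfty_le (half_pos hε).le fun p => ?_).trans_lt (half_lt_self hε)
  let ev : C₀(Multiplicative ℤ × Circle, ℂ) →+ ℂ := ⟨⟨fun F => F p, rfl⟩, fun _ _ => rfl⟩
  have hsum : ∀ (s : Finset (Multiplicative ℤ)) (G : _ → C₀(Multiplicative ℤ × Circle, ℂ)),
      (∑ l ∈ s, G l) p = ∑ l ∈ s, G l p := fun s G => map_sum ev G s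
  rw [ZeroAtInftyContinuousMap.sub_apply, hsum]
  simp only [sliceZero_apply, ContinuousMap.coe_mk]
  rw [Finset.sum_ite_eq]
  split_ifs with h
  · rw [sub_self, norm_zero]
    exact (half_pos hε).le
  · rw [sub_zero]
    have hp : p ∈ Kᶜ := fun hp => h (by rw [Set.Finite.mem_toFinset]; exact ⟨p, hp, rfl⟩)
    have := hFK hp
    rw [Set.mem_ofPred_eq, dist_zero_right] at this
    exact this.le

/-- The continuous functional calculus of a unitary operator, on functions on the circle. -/
theorem exists_circle_functionalCalculus {H : Type*} [NormedAddCommGroup H] [InnerProductSpace ℂ H]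
    [CompleteSpace H] (U : H ≃ₗᵢ[ℂ] H) :
    ∃ θ : C(Circle, ℂ) →⋆ₐ[ℂ] (H →L[ℂ] H), (∀ q, ‖θ q‖ ≤ ‖q‖) ∧
      ∀ v, θ (circleChar 1) v = U v := by
  let u : unitary (H →L[ℂ] H) := Unitary.linearIsometryEquiv.symm U
  have hu : IsStarNormal (u : H →L[ℂ] H) := inferInstance
  -- The spectrum of a unitary lies in the circle, so functions on the circle restrict to it and can
  -- be applied to `u`.
  let ι : C(spectrum ℂ (u : H →L[ℂ] H), Circle) :=
    ⟨fun z => ⟨z.1, Unitary.spectrum_subset_circle u z.2⟩, by fun_prop⟩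
  let θ : C(Circle, ℂ) →⋆ₐ[ℂ] (H →L[ℂ] H) :=
    (cfcHom hu).comp (ContinuousMap.compStarAlgHom' ℂ ℂ ι)
  refine ⟨θ, fun q => NonUnitalStarAlgHom.norm_apply_le θ q, fun v => ?_⟩
  have h1 : θ (circleChar 1) = cfcHom hu (ContinuousMap.restrict (spectrum ℂ (u : H →L[ℂ] H))
      (ContinuousMap.id ℂ)) := by
    change cfcHom hu _ = _
    congr 1
    ext z
    change ((ι z ^ (1 : ℤ) : Circle) : ℂ) = z.1
    rw [zpow_one]
    rfl
  rw [h1, cfcHom_id]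
  rfl

/-- For `κ = 0` each weight space is stable under `Π_T`. There `π(f)` is the row `w ↦ fourier f (l,
w)` applied to the unitary `ρ(1, 1)`, and the functional calculus does not increase the supremum
norm of the row. The identity is checked on monomials and extended by `L¹`-approximation. -/
theorem norm_toCStar_le_norm_fourierZero (f : C_c(TPi, ℂ)) :
    ‖toCStar (tau 0) haarTPi f‖ ≤ ‖fourierZero f‖ := by
  refine norm_toCStar_le _ _ (norm_nonneg _) fun π => ?_
  obtain ⟨θ, hθ, hθU⟩ := exists_circle_functionalCalculus (π.ρ (tpi 1 1))
  have hθm : ∀ (m : ℤ) v, θ (circleChar m) v = π.ρ (tpi 1 m) v := fun m => by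
    have hstep : ∀ (m : ℤ) v, θ (circleChar (m + 1)) v = π.ρ (tpi 1 1) (θ (circleChar m) v) :=
      fun m v => by
        rw [add_comm, circleChar_add, map_mul, ← hθU]
        rfl
    induction m using Int.induction_on with
    | zero =>
      intro v
      rw [circleChar_zero, map_one]
      exact (π.ρ_one v).symm
    | succ m ih =>
      intro v
      rw [hstep, ih, π.ρ_torus_mul, add_comm]
    | pred m ih =>
      intro v
      apply (π.ρ (tpi 1 1)).injective
      rw [← hstep, sub_add_cancel, ih, π.ρ_torus_mul, add_sub_cancel]
  let row : ∀ (_ : C_c(TPi, ℂ)) (_ : ℤ), C(Circle, ℂ) := fun f l =>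
    ⟨fun w => fourierZero f (Multiplicative.ofAdd l, w), by fun_prop⟩
  have hrow : ∀ f l, ‖row f l‖ ≤ ‖fourierZero f‖ := fun f l =>
    (ContinuousMap.norm_le _ (norm_nonneg _)).2 fun w =>
      norm_apply_le_norm_zeroAtInfty (fourierZero f) (Multiplicative.ofAdd l, w)
  have key : ∀ (f : C_c(TPi, ℂ)) (l : ℤ), ∀ v ∈ weightSpace π l,
      π.integrated haarTPi f v = θ (row f l) v ∧
        π.integrated haarTPi f v ∈ weightSpace π l := by
    intro f l v hv
    refine torusMonomial_induction (P := fun f => π.integrated haarTPi f v = θ (row f l) v ∧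
        π.integrated haarTPi f v ∈ weightSpace π l) ?_ ?_ ?_ ?_ f
    · intro j m
      have h1 : row (torusMonomial j m) l = if l = -j then circleChar m else 0 := by
        ext w
        change fourier (torusMonomial j m) (Multiplicative.ofAdd l, w) = _
        rw [fourier_torusMonomial, toAdd_ofAdd]
        split_ifs <;> rfl
      rw [integrated_torusMonomial j m hv, h1, AddMonoidHom.zero_apply, zero_sub]
      split_ifs
      · refine ⟨(hθm m v).symm, ?_⟩
        have := ρ_tpi_one_mem_weightSpace hv m
        rwa [AddMonoidHom.zero_apply, sub_zero] at this
      · rw [map_zero]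
        exact ⟨rfl, zero_mem _⟩
    · intro f g hf hg
      have h1 : row (f + g) l = row f l + row g l := by
        ext w
        exact fourier_add f g _
      rw [TwistedRep.integrated_add, h1, map_add]
      exact ⟨congrArg₂ (· + ·) hf.1 hg.1, add_mem hf.2 hg.2⟩
    · intro c f hf
      have h1 : row (c • f) l = c • row f l := by
        ext w
        exact fourier_smul c f _
      rw [TwistedRep.integrated_smul, h1, map_smul]
      exact ⟨congrArg (c • ·) hf.1, Submodule.smul_mem _ c hf.2⟩
    · intro f hf
      have hclose : ∀ ε > 0, ∃ g, (π.integrated haarTPi g v = θ (row g l) v ∧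
          π.integrated haarTPi g v ∈ weightSpace π l) ∧
          ‖π.integrated haarTPi f v - π.integrated haarTPi g v‖ < ε ∧
          ‖θ (row f l) v - θ (row g l) v‖ < ε := by
        intro ε hε
        -- The operators are compared at `v`, so the `L¹`-error gets multiplied by `‖v‖`; the added
        -- `1` keeps the divisor positive when `v = 0`.
        obtain ⟨g, hg, hfg⟩ := hf (ε / (‖v‖ + 1)) (by positivity)
        have hfg' : (∫ a, ‖f a - g a‖ ∂haarTPi) * ‖v‖ < ε := by
          rw [lt_div_iff₀ (by positivity)] at hfg
          refine lt_of_le_of_lt (mul_le_mul_of_nonneg_left (by linarith)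
            (integral_nonneg fun _ => norm_nonneg _)) hfg
        refine ⟨g, hg, lt_of_le_of_lt ?_ hfg', lt_of_le_of_lt ?_ hfg'⟩
        · have h1 : π.integrated haarTPi f v - π.integrated haarTPi g v =
              π.integrated haarTPi (f + (-1 : ℂ) • g) v := by
            rw [TwistedRep.integrated_add, TwistedRep.integrated_smul, neg_one_smul,
              sub_eq_add_neg]
            rfl
          rw [h1]
          refine (ContinuousLinearMap.le_opNorm _ _).trans
            (mul_le_mul_of_nonneg_right ?_ (norm_nonneg _))
          exact (norm_integrated_le_norm_toCStar _ _ _).trans (norm_toCStar_sub_le f g)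
        · rw [← sub_apply, ← map_sub]
          refine (ContinuousLinearMap.le_opNorm _ _).trans
            (mul_le_mul_of_nonneg_right ((hθ _).trans ?_) (norm_nonneg _))
          refine (ContinuousMap.norm_le _ (integral_nonneg fun _ => norm_nonneg _)).2 fun w => ?_
          exact norm_fourier_sub_le f g _
      constructor
      · refine eq_of_forall_dist_le fun ε hε => ?_
        obtain ⟨g, hg, h1, h2⟩ := hclose (ε / 2) (half_pos hε)
        rw [hg.1] at h1
        rw [norm_sub_rev] at h2
        rw [dist_eq_norm]
        have h3 := norm_add_le (π.integrated haarTPi f v - θ (row g l) v)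
          (θ (row g l) v - θ (row f l) v)
        rw [sub_add_sub_cancel] at h3
        linarith
      · have hcl : IsClosed (weightSpace π l : Set π.H) :=
          isClosed_circleWeightSpace π.torusAction l
        refine hcl.closure_subset (Metric.mem_closure_iff.2 fun ε hε => ?_)
        obtain ⟨g, hg, h1, -⟩ := hclose ε hε
        exact ⟨_, hg.2, by rwa [dist_eq_norm]⟩
  refine opNorm_le_of_isHilbertSum' (isHilbertSum_weightSpace π) _ (norm_nonneg _)
    fun l v => ⟨⟨_, (key f l v v.2).2⟩, rfl, ?_⟩
  change ‖π.integrated haarTPi f v‖ ≤ _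
  rw [(key f l v v.2).1]
  exact (ContinuousLinearMap.le_opNorm _ _).trans
    (mul_le_mul_of_nonneg_right ((hθ _).trans (hrow f l)) (norm_nonneg _))

/-- The untwisted group algebra of `T × Π_T` is the algebra of functions vanishing at infinity on
the dual group. -/
theorem nonempty_starAlgEquiv_zeroAtInfty :
    Nonempty (GroupCStar (tau 0) haarTPi ≃⋆ₐ[ℂ] C₀(Multiplicative ℤ × Circle, ℂ)) := by
  obtain ⟨Φ, -⟩ := exists_starAlgEquiv_groupCStar (tau 0) haarTPi fourierZero
    denseRange_fourierZero
    (fun f g => ZeroAtInftyContinuousMap.ext fun p => fourier_add f g p)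
    (fun c f => ZeroAtInftyContinuousMap.ext fun p => fourier_smul c f p)
    (fun f g => ZeroAtInftyContinuousMap.ext fun p => fourier_conv f g p)
    (fun f => ZeroAtInftyContinuousMap.ext fun p => fourier_invol f p)
    (fun f => le_antisymm
      (norm_zeroAtInfty_le (norm_nonneg _) fun p => norm_fourier_le_norm_toCStar f p)
      (norm_toCStar_le_norm_fourierZero f))
  exact ⟨Φ⟩

end Untwisted

end TwistedCStar
end

noncomputable section

namespace TwistedCStar

/-! ### The Grothendieck group of representations with finite weight multiplicities -/

section GrothendieckReps

theorem exists_of_sub_of {M : Type*} [AddCommMonoid M] (x : Algebra.GrothendieckAddGroup M) :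
    ∃ a b : M, x = Algebra.GrothendieckAddGroup.of a - Algebra.GrothendieckAddGroup.of b := by
  obtain ⟨⟨a, b⟩, h⟩ := (AddLocalization.addMonoidOf (⊤ : AddSubmonoid M)).surj x
  exact ⟨a, b, eq_sub_of_add_eq h⟩

theorem lift_of {M G : Type*} [AddCommMonoid M] [AddCommGroup G] (f : M →+ G) (a : M) :
    Algebra.GrothendieckAddGroup.lift f (Algebra.GrothendieckAddGroup.of a) = f a :=
  DFunLike.congr_fun (Algebra.GrothendieckAddGroup.lift.symm_apply_apply f) a

variable {κ : ℤ →+ ℤ} {c : ℤ ⧸ κ.range}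

theorem inner_basisVec_left (l : Weights κ c) (v : VSpace κ c) :
    inner ℂ (basisVec l) (show (V κ c).H from v) = v l := by
  refine (lp.inner_single_left (𝕜 := ℂ) (G := fun _ : Weights κ c => ℂ) l (1 : ℂ) v).trans ?_
  simp

/-- The coordinate of `v` at `l'` is its inner product with a vector of weight `l'`, which vanishes
unless `l' = l`. -/
theorem weightSpace_V_eq_span (l : Weights κ c) :
    weightSpace (V κ c) l.1 = Submodule.span ℂ {basisVec l} := by
  refine le_antisymm (fun v hv => ?_) ?_
  · rw [Submodule.mem_span_singleton]
    let w : VSpace κ c := v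
    refine ⟨w l, ?_⟩
    have key : ∀ l', ((w l • lp.single 2 l 1 : VSpace κ c)) l' = w l' := fun l' => by
      rw [lp.coeFn_smul, Pi.smul_apply, lp.coeFn_single]
      by_cases h : l' = l
      · subst h
        simp
      · rw [Pi.single_eq_of_ne h, smul_zero, ← inner_basisVec_left]
        exact (inner_eq_zero_of_mem_weightSpace (fun e => h (Subtype.ext e))
          (basisVec_mem_weightSpace l') hv).symm
    exact lp.ext (funext key)
  · rw [Submodule.span_le, Set.singleton_subset_iff]
    exact basisVec_mem_weightSpace l

theorem weightSpace_V_eq_bot {l : ℤ} (h : (l : ℤ ⧸ κ.range) ≠ c) :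
    weightSpace (V κ c) l = ⊥ := by
  refine (Submodule.eq_bot_iff _).2 fun v hv => ?_
  let w : VSpace κ c := v
  have key : ∀ l', w l' = 0 := fun l' => by
    rw [← inner_basisVec_left]
    exact inner_eq_zero_of_mem_weightSpace (fun e => h (by rw [← e]; exact l'.2))
      (basisVec_mem_weightSpace l') hv
  exact lp.ext (funext key)

theorem finiteMult_V (c : ℤ ⧸ κ.range) : FiniteMult (V κ c) := fun l => by
  by_cases h : (l : ℤ ⧸ κ.range) = c
  · have h1 := weightSpace_V_eq_span (⟨l, h⟩ : Weights κ c)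
    rw [h1]
    infer_instance
  · rw [weightSpace_V_eq_bot h]
    infer_instance

theorem finrank_weightSpace_V (c : ℤ ⧸ κ.range) (l : ℤ) [Decidable ((l : ℤ ⧸ κ.range) = c)] :
    Module.finrank ℂ (weightSpace (V κ c) l) = if (l : ℤ ⧸ κ.range) = c then 1 else 0 := by
  split_ifs with h
  · have h1 := weightSpace_V_eq_span (⟨l, h⟩ : Weights κ c)
    rw [h1]
    refine finrank_span_singleton fun h0 => ?_
    have := norm_basisVec (⟨l, h⟩ : Weights κ c)
    rw [h0, norm_zero] at this
    exact zero_ne_one this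
  · rw [weightSpace_V_eq_bot h, finrank_bot]

/-- The weight spaces of a direct sum. -/
def weightSpaceSumEquiv (π π' : TwistedRep (tau κ)) (l : ℤ) :
    weightSpace (π.sum π') l ≃ₗ[ℂ] weightSpace π l × weightSpace π' l where
  toFun v := (⟨WithLp.fst v.1, fun t => congrArg WithLp.fst (v.2 t)⟩,
    ⟨WithLp.snd v.1, fun t => congrArg WithLp.snd (v.2 t)⟩)
  map_add' _ _ := rfl
  map_smul' _ _ := rfl
  invFun v := ⟨WithLp.toLp 2 (v.1.1, v.2.1), fun t =>
    WithLp.ofLp_injective 2 (Prod.ext (v.1.2 t) (v.2.2 t))⟩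
  left_inv _ := rfl
  right_inv _ := rfl

theorem TwistedRep.Iso.nonempty_weightSpaceEquiv {π π' : TwistedRep (tau κ)} (h : π.Iso π')
    (l : ℤ) : Nonempty (weightSpace π l ≃ₗ[ℂ] weightSpace π' l) := by
  obtain ⟨U, hU⟩ := h
  exact ⟨
    { toFun := fun v => ⟨U v.1, fun t => by rw [← hU, v.2 t, map_smul]⟩
      map_add' := fun v w => Subtype.ext (map_add U v.1 w.1)
      map_smul' := fun z v => Subtype.ext (map_smul U z v.1)
      invFun := fun v => ⟨U.symm v.1, fun t => U.injective (by
        rw [hU, U.apply_symm_apply, v.2 t, map_smul, U.apply_symm_apply])⟩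
      left_inv := fun v => Subtype.ext (U.symm_apply_apply _)
      right_inv := fun v => Subtype.ext (U.apply_symm_apply _) }⟩

theorem TwistedRep.Iso.finrank_weightSpace {π π' : TwistedRep (tau κ)} (h : π.Iso π') (l : ℤ) :
    Module.finrank ℂ (weightSpace π l) = Module.finrank ℂ (weightSpace π' l) :=
  (h.nonempty_weightSpaceEquiv l).some.finrank_eq

variable (κ)

/-- The multiplicity of a representative of each coset of weights. -/
def multiplicity : RepMonoid κ →+ ((ℤ ⧸ κ.range) → ℤ) where
  toFun := Quotient.lift (fun π c => (Module.finrank ℂ (weightSpace π.1 c.out) : ℤ))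
    fun _ _ h => funext fun c => congrArg Nat.cast (TwistedRep.Iso.finrank_weightSpace h _)
  map_zero' := by
    funext c
    have : Subsingleton (TwistedRep.zero : TwistedRep (tau κ)).H :=
      inferInstanceAs (Subsingleton (EuclideanSpace ℂ Empty))
    exact congrArg Nat.cast (Module.finrank_zero_of_subsingleton (R := ℂ)
      (M := weightSpace (TwistedRep.zero : TwistedRep (tau κ)) c.out))
  map_add' := by
    rintro ⟨π⟩ ⟨π'⟩
    funext c
    have h1 := π.2 c.out
    have h2 := π'.2 c.out
    have h3 := (weightSpaceSumEquiv π.1 π'.1 c.out).finrank_eq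
    rw [Module.finrank_prod] at h3
    exact (congrArg Nat.cast h3).trans (Nat.cast_add _ _)

/-- The class of a representation in the monoid of representations. -/
def repClass (π : TwistedRep (tau κ)) (h : FiniteMult π) : RepMonoid κ :=
  Quotient.mk (repSetoid κ) ⟨π, h⟩

theorem multiplicity_repClass (π : TwistedRep (tau κ)) (h : FiniteMult π) (c : ℤ ⧸ κ.range) :
    multiplicity κ (repClass κ π h) c = Module.finrank ℂ (weightSpace π c.out) := rfl

theorem multiplicity_V (c : ℤ ⧸ κ.range) [DecidableEq (ℤ ⧸ κ.range)] :
    multiplicity κ (repClass κ (V κ c) (finiteMult_V c)) = Pi.single c 1 := by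
  funext d
  rw [multiplicity_repClass, finrank_weightSpace_V, QuotientAddGroup.out_eq', Pi.single_apply]
  split_ifs <;> rfl

variable {κ}

/-- The image of an intertwiner splits off as a direct summand. -/
theorem exists_iso_sum {π π' : TwistedRep (tau κ)} (W : π'.H →ₗᵢ[ℂ] π.H)
    (hW : ∀ a x, W (π'.ρ a x) = π.ρ a (W x)) :
    ∃ π'' : TwistedRep (tau κ), (π'.sum π'').Iso π := by
  let S : Submodule ℂ π.H := LinearMap.range W.toLinearMap
  have hc : IsClosed (S : Set π.H) := W.isometry.isClosedEmbedding.isClosed_range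
  let _ : CompleteSpace S := hc.completeSpace_coe
  have hSρ : ∀ a, ∀ v ∈ S, π.ρ a v ∈ S := by
    rintro a _ ⟨x, rfl⟩
    exact ⟨_, hW a x⟩
  have hS : ∀ a, ∀ v ∈ Sᗮ, π.ρ a v ∈ Sᗮ := by
    intro a v hv
    rw [Submodule.mem_orthogonal] at hv ⊢
    intro u hu
    rw [← (π.ρ a).apply_symm_apply u, LinearIsometryEquiv.inner_map_map]
    refine hv _ ?_
    rw [π.ρ_symm_apply]
    exact S.smul_mem _ (hSρ _ _ hu)
  -- The complementary summand is the orthogonal complement of the image. It is invariant because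
  -- the inverse of each `ρ(a)` preserves the image.
  refine ⟨π.restrict Sᗮ hS, (W.equivRange.withLpProdCongr 2 (LinearIsometryEquiv.refl ℂ Sᗮ)).trans
    S.orthogonalDecomposition.symm, fun a v => ?_⟩
  change W (π'.ρ a v.fst) + π.ρ a (v.snd : Sᗮ).1 = π.ρ a (W v.fst + (v.snd : Sᗮ).1)
  rw [map_add, hW]

theorem FiniteMult.of_sum_iso {π π' π'' : TwistedRep (tau κ)} (h : FiniteMult π)
    (e : (π'.sum π'').Iso π) : FiniteMult π'' := by
  intro l
  have := h l
  let F := (e.nonempty_weightSpaceEquiv l).some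
  exact FiniteDimensional.of_injective (F.toLinearMap ∘ₗ
    (weightSpaceSumEquiv π' π'' l).symm.toLinearMap ∘ₗ LinearMap.inr ℂ _ _)
    (F.injective.comp ((weightSpaceSumEquiv π' π'' l).symm.injective.comp LinearMap.inr_injective))

/-- The unitaries `ρ(1, m)` identify the weight spaces within a coset, so vanishing at one
representative of each coset forces all weight spaces, and then their dense span, to vanish. -/
theorem subsingleton_of_multiplicity_eq_zero {π : TwistedRep (tau κ)} {h : FiniteMult π}
    (h0 : multiplicity κ (repClass κ π h) = 0) : Subsingleton π.H := by
  have hbot : ∀ l, weightSpace π l = ⊥ := fun l => by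
    let c : ℤ ⧸ κ.range := l
    have := h c.out
    have h1 : Module.finrank ℂ (weightSpace π c.out) = 0 := by
      have h2 : ((Module.finrank ℂ (weightSpace π c.out) : ℕ) : ℤ) = 0 := congrFun h0 c
      exact_mod_cast h2
    rw [Submodule.finrank_eq_zero] at h1
    obtain ⟨m, hm⟩ := exists_sub_eq (⟨l, rfl⟩ : Weights κ c) ⟨c.out, QuotientAddGroup.out_eq' c⟩
    refine (Submodule.eq_bot_iff _).2 fun v hv => ?_
    have h2 := ρ_tpi_one_mem_weightSpace hv m
    change l - κ m = c.out at hm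
    rw [hm, h1, Submodule.mem_bot] at h2
    exact (map_eq_zero_iff _ (π.ρ (tpi 1 m)).injective).1 h2
  have h3 : (⨆ l, weightSpace π l).topologicalClosure = ⊤ :=
    iSup_circleWeightSpace_closure_eq_top π.torusAction_mul π.continuous_torusAction
  simp only [hbot, iSup_bot] at h3
  rw [IsClosed.submodule_topologicalClosure_eq isClosed_singleton] at h3
  exact (Submodule.subsingleton_iff ℂ).1 (subsingleton_of_bot_eq_top h3)

/-- Induction on the total multiplicity over the finitely many cosets: a nonzero weight vector
generates a copy of some `V_{[λ]}`, which splits off and lowers the total by one. -/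
theorem repClass_mem_closure (hκ : κ ≠ 0) (x : RepMonoid κ) :
    x ∈ AddSubmonoid.closure
      (Set.range fun c : ℤ ⧸ κ.range => repClass κ (V κ c) (finiteMult_V c)) := by
  classical
  let _ := finite_quotient_range hκ
  let _ : Fintype (ℤ ⧸ κ.range) := Fintype.ofFinite _
  obtain ⟨⟨π, h⟩⟩ := x
  change repClass κ π h ∈ _
  obtain ⟨N, hN⟩ : ∃ N : ℕ, ∑ c, multiplicity κ (repClass κ π h) c = N :=
    ⟨∑ c : ℤ ⧸ κ.range, Module.finrank ℂ (weightSpace π c.out), by push_cast; rfl⟩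
  induction N generalizing π with
  | zero =>
    have h0 : multiplicity κ (repClass κ π h) = 0 := funext fun c =>
      (Finset.sum_eq_zero_iff_of_nonneg fun c _ => by
        rw [multiplicity_repClass]; positivity).1 (hN.trans Nat.cast_zero) c (Finset.mem_univ c)
    have := subsingleton_of_multiplicity_eq_zero h0
    have : Subsingleton (TwistedRep.zero : TwistedRep (tau κ)).H :=
      inferInstanceAs (Subsingleton (EuclideanSpace ℂ Empty))
    have h1 : repClass κ π h = 0 := Quotient.sound
      (⟨⟨⟨⟨⟨fun _ => 0, fun _ _ => (add_zero _).symm⟩, fun _ _ => (smul_zero _).symm⟩, fun _ => 0,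
        fun _ => Subsingleton.elim _ _, fun _ => Subsingleton.elim _ _⟩, fun x => by
          rw [Subsingleton.elim x 0, map_zero, norm_zero, norm_zero]⟩,
        fun _ _ => Subsingleton.elim _ _⟩ : π.Iso TwistedRep.zero)
    rw [h1]
    exact zero_mem _
  | succ N ih =>
    obtain ⟨c, -, hc⟩ : ∃ c ∈ Finset.univ, multiplicity κ (repClass κ π h) c ≠ 0 :=
      Finset.exists_ne_zero_of_sum_ne_zero (by rw [hN]; positivity)
    rw [multiplicity_repClass] at hc
    have := h c.out
    obtain ⟨v, hv0⟩ : ∃ v : weightSpace π c.out, v ≠ 0 := by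
      have : 0 < Module.finrank ℂ (weightSpace π c.out) := by
        rw [Nat.pos_iff_ne_zero]
        exact_mod_cast hc
      have := Module.finrank_pos_iff.1 this
      exact exists_ne 0
    have hv1 : v.1 ≠ 0 := fun e => hv0 (Subtype.ext e)
    obtain ⟨W, hW, -⟩ := exists_intertwiner hκ π (⟨c.out, QuotientAddGroup.out_eq' c⟩ : Weights κ c)
      (v := ((‖v.1‖⁻¹ : ℝ) : ℂ) • v.1) (Submodule.smul_mem _ _ v.2) (by
        rw [norm_smul, Complex.norm_real, norm_inv, norm_norm,
          inv_mul_cancel₀ (norm_ne_zero_iff.2 hv1)])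
    obtain ⟨π'', e⟩ := exists_iso_sum W hW
    have h'' : FiniteMult π'' := h.of_sum_iso e
    have hadd : repClass κ π h = repClass κ (V κ c) (finiteMult_V c) + repClass κ π'' h'' :=
      Quotient.sound e.symm
    rw [hadd]
    refine add_mem (AddSubmonoid.subset_closure ⟨c, rfl⟩) (ih π'' h'' ?_)
    rw [hadd, map_add, multiplicity_V] at hN
    simp only [Pi.add_apply, Finset.sum_add_distrib, Finset.sum_pi_single', Finset.mem_univ,
      if_true] at hN
    push_cast at hN
    linarith

/-- `R^τ(T × Π_T)` is free on the classes of the representations `V_{[λ]}`. -/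
theorem exists_addEquiv_RTau (hκ : κ ≠ 0) :
    ∃ e : ((ℤ ⧸ κ.range) →₀ ℤ) ≃+ RTau κ,
      ∀ c : ℤ ⧸ κ.range, ∃ h : FiniteMult (V κ c),
        e (Finsupp.single c 1) = RTau.mk κ (V κ c) h := by
  classical
  let F : ((ℤ ⧸ κ.range) →₀ ℤ) →+ RTau κ := Finsupp.liftAddHom fun c =>
    zmultiplesHom _ (RTau.mk κ (V κ c) (finiteMult_V c))
  have hF : ∀ c, F (Finsupp.single c 1) = RTau.mk κ (V κ c) (finiteMult_V c) := fun c => by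
    rw [Finsupp.liftAddHom_apply_single, zmultiplesHom_apply, one_zsmul]
  let G : RTau κ →+ ((ℤ ⧸ κ.range) → ℤ) := Algebra.GrothendieckAddGroup.lift (multiplicity κ)
  -- The multiplicities invert `F` on generators, which gives injectivity.
  have hGF : ∀ x, G (F x) = x := fun x => by
    have h1 : G.comp F = Finsupp.coeFnAddHom := by
      refine Finsupp.addHom_ext' fun c => AddMonoidHom.ext_int ?_
      change G (F (Finsupp.single c 1)) = ⇑(Finsupp.single c (1 : ℤ))
      rw [hF, Finsupp.single_eq_pi_single]
      exact (lift_of _ _).trans (multiplicity_V κ c)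
    exact DFunLike.congr_fun h1 x
  have hof : ∀ a : RepMonoid κ, Algebra.GrothendieckAddGroup.of a ∈ F.range := fun a => by
    have h1 : AddSubmonoid.closure
        (Set.range fun c : ℤ ⧸ κ.range => repClass κ (V κ c) (finiteMult_V c)) ≤
        F.range.toAddSubmonoid.comap Algebra.GrothendieckAddGroup.of := by
      rw [AddSubmonoid.closure_le]
      rintro _ ⟨c, rfl⟩
      exact ⟨_, hF c⟩
    exact h1 (repClass_mem_closure hκ a)
  refine ⟨AddEquiv.ofBijective F ⟨fun x y hxy => ?_, fun x => ?_⟩, fun c => ⟨_, hF c⟩⟩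
  · have h1 := hGF x
    rw [hxy, hGF] at h1
    exact DFunLike.coe_injective h1.symm
  · obtain ⟨a, b, rfl⟩ := exists_of_sub_of x
    exact F.range.sub_mem (hof a) (hof b)

end GrothendieckReps

end TwistedCStar
end

noncomputable section

namespace TwistedCStar

/-! ### Matrices of operators -/

section OpMatrix

variable {H : Type*} [NormedAddCommGroup H] [InnerProductSpace ℂ H] [CompleteSpace H]

/-- An isometry that is a compact perturbation of the identity is unitary. By the Fredholm
alternative for `T - 1`, either `-1` is an eigenvalue, and its eigenvector lies in the kernel of the
isometry `T`, or `T` is invertible. -/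
theorem mul_star_eq_one_of_isCompactOperator_sub_one {T : H →L[ℂ] H}
    (hT : IsCompactOperator (T - 1 : H →L[ℂ] H)) (h : star T * T = 1) : T * star T = 1 := by
  have h1 : IsUnit T := by
    rcases hT.hasEigenvalue_or_mem_resolventSet (neg_ne_zero.2 one_ne_zero : (-1 : ℂ) ≠ 0)
      with h2 | h2
    · obtain ⟨v, hv⟩ := h2.exists_hasEigenvector
      have h3 : T v - v = (-1 : ℂ) • v := hv.apply_eq_smul
      rw [neg_one_smul, sub_eq_neg_self] at h3
      have h4 : (star T * T) v = 0 := by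
        change star T (T v) = 0
        rw [h3, map_zero]
      rw [h] at h4
      exact absurd h4 hv.2
    · rw [spectrum.mem_resolventSet_iff] at h2
      have h3 : (algebraMap ℂ (H →L[ℂ] H)) (-1) - (T - 1) = -T := by
        rw [map_neg, map_one]
        abel
      rw [h3, IsUnit.neg_iff] at h2
      exact h2
  refine h1.mul_right_cancel ?_
  rw [mul_assoc, h, mul_one, one_mul]

/-- The range of a compact projection lies in its eigenspace for `1`, which is finite-dimensional.
-/
theorem exists_eq_sum_rankOne {Q : H →L[ℂ] H} (hQ : IsCompactOperator Q) (hs : star Q = Q)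
    (hi : Q * Q = Q) : ∃ (r : ℕ) (ξ : Fin r → H), Orthonormal ℂ ξ ∧
      Q = ∑ k, InnerProductSpace.rankOne ℂ (ξ k) (ξ k) := by
  have h1 := ContinuousLinearMap.finite_dimensional_eigenspace hQ 1 one_ne_zero
  have h2 : IsStarProjection Q := ⟨hi, hs⟩
  rw [isStarProjection_iff_eq_starProjection_range] at h2
  obtain ⟨h3, h4⟩ := h2
  have h5 : FiniteDimensional ℂ Q.range := by
    refine Submodule.finiteDimensional_of_le (S₂ := Module.End.eigenspace Q.toLinearMap 1) ?_
    rintro _ ⟨x, rfl⟩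
    rw [Module.End.mem_eigenspace_iff, one_smul]
    exact DFunLike.congr_fun hi x
  let b := stdOrthonormalBasis ℂ Q.range
  refine ⟨_, fun k => (b k : H), b.orthonormal.comp_linearIsometry Q.range.subtypeₗᵢ, ?_⟩
  exact h4.trans b.starProjection_eq_sum_rankOne

variable {n : Type*} [Fintype n]

/-- The operator on `H ^ n` given by a matrix of operators. -/
def opMat (M : Matrix n n (H →L[ℂ] H)) :
    (PiLp 2 fun _ : n => H) →L[ℂ] (PiLp 2 fun _ : n => H) :=
  ((PiLp.continuousLinearEquiv 2 ℂ fun _ : n => H).symm : (n → H) →L[ℂ] PiLp 2 fun _ : n => H) ∘L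
    ContinuousLinearMap.pi fun i => ∑ j, M i j ∘L PiLp.proj 2 (fun _ : n => H) j

theorem opMat_apply (M : Matrix n n (H →L[ℂ] H)) (v : PiLp 2 fun _ : n => H) (i : n) :
    opMat M v i = ∑ j, M i j (v j) := by
  change (∑ j, M i j ∘L PiLp.proj 2 (fun _ : n => H) j) v = _
  rw [sum_apply]
  rfl

theorem opMat_sub (M N : Matrix n n (H →L[ℂ] H)) : opMat (M - N) = opMat M - opMat N := by
  ext v i
  change opMat (M - N) v i = opMat M v i - opMat N v i
  simp only [opMat_apply, Matrix.sub_apply, sub_apply, Finset.sum_sub_distrib]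

theorem opMat_mul (M N : Matrix n n (H →L[ℂ] H)) : opMat (M * N) = opMat M * opMat N := by
  ext v i
  change opMat (M * N) v i = opMat M (opMat N v) i
  simp only [opMat_apply, Matrix.mul_apply, sum_apply, map_sum]
  exact Finset.sum_comm

theorem opMat_one [DecidableEq n] : opMat (1 : Matrix n n (H →L[ℂ] H)) = 1 := by
  ext v i
  change opMat 1 v i = v i
  rw [opMat_apply, Finset.sum_eq_single_of_mem i (Finset.mem_univ i)]
  · rw [Matrix.one_apply_eq]
    rfl
  · intro j _ hj
    rw [Matrix.one_apply_ne hj.symm]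
    rfl

theorem opMat_conjTranspose (M : Matrix n n (H →L[ℂ] H)) :
    opMat M.conjTranspose = star (opMat M) := by
  rw [ContinuousLinearMap.star_eq_adjoint, ContinuousLinearMap.eq_adjoint_iff]
  intro v w
  rw [PiLp.inner_apply, PiLp.inner_apply]
  simp only [opMat_apply, sum_inner, inner_sum]
  rw [Finset.sum_comm]
  refine Finset.sum_congr rfl fun i _ => Finset.sum_congr rfl fun j _ => ?_
  rw [Matrix.conjTranspose_apply, ContinuousLinearMap.star_eq_adjoint,
    ContinuousLinearMap.adjoint_inner_left]

theorem opMat_single [DecidableEq n] (M : Matrix n n (H →L[ℂ] H)) (i j : n) (x : H) :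
    opMat M (PiLp.single 2 j x) i = M i j x := by
  rw [opMat_apply, Finset.sum_eq_single_of_mem j (Finset.mem_univ j)]
  · simp
  · intro k _ hk
    simp [hk]

/-- The operator is the finite sum of its entries, each composed with a coordinate projection and a
coordinate inclusion. -/
theorem isCompactOperator_opMat {M : Matrix n n (H →L[ℂ] H)}
    (hM : ∀ i j, IsCompactOperator (M i j)) : IsCompactOperator (opMat M) := by
  classical
  have h1 : opMat M = ∑ i, ∑ j,
      (((PiLp.continuousLinearEquiv 2 ℂ fun _ : n => H).symm :
        (n → H) →L[ℂ] PiLp 2 fun _ : n => H) ∘L ContinuousLinearMap.single ℂ (fun _ : n => H) i) ∘L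
        M i j ∘L PiLp.proj 2 (fun _ : n => H) j := by
    ext v k
    have h2 : ∀ i j, ((((PiLp.continuousLinearEquiv 2 ℂ fun _ : n => H).symm :
        (n → H) →L[ℂ] PiLp 2 fun _ : n => H) ∘L ContinuousLinearMap.single ℂ (fun _ : n => H) i) ∘L
        M i j ∘L PiLp.proj 2 (fun _ : n => H) j) v k = if k = i then M i j (v j) else 0 :=
      fun i j => Pi.single_apply i (M i j (v j)) k
    simp only [sum_apply, WithLp.ofLp_sum, Finset.sum_apply, h2, opMat_apply]
    rw [Finset.sum_comm]
    simp
  rw [h1]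
  refine Finset.sum_induction _ (fun T : (PiLp 2 fun _ : n => H) →L[ℂ] (PiLp 2 fun _ : n => H) =>
    IsCompactOperator T) (fun _ _ => IsCompactOperator.add) isCompactOperator_zero fun i _ =>
    Finset.sum_induction _ (fun T : (PiLp 2 fun _ : n => H) →L[ℂ] (PiLp 2 fun _ : n => H) =>
    IsCompactOperator T) (fun _ _ => IsCompactOperator.add) isCompactOperator_zero fun j _ => ?_
  exact ((hM i j).comp_clm (PiLp.proj 2 (fun _ : n => H) j)).clm_comp
    (((PiLp.continuousLinearEquiv 2 ℂ fun _ : n => H).symm :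
      (n → H) →L[ℂ] PiLp 2 fun _ : n => H) ∘L ContinuousLinearMap.single ℂ (fun _ : n => H) i)

end OpMatrix

/-! ### Stable finiteness of the unitized compact operators -/

section StablyFinite

variable {H : Type*} [NormedAddCommGroup H] [InnerProductSpace ℂ H] [CompleteSpace H]

/-- The action of the unitization of the compact operators. -/
def unitizedToCLM (H : Type*) [NormedAddCommGroup H] [InnerProductSpace ℂ H] [CompleteSpace H] :
    Unitization ℂ (CompactOps H) →⋆ₐ[ℂ] (H →L[ℂ] H) :=
  Unitization.starLift (CompactOps.toCLMHom H)

theorem unitizedToCLM_inr (x : CompactOps H) : unitizedToCLM H x = x.toCLM := by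
  have h := Unitization.starLift_symm_apply_apply (R := ℂ) (unitizedToCLM H) x
  rw [← h, unitizedToCLM, Equiv.symm_apply_apply]
  rfl

/-- The scalar part of an element of a unitization, as a `*`-homomorphism. -/
def scalarPart (A : Type*) [NonUnitalCStarAlgebra A] : Unitization ℂ A →⋆ₐ[ℂ] ℂ where
  __ := Unitization.fstHom ℂ A
  map_star' _ := rfl

theorem eq_inr_of_scalarPart_eq_zero {A : Type*} [NonUnitalCStarAlgebra A] {x : Unitization ℂ A}
    (hx : scalarPart A x = 0) : x = (x.snd : Unitization ℂ A) := Unitization.ext hx rfl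

variable {R S : Type*} [Ring R] [StarRing R] [Algebra ℂ R] [Ring S] [StarRing S] [Algebra ℂ S]

theorem conjTranspose_map_starHom {m k : Type*} (φ : R →⋆ₐ[ℂ] S) (M : Matrix m k R) :
    (M.map φ).conjTranspose = M.conjTranspose.map φ :=
  (Matrix.conjTranspose_map (f := φ) (map_star φ)).symm

theorem mul_map_starHom {l m k : Type*} [Fintype m] (φ : R →⋆ₐ[ℂ] S) (M : Matrix l m R)
    (N : Matrix m k R) : (M * N).map φ = M.map φ * N.map φ :=
  Matrix.map_mul (f := (φ : R →+* S))

theorem one_map_starHom {n : Type*} [DecidableEq n] (φ : R →⋆ₐ[ℂ] S) :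
    (1 : Matrix n n R).map φ = 1 := Matrix.map_one φ (map_zero φ) (map_one φ)

theorem sub_map_starHom {m k : Type*} (φ : R →⋆ₐ[ℂ] S) (M N : Matrix m k R) :
    (M - N).map φ = M.map φ - N.map φ := Matrix.map_sub φ (map_sub φ) M N

variable {n : Type*} [Fintype n] [DecidableEq n]

/-- With scalar part `1`, the matrix `Z` acts on `H ^ n` as a compact perturbation of the identity,
to which the Fredholm alternative applies. -/
theorem mul_conjTranspose_eq_one_of_scalarPart {Z : Matrix n n (Unitization ℂ (CompactOps H))}
    (h : Z.conjTranspose * Z = 1) (h0 : Z.map (scalarPart (CompactOps H)) = 1) :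
    Z * Z.conjTranspose = 1 := by
  have h1 : star (opMat (Z.map (unitizedToCLM H))) * opMat (Z.map (unitizedToCLM H)) = 1 := by
    rw [← opMat_conjTranspose, ← opMat_mul, conjTranspose_map_starHom, ← mul_map_starHom, h,
      one_map_starHom, opMat_one]
  have h2 : IsCompactOperator (opMat (Z.map (unitizedToCLM H)) - 1 :
      (PiLp 2 fun _ : n => H) →L[ℂ] (PiLp 2 fun _ : n => H)) := by
    rw [← opMat_one, ← opMat_sub, ← one_map_starHom (unitizedToCLM H), ← sub_map_starHom]
    refine isCompactOperator_opMat fun i j => ?_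
    have h3 : scalarPart (CompactOps H) ((Z - 1) i j) = 0 := by
      have : ((Z - 1).map (scalarPart (CompactOps H))) i j = 0 := by
        rw [sub_map_starHom, h0, one_map_starHom, sub_self]
        rfl
      exact this
    rw [Matrix.map_apply, eq_inr_of_scalarPart_eq_zero h3, unitizedToCLM_inr]
    exact CompactOps.isCompactOperator _
  have h4 := mul_star_eq_one_of_isCompactOperator_sub_one h2 h1
  rw [← opMat_conjTranspose, ← opMat_mul, conjTranspose_map_starHom, ← mul_map_starHom,
    ← sub_eq_zero, ← opMat_one, ← opMat_sub, ← one_map_starHom (unitizedToCLM H),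
    ← sub_map_starHom] at h4
  rw [← sub_eq_zero]
  ext1 i j
  -- If `H` is finite-dimensional, the unitization does not act faithfully on `H`. The vanishing of
  -- the scalar part is therefore needed: it puts the entry in `𝒦(H)`, which does act faithfully.
  have h5 : scalarPart (CompactOps H) ((Z * Z.conjTranspose - 1) i j) = 0 := by
    have : ((Z * Z.conjTranspose - 1).map (scalarPart (CompactOps H))) i j = 0 := by
      rw [sub_map_starHom, mul_map_starHom, ← conjTranspose_map_starHom, h0, one_map_starHom,
        Matrix.conjTranspose_one, one_mul, sub_self]
      rfl
    exact this
  have h6 : unitizedToCLM H ((Z * Z.conjTranspose - 1) i j) = 0 := by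
    ext x
    have := opMat_single ((Z * Z.conjTranspose - 1).map (unitizedToCLM H)) i j x
    rw [h4] at this
    exact this.symm
  rw [eq_inr_of_scalarPart_eq_zero h5, unitizedToCLM_inr] at h6
  rw [eq_inr_of_scalarPart_eq_zero h5, CompactOps.ext (T := 0) h6]
  rfl

/-- The unitization of the compact operators is stably finite. -/
theorem mul_conjTranspose_eq_one {Y : Matrix n n (Unitization ℂ (CompactOps H))}
    (h : Y.conjTranspose * Y = 1) : Y * Y.conjTranspose = 1 := by
  let ε := scalarPart (CompactOps H)
  let j : ℂ →⋆ₐ[ℂ] Unitization ℂ (CompactOps H) := StarAlgHom.ofId ℂ _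
  have hεj : ∀ z, ε (j z) = z := fun z => (ε.toAlgHom.commutes z : _)
  -- The scalar part of `Y` is an isometry over `ℂ`, hence unitary. Multiplying `Y` by the adjoint
  -- of this unitary reduces to scalar part `1`.
  let W : Matrix n n (Unitization ℂ (CompactOps H)) := (Y.map ε).map j
  have h0 : (Y.map ε).conjTranspose * Y.map ε = 1 := by
    rw [conjTranspose_map_starHom, ← mul_map_starHom, h, one_map_starHom]
  have hW : W * W.conjTranspose = 1 := by
    rw [conjTranspose_map_starHom, ← mul_map_starHom, mul_eq_one_comm.1 h0, one_map_starHom]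
  have hWε : W.map ε = Y.map ε := by
    ext i k
    exact hεj _
  have h1 : (W.conjTranspose * Y).conjTranspose * (W.conjTranspose * Y) = 1 := by
    rw [Matrix.conjTranspose_mul, Matrix.conjTranspose_conjTranspose, Matrix.mul_assoc,
      ← Matrix.mul_assoc W, hW, Matrix.one_mul, h]
  have h2 := mul_conjTranspose_eq_one_of_scalarPart h1 (by
    rw [mul_map_starHom, ← conjTranspose_map_starHom, hWε, h0])
  calc Y * Y.conjTranspose
      = W * ((W.conjTranspose * Y) * (W.conjTranspose * Y).conjTranspose) * W.conjTranspose := by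
        rw [Matrix.conjTranspose_mul, Matrix.conjTranspose_conjTranspose]
        simp only [← Matrix.mul_assoc]
        rw [hW, Matrix.one_mul, Matrix.mul_assoc _ W, hW, Matrix.mul_one]
    _ = 1 := by rw [h2, Matrix.mul_one, hW]

end StablyFinite

end TwistedCStar
end

noncomputable section

namespace TwistedCStar

/-! ### Classes of projections -/

section Classes

theorem of_eq_of_iff {M : Type*} [AddCommMonoid M] {a b : M} :
    Algebra.GrothendieckAddGroup.of a = Algebra.GrothendieckAddGroup.of b ↔
      ∃ c, a + c = b + c := by
  refine ((AddLocalization.addMonoidOf (⊤ : AddSubmonoid M)).eq_iff_exists).trans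
    ⟨fun ⟨c, hc⟩ => ⟨c, ?_⟩, fun ⟨c, hc⟩ => ⟨⟨c, trivial⟩, ?_⟩⟩
  · rw [add_comm a, add_comm b]
    exact hc
  · rw [add_comm a, add_comm b] at hc
    exact hc

namespace ProjMonoid

variable {R : Type*} [Ring R] [StarRing R]

/-- The class of a projection. -/
def cls (p : MatProj R) : ProjMonoid R := Quotient.mk _ p

theorem exists_cls (x : ProjMonoid R) : ∃ p, x = cls p := by
  obtain ⟨p⟩ := x
  exact ⟨p, rfl⟩

theorem cls_add (p q : MatProj R) : cls (p.add q) = cls p + cls q := rfl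

theorem cls_eq_cls {p q : MatProj R} : cls p = cls q ↔ MatProj.MvN p q := Quotient.eq

theorem cls_eq_zero {p : MatProj R} : cls p = 0 ↔ p.p = 0 := by
  refine (cls_eq_cls (q := MatProj.zero)).trans ⟨fun ⟨v, h, _⟩ => ?_, fun h => ⟨0, ?_, ?_⟩⟩
  · rw [← h]
    ext i j
    exact Finset.sum_empty (f := fun k : Fin 0 => v.conjTranspose i k * v k j)
  · rw [h]
    ext i j
    exact Finset.sum_empty (f := fun k : Fin 0 => (0 : Matrix (Fin p.n) (Fin 0) R) i k *
      (0 : Matrix (Fin 0) (Fin p.n) R) k j)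
  · ext i
    exact Fin.elim0 i

theorem eq_zero_of_cls_add_eq_zero {p : MatProj R} {x : ProjMonoid R} (h : cls p + x = 0) :
    p.p = 0 := by
  obtain ⟨q, rfl⟩ := exists_cls x
  have h1 := cls_eq_zero.1 ((cls_add p q).trans h)
  ext i j
  refine (MatProj.add_p_addIndex p q (Sum.inl i) (Sum.inl j)).symm.trans ?_
  rw [h1]
  rfl

/-- The class of an orthogonal sum of projections. -/
theorem cls_orthogonal_add {n : ℕ} {p q r : Matrix (Fin n) (Fin n) R} (hp : p.conjTranspose = p)
    (hp' : p * p = p) (hq : q.conjTranspose = q) (hq' : q * q = q) (hr : r.conjTranspose = r)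
    (hr' : r * r = r) (h : p + q = r) (hpq : p * q = 0) :
    cls ⟨n, p, hp, hp'⟩ + cls ⟨n, q, hq, hq'⟩ = cls ⟨n, r, hr, hr'⟩ := by
  have hqp : q * p = 0 := by
    rw [← hp, ← hq, ← Matrix.conjTranspose_mul, hpq, Matrix.conjTranspose_zero]
  rw [← cls_add, cls_eq_cls]
  -- The equivalence is implemented by the row `(p q)`: orthogonality makes its Gram matrix block
  -- diagonal, and the other product is `p + q`.
  refine MatProj.equiv_of (MatProj.addIndex ⟨n, p, hp, hp'⟩ ⟨n, q, hq, hq'⟩) (Equiv.refl (Fin n))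
    (Matrix.fromCols p q) ?_ ?_
  · rw [MatProj.add_p_submatrix, Matrix.conjTranspose_fromCols_eq_fromRows_conjTranspose,
      Matrix.fromRows_mul_fromCols, hp, hq, hp', hq', hpq, hqp]
  · rw [Matrix.conjTranspose_fromCols_eq_fromRows_conjTranspose,
      Matrix.fromCols_mul_fromRows, hp, hq, hp', hq', h]
    rfl

variable (R) in
/-- The identity matrix as a projection. -/
def onePr (n : ℕ) : MatProj R := ⟨n, 1, Matrix.conjTranspose_one, one_mul 1⟩

theorem cls_onePr_add (m n : ℕ) : cls (onePr R (m + n)) = cls (onePr R m) + cls (onePr R n) := by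
  rw [← cls_add]
  congr 1
  have h : ((onePr R m).add (onePr R n)).p = 1 := by
    change (Matrix.fromBlocks (1 : Matrix (Fin m) (Fin m) R) 0 0
      (1 : Matrix (Fin n) (Fin n) R)).submatrix finSumFinEquiv.symm finSumFinEquiv.symm = 1
    rw [Matrix.fromBlocks_one, Matrix.submatrix_one_equiv]
  rw [onePr]
  congr 1
  exact h.symm

theorem cls_onePr_zero : cls (onePr R 0) = 0 := by
  rw [cls_eq_zero]
  ext i
  exact Fin.elim0 i

theorem nsmul_cls_onePr (m n : ℕ) : m • cls (onePr R n) = cls (onePr R (m * n)) := by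
  induction m with
  | zero => rw [zero_nsmul, zero_mul, cls_onePr_zero]
  | succ m ih => rw [succ_nsmul, ih, add_mul, one_mul, cls_onePr_add]

/-- The complement of a projection. -/
def compl (p : MatProj R) : MatProj R where
  n := p.n
  p := 1 - p.p
  star_eq := by rw [Matrix.conjTranspose_sub, Matrix.conjTranspose_one, p.star_eq]
  idem := (IsIdempotentElem.one_sub (show IsIdempotentElem p.p from p.idem)).eq

theorem cls_add_cls_compl (p : MatProj R) : cls p + cls (compl p) = cls (onePr R p.n) :=
  cls_orthogonal_add _ _ _ _ _ _ (add_sub_cancel _ _) (by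
    rw [mul_sub, mul_one, p.idem, sub_self])

theorem exists_add_eq_onePr (x : ProjMonoid R) : ∃ y k, x + y = cls (onePr R k) := by
  obtain ⟨p, rfl⟩ := exists_cls x
  exact ⟨_, _, cls_add_cls_compl p⟩

/-- The hypothesis makes the identity of size `p.n + k` equivalent to `(1 - p) ⊕ 1_k`, of the same
size. The equivalence is then a square isometry, and stable finiteness forces `(1 - p) ⊕ 1_k = 1`.
-/
theorem eq_zero_of_cls_add_onePr (hR : ∀ (n : ℕ) (Y : Matrix (Fin n) (Fin n) R),
    Y.conjTranspose * Y = 1 → Y * Y.conjTranspose = 1) {p : MatProj R} {k : ℕ}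
    (h : cls p + cls (onePr R k) = cls (onePr R k)) : p.p = 0 := by
  have h1 : cls (onePr R (p.n + k)) = cls ((compl p).add (onePr R k)) := by
    rw [cls_onePr_add, ← cls_add_cls_compl, add_comm (cls p), add_assoc, h, cls_add]
  obtain ⟨v, hv1, hv2⟩ := cls_eq_cls.1 h1
  have hv3 : ((compl p).add (onePr R k)).p = 1 := hv2.symm.trans (hR (p.n + k) v hv1)
  have h2 : (compl p).p = 1 := by
    ext i j
    refine (MatProj.add_p_addIndex (compl p) (onePr R k) (Sum.inl i) (Sum.inl j)).symm.trans ?_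
    rw [hv3, Matrix.one_apply, Matrix.one_apply]
    have : (MatProj.addIndex (compl p) (onePr R k) (Sum.inl i) =
      MatProj.addIndex (compl p) (onePr R k) (Sum.inl j)) ↔ i = j := by
        rw [(MatProj.addIndex _ _).apply_eq_iff_eq, Sum.inl.injEq]
    simp only [this]
  have h3 : 1 - p.p = 1 := h2
  simpa using h3

/-- Over a stably finite ring, multiples of the class of a non-zero projection are stably
distinct. -/
theorem eq_of_nsmul_cls_add (hR : ∀ (n : ℕ) (Y : Matrix (Fin n) (Fin n) R),
    Y.conjTranspose * Y = 1 → Y * Y.conjTranspose = 1) {F : MatProj R} (hF : F.p ≠ 0) {a b : ℕ}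
    {x : ProjMonoid R} (h : a • cls F + x = b • cls F + x) : a = b := by
  wlog hab : a ≤ b generalizing a b
  · exact (this h.symm (le_of_not_ge hab)).symm
  obtain ⟨d, rfl⟩ := Nat.exists_eq_add_of_le hab
  obtain ⟨y, k, hk⟩ := exists_add_eq_onePr x
  -- Adding `a` copies of `1 - F` and a complement `y` of `x` to both sides turns the common part
  -- into the class of an identity matrix.
  have h1 : d • cls F + cls (onePr R (a * F.n + k)) = cls (onePr R (a * F.n + k)) := by
    rw [cls_onePr_add, ← nsmul_cls_onePr, ← cls_add_cls_compl, ← hk, nsmul_add]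
    calc d • cls F + (a • cls F + a • cls (compl F) + (x + y))
        = ((a + d) • cls F + x) + (a • cls (compl F) + y) := by rw [add_nsmul]; abel
      _ = (a • cls F + x) + (a • cls (compl F) + y) := by rw [h]
      _ = _ := by abel
  obtain ⟨p, hp⟩ := exists_cls (d • cls F)
  rw [hp] at h1
  have h2 := cls_eq_zero.2 (eq_zero_of_cls_add_onePr hR h1)
  rw [← hp] at h2
  rcases d with _ | d
  · rfl
  · rw [add_comm d 1, add_nsmul, one_nsmul] at h2
    exact absurd (eq_zero_of_cls_add_eq_zero h2) hF

end ProjMonoid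

theorem K0Unital.map_of {R S : Type*} [Ring R] [StarRing R] [Ring S] [StarRing S]
    (φ : R →+* S) (hφ : ∀ x, φ (star x) = star (φ x)) (x : ProjMonoid R) :
    K0Unital.map φ hφ (Algebra.GrothendieckAddGroup.of x) =
      Algebra.GrothendieckAddGroup.of (ProjMonoid.map φ hφ x) := lift_of _ _

theorem K0Unital.map_map {R S Q : Type*} [Ring R] [StarRing R] [Ring S] [StarRing S]
    [Ring Q] [StarRing Q] (φ : R →+* S) (hφ : ∀ x, φ (star x) = star (φ x))
    (ψ : S →+* Q) (hψ : ∀ x, ψ (star x) = star (ψ x)) (χ : R →+* Q)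
    (hχ : ∀ x, χ (star x) = star (χ x)) (h : ∀ x, ψ (φ x) = χ x) (x : K0Unital R) :
    K0Unital.map ψ hψ (K0Unital.map φ hφ x) = K0Unital.map χ hχ x := by
  have h1 : ∀ a, K0Unital.map ψ hψ (K0Unital.map φ hφ (Algebra.GrothendieckAddGroup.of a)) =
      K0Unital.map χ hχ (Algebra.GrothendieckAddGroup.of a) := fun a => by
    obtain ⟨p, rfl⟩ := ProjMonoid.exists_cls a
    rw [K0Unital.map_of, K0Unital.map_of, K0Unital.map_of]
    congr 2
    refine congrArg ProjMonoid.cls ?_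
    change MatProj.mk _ _ _ _ = MatProj.mk _ _ _ _
    congr 1
    ext i j
    exact h _
  obtain ⟨a, b, rfl⟩ := exists_of_sub_of x
  rw [map_sub, map_sub, map_sub, h1, h1]

theorem K0Unital.map_id {R : Type*} [Ring R] [StarRing R] (x : K0Unital R) :
    K0Unital.map (RingHom.id R) (fun _ => rfl) x = x := by
  have h1 : ∀ a : ProjMonoid R, K0Unital.map (RingHom.id R) (fun _ => rfl)
      (Algebra.GrothendieckAddGroup.of a) = Algebra.GrothendieckAddGroup.of a := fun a => by
    obtain ⟨p, rfl⟩ := ProjMonoid.exists_cls a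
    rw [K0Unital.map_of]
    rfl
  obtain ⟨a, b, rfl⟩ := exists_of_sub_of x
  rw [map_sub, h1, h1]

/-- The unitized maps commute with the scalar characters, so they respect the kernels that define
`K_0`. -/
theorem fst_starMap {A B : Type*} [NonUnitalCStarAlgebra A] [NonUnitalCStarAlgebra B]
    (φ : A →⋆ₙₐ[ℂ] B) (x : Unitization ℂ A) : (Unitization.starMap φ x).fst = x.fst := by
  induction x using Unitization.ind with
  | inl_add_inr r a =>
    rw [map_add, Unitization.starMap_inl, Unitization.starMap_inr, Unitization.algebraMap_eq_inl]
    rfl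

/-- Isomorphic `C^*`-algebras have isomorphic `K_0` groups. -/
theorem nonempty_K0_addEquiv {A B : Type*} [NonUnitalCStarAlgebra A] [NonUnitalCStarAlgebra B]
    (φ : A ≃⋆ₐ[ℂ] B) : Nonempty (K0 A ≃+ K0 B) := by
  let φ₁ : A →⋆ₙₐ[ℂ] B := φ
  let φ₂ : B →⋆ₙₐ[ℂ] A := φ.symm
  let Φ : Unitization ℂ A →⋆ₐ[ℂ] Unitization ℂ B := Unitization.starMap φ₁
  let Ψ : Unitization ℂ B →⋆ₐ[ℂ] Unitization ℂ A := Unitization.starMap φ₂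
  have hΦ : ∀ x, (Φ x).fst = x.fst := fst_starMap φ₁
  have hΨ : ∀ x, (Ψ x).fst = x.fst := fst_starMap φ₂
  have h12 : φ₂.comp φ₁ = NonUnitalStarAlgHom.id ℂ A :=
    NonUnitalStarAlgHom.ext fun x => φ.symm_apply_apply x
  have h21 : φ₁.comp φ₂ = NonUnitalStarAlgHom.id ℂ B :=
    NonUnitalStarAlgHom.ext fun x => φ.apply_symm_apply x
  have hΨΦ : ∀ x, Ψ (Φ x) = x := fun x => by
    have h := DFunLike.congr_fun (Unitization.starMap_comp (φ := φ₁) (ψ := φ₂)) x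
    rw [h12, Unitization.starMap_id] at h
    exact h.symm
  have hΦΨ : ∀ x, Φ (Ψ x) = x := fun x => by
    have h := DFunLike.congr_fun (Unitization.starMap_comp (φ := φ₂) (ψ := φ₁)) x
    rw [h21, Unitization.starMap_id] at h
    exact h.symm
  let F := K0Unital.map (Φ : Unitization ℂ A →+* Unitization ℂ B) (map_star Φ)
  let G := K0Unital.map (Ψ : Unitization ℂ B →+* Unitization ℂ A) (map_star Ψ)
  have hF : ∀ x ∈ K0 A, F x ∈ K0 B := fun x hx => by
    refine (AddMonoidHom.mem_ker).2 (Eq.trans ?_ (AddMonoidHom.mem_ker.1 hx))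
    exact K0Unital.map_map _ _ _ _ _ _ hΦ x
  have hG : ∀ x ∈ K0 B, G x ∈ K0 A := fun x hx => by
    refine (AddMonoidHom.mem_ker).2 (Eq.trans ?_ (AddMonoidHom.mem_ker.1 hx))
    exact K0Unital.map_map _ _ _ _ _ _ hΨ x
  exact ⟨
    { toFun := fun x => ⟨F x, hF x x.2⟩
      invFun := fun x => ⟨G x, hG x x.2⟩
      left_inv := fun x => Subtype.ext ((K0Unital.map_map _ _ _ _ (RingHom.id _) (fun _ => rfl)
        hΨΦ x.1).trans (K0Unital.map_id _))
      right_inv := fun x => Subtype.ext ((K0Unital.map_map _ _ _ _ (RingHom.id _) (fun _ => rfl)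
        hΦΨ x.1).trans (K0Unital.map_id _))
      map_add' := fun x y => Subtype.ext (map_add F _ _) }⟩

end Classes

end TwistedCStar
end

noncomputable section

namespace TwistedCStar

/-! ### Projections with given scalar part -/

section ScalarPart

/-- The element `s` is `a^(-1/2)`: the spectrum of `a` lies within distance less than `1` of the
point `1`, hence in the positive reals. As a function of `a`, it commutes with everything that
commutes with `a`. -/
theorem exists_mul_mul_eq_one {C : Type*} [CStarAlgebra C] {a : C} (ha : IsSelfAdjoint a)
    (h : ‖a - 1‖ < 1) :
    ∃ s, star s = s ∧ s * a * s = 1 ∧ ∀ b, Commute a b → Commute s b := by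
  rcases subsingleton_or_nontrivial C with hC | hC
  · exact ⟨1, star_one C, Subsingleton.elim _ _, fun b _ => Subsingleton.elim _ _⟩
  have hpos : ∀ x ∈ spectrum ℝ a, 0 < x := by
    intro x hx
    have h1 : x - 1 ∈ spectrum ℝ (a - 1) := by
      have := spectrum.sub_singleton_eq a (1 : ℝ)
      rw [map_one] at this
      rw [← this]
      exact Set.sub_mem_sub hx rfl
    have h2 := (spectrum.norm_le_norm_of_mem h1).trans_lt h
    rw [Real.norm_eq_abs, abs_lt] at h2
    linarith
  have hc : ContinuousOn (fun x : ℝ => (√x)⁻¹) (spectrum ℝ a) :=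
    Real.continuous_sqrt.continuousOn.inv₀ fun x hx => (Real.sqrt_pos.2 (hpos x hx)).ne'
  refine ⟨cfc (fun x : ℝ => (√x)⁻¹) a, cfc_predicate (p := IsSelfAdjoint) _ a, ?_, fun b hb =>
    hb.cfc_real _⟩
  conv_lhs =>
    enter [1, 2]
    rw [← cfc_id' ℝ a]
  rw [← cfc_mul (fun x : ℝ => (√x)⁻¹) (fun x : ℝ => x) a,
    ← cfc_mul (fun x : ℝ => (√x)⁻¹ * x) (fun x : ℝ => (√x)⁻¹) a (hc.mul continuousOn_id) hc,
    ← cfc_one ℝ a]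
  refine cfc_congr fun x hx => ?_
  have h1 := hpos x hx
  have h2 := (Real.sqrt_pos.2 h1).ne'
  change (√x)⁻¹ * x * (√x)⁻¹ = 1
  nth_rewrite 2 [← Real.mul_self_sqrt h1.le]
  field_simp

theorem norm_le_one_of_projection {C : Type*} [CStarAlgebra C] {e : C} (h : star e = e)
    (h' : e * e = e) : ‖e‖ ≤ 1 := by
  have h1 : ‖e‖ * ‖e‖ = ‖e‖ := by
    rw [← CStarRing.norm_star_mul_self, h, h']
  nlinarith [norm_nonneg e]

/-- A matrix over a `C^*`-algebra with small entries has small norm. -/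
theorem exists_norm_lt_of_entries {n : Type*} [Fintype n] (R : Type*) [CStarAlgebra R]
    [PartialOrder R] [StarOrderedRing R] {ε : ℝ} (hε : 0 < ε) :
    ∃ δ > 0, ∀ M : CStarMatrix n n R, (∀ i j, ‖M i j‖ < δ) → ‖M‖ < ε := by
  -- For a fixed finite size, the `C^*`-norm of a matrix is continuous in the topology of its
  -- entries.
  have h1 : Continuous fun M : n → n → R => ‖(show CStarMatrix n n R from M)‖ :=
    continuous_norm.comp (CStarMatrix.ofMatrixL (A := R) (m := n) (n := n)).continuous
  have h2 : Filter.Tendsto (fun M : n → n → R => ‖(show CStarMatrix n n R from M)‖) (nhds 0)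
      (nhds 0) := by
    have := h1.tendsto 0
    rwa [show ‖(show CStarMatrix n n R from (0 : n → n → R))‖ = 0 from
      norm_zero (E := CStarMatrix n n R)] at this
  obtain ⟨δ, hδ, h3⟩ := Metric.eventually_nhds_iff.1 (h2.eventually_lt_const hε)
  refine ⟨δ, hδ, fun M hM => h3 (y := M) ?_⟩
  refine (dist_pi_lt_iff hδ).2 fun i => (dist_pi_lt_iff hδ).2 fun j => ?_
  rw [dist_eq_norm]
  refine lt_of_eq_of_lt (congrArg _ (sub_zero _)) (hM i j)

/-- Compression by a projection does not increase the norm, so the same `δ` serves for every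
projection `e`. This matters because the projection is constructed only after `δ` is fixed. -/
theorem exists_matrix_mul_mul_eq_one (n : Type*) [Fintype n] [DecidableEq n] (R : Type*)
    [CStarAlgebra R] : ∃ δ > 0, ∀ e x : Matrix n n R, e.conjTranspose = e → e * e = e →
      (e * x * e).conjTranspose = e * x * e → (∀ i j, ‖x i j‖ < δ) →
      ∃ s : Matrix n n R, s.conjTranspose = s ∧ s * (1 + e * x * e) * s = 1 ∧
        ∀ b, Commute (1 + e * x * e) b → Commute s b := by
  let _ : PartialOrder R := CStarAlgebra.spectralOrder R
  let _ : StarOrderedRing R := CStarAlgebra.spectralOrderedRing R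
  obtain ⟨δ, hδ, h1⟩ := exists_norm_lt_of_entries (n := n) R one_pos
  refine ⟨δ, hδ, fun e x he he' hx hxδ => ?_⟩
  let e₁ : CStarMatrix n n R := e
  let x₁ : CStarMatrix n n R := x
  have h2 : ‖e₁‖ ≤ 1 := norm_le_one_of_projection he he'
  have h3 : ‖x₁‖ < 1 := h1 x₁ hxδ
  have h4 : ‖1 + e₁ * x₁ * e₁ - 1‖ < 1 := by
    rw [add_sub_cancel_left]
    refine lt_of_le_of_lt ?_ h3
    refine (norm_mul_le _ _).trans ((mul_le_of_le_one_right (norm_nonneg _) h2).trans ?_)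
    exact (norm_mul_le _ _).trans (mul_le_of_le_one_left (norm_nonneg _) h2)
  have h5 : IsSelfAdjoint (1 + e₁ * x₁ * e₁) :=
    (IsSelfAdjoint.one _).add (show star (e₁ * x₁ * e₁) = _ from hx)
  exact exists_mul_mul_eq_one h5 h4

variable {A : Type*} [NonUnitalCStarAlgebra A]

open ProjMonoid

variable (A) in
/-- The inclusion of the scalars in a unitization. -/
def scalarIncl : ℂ →⋆ₐ[ℂ] Unitization ℂ A := StarAlgHom.ofId ℂ _

theorem scalarPart_scalarIncl (z : ℂ) : scalarPart A (scalarIncl A z) = z :=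
  (scalarPart A).toAlgHom.commutes z

/-- The scalar part of a projection. -/
def scalarProj (p : MatProj (Unitization ℂ A)) : MatProj (Unitization ℂ A) :=
  (p.map (scalarPart A : Unitization ℂ A →+* ℂ) (map_star (scalarPart A))).map
    (scalarIncl A : ℂ →+* Unitization ℂ A) (map_star (scalarIncl A))

/-- Up to projections over the algebra itself, the class of a projection is that of its scalar
part. -/
theorem exists_cls_add_eq (hA : ∀ (n : ℕ) (x : Fin n → Fin n → A) (ε : ℝ), 0 < ε →
      ∃ g : A, star g = g ∧ g * g = g ∧ ∀ i j, ‖x i j - g * x i j‖ < ε)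
    (p : MatProj (Unitization ℂ A)) :
    ∃ a b : MatProj (Unitization ℂ A), a.p.map (scalarPart A) = 0 ∧ b.p.map (scalarPart A) = 0 ∧
      cls p + cls a = cls (scalarProj p) + cls b := by
  obtain ⟨n, P, hP, hP'⟩ := p
  let E : Matrix (Fin n) (Fin n) (Unitization ℂ A) := (P.map (scalarPart A)).map (scalarIncl A)
  have hE : E.conjTranspose = E := (scalarProj (A := A) ⟨n, P, hP, hP'⟩).star_eq
  have hE' : E * E = E := (scalarProj (A := A) ⟨n, P, hP, hP'⟩).idem
  have hEs : E.map (scalarPart A) = P.map (scalarPart A) := by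
    ext i j
    exact scalarPart_scalarIncl (A := A) _
  have hPE : ∀ i j, (P - E) i j = ((P - E) i j).snd := fun i j => by
    refine eq_inr_of_scalarPart_eq_zero ?_
    rw [Matrix.sub_apply, map_sub, sub_eq_zero]
    exact (congrFun (congrFun hEs i) j).symm
  obtain ⟨δ, hδ, hδ'⟩ := exists_matrix_mul_mul_eq_one (Fin n) (Unitization ℂ A)
  -- The entries of `P - E` lie in `A`, since `E` is the scalar part of `P`. The projection `g`
  -- absorbs these entries up to `δ`, so that `P` and `E` almost agree after multiplication by `1 -
  -- g`.
  obtain ⟨g, hg, hg', hgx⟩ := hA n (fun i j => ((P - E) i j).snd) δ hδ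
  let G : Matrix (Fin n) (Fin n) (Unitization ℂ A) := Matrix.diagonal fun _ => (g : Unitization ℂ A)
  have hG : G.conjTranspose = G := by
    rw [Matrix.diagonal_conjTranspose]
    congr 1
    funext i
    change star (g : Unitization ℂ A) = g
    rw [← Unitization.inr_star, hg]
  have hG' : G * G = G := by
    rw [Matrix.diagonal_mul_diagonal, ← Unitization.inr_mul, hg']
  have hGE : G * E = E * G := by
    ext1 i j
    rw [Matrix.diagonal_mul, Matrix.mul_diagonal]
    exact (Algebra.commutes (R := ℂ) _ (g : Unitization ℂ A)).symm
  have hGs : G.map (scalarPart A) = 0 := by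
    rw [Matrix.diagonal_map (map_zero _)]
    exact Matrix.diagonal_zero
  have hsmall : ∀ i j, ‖((1 - G) * (P - E)) i j‖ < δ := fun i j => by
    have h1 : ((1 - G) * (P - E)) i j =
        (((P - E) i j).snd - g * ((P - E) i j).snd : A) := by
      rw [sub_mul, one_mul, Matrix.sub_apply, Matrix.diagonal_mul, Unitization.inr_sub,
        Unitization.inr_mul, ← hPE]
    have h2 := hgx i j
    rw [← Unitization.norm_inr (𝕜 := ℂ), ← h1] at h2
    exact h2
  -- The scalar matrix `E` commutes with `G`, so `E' = E(1 - G)` is a projection below `E`, and the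
  -- difference `E G` has entries in `A`.
  obtain ⟨E', hE'def⟩ : ∃ E', E' = E * (1 - G) := ⟨_, rfl⟩
  have e1 : E'.conjTranspose = E' := by
    rw [hE'def, Matrix.conjTranspose_mul, Matrix.conjTranspose_sub, Matrix.conjTranspose_one, hG, hE,
      sub_mul, mul_sub, hGE, one_mul, mul_one]
  have e2 : E' * (1 - G) = E' := by
    rw [hE'def, mul_assoc, mul_sub (1 - G), mul_one, sub_mul 1 G G, one_mul, hG', sub_self, sub_zero]
  have e3 : E' * E = E' := by
    rw [hE'def, mul_assoc, sub_mul, one_mul, hGE, mul_sub, ← mul_assoc E E, hE', mul_sub, mul_one]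
  have e4 : E' * E' = E' := by
    nth_rewrite 2 [hE'def]
    rw [← mul_assoc, e3, e2]
  have hx : E' * ((1 - G) * (P - E)) * E' = E' * P * E' - E' := by
    rw [← mul_assoc, e2, mul_sub, e3, sub_mul, e4]
  obtain ⟨s, hs, hs1, hsc⟩ := hδ' E' ((1 - G) * (P - E)) e1 e4 (by
    rw [hx, Matrix.conjTranspose_sub, Matrix.conjTranspose_mul, Matrix.conjTranspose_mul, e1, hP,
      mul_assoc]) hsmall
  rw [hx] at hs1 hsc
  have haE : (1 + (E' * P * E' - E')) * E' = E' * P * E' := by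
    rw [add_mul, sub_mul, one_mul, mul_assoc (E' * P), e4, add_sub_cancel]
  have hEa : E' * (1 + (E' * P * E' - E')) = E' * P * E' := by
    rw [mul_add, mul_sub, mul_one, ← mul_assoc, ← mul_assoc, e4, add_sub_cancel]
  have hsE : s * E' = E' * s := hsc E' (haE.trans hEa.symm)
  -- On the corner of `E'` the compression `E' P E'` is close to `E'`, and `s` is the inverse square
  -- root correcting the difference. So `v` is a partial isometry from `E'` onto a subprojection `q`
  -- of `P`.
  obtain ⟨v, hv⟩ : ∃ v, v = P * E' * s := ⟨_, rfl⟩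
  have hv1 : v.conjTranspose * v = E' := by
    calc v.conjTranspose * v = s * (E' * (P * P) * E') * s := by
          rw [hv, Matrix.conjTranspose_mul, Matrix.conjTranspose_mul, hP, e1, hs]
          simp only [mul_assoc]
      _ = s * (1 + (E' * P * E' - E')) * (E' * s) := by
          rw [hP', ← haE, ← mul_assoc s, mul_assoc _ E' s, haE]
      _ = E' := by rw [← hsE, ← mul_assoc, hs1, one_mul]
  have hvE : v * E' = v := by
    rw [hv, mul_assoc, hsE, ← mul_assoc, mul_assoc P, e4]
  obtain ⟨q, hq⟩ : ∃ q, q = v * v.conjTranspose := ⟨_, rfl⟩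
  have hqs : q.conjTranspose = q := by
    rw [hq, Matrix.conjTranspose_mul, Matrix.conjTranspose_conjTranspose]
  have hqi : q * q = q := by
    rw [hq, mul_assoc, ← mul_assoc v.conjTranspose, hv1, ← mul_assoc, hvE]
  have hPv : P * v = v := by
    rw [hv, ← mul_assoc, ← mul_assoc, hP']
  have hPq : P * q = q := by
    rw [hq, ← mul_assoc, hPv]
  have hqP : q * P = q := by
    rw [← hP, ← hqs, ← Matrix.conjTranspose_mul, hPq]
  have hd : (P - q).conjTranspose = P - q := by rw [Matrix.conjTranspose_sub, hP, hqs]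
  have hd' : (P - q) * (P - q) = P - q := by
    rw [sub_mul, mul_sub, mul_sub, hP', hPq, hqP, hqi, sub_self, sub_zero]
  have hEG : (E * G).conjTranspose = E * G := by rw [Matrix.conjTranspose_mul, hG, hE, hGE]
  have hEG' : E * G * (E * G) = E * G := by
    rw [mul_assoc, ← mul_assoc G, hGE, mul_assoc E G, hG', ← mul_assoc, hE']
  have hEE : E * G + E' = E := by rw [hE'def, mul_sub, mul_one, add_sub_cancel]
  have hEGE : E * G * E' = 0 := by
    rw [hE'def, mul_assoc, ← mul_assoc G, hGE, mul_assoc E G, mul_sub, mul_one, hG', sub_self,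
      mul_zero, mul_zero]
  have hqPq : q * (P - q) = 0 := by rw [mul_sub, hqP, hqi, sub_self]
  have c1 : cls ⟨n, q, hqs, hqi⟩ = cls ⟨n, E', e1, e4⟩ :=
    (cls_eq_cls.2 ⟨v, hv1, hq.symm⟩).symm
  have c2 := cls_orthogonal_add hqs hqi hd hd' hP hP' (add_sub_cancel q P) hqPq
  have c3 := cls_orthogonal_add hEG hEG' e1 e4 hE hE' hEE hEGE
  -- From `P = q + (P - q)`, `E = E G + E'` and `q ∼ E'`, the two error terms are `E G` and `P - q`.
  refine ⟨⟨n, E * G, hEG, hEG'⟩, ⟨n, P - q, hd, hd'⟩, ?_, ?_, ?_⟩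
  · change (E * G).map (scalarPart A) = 0
    rw [mul_map_starHom, hGs, mul_zero]
  · change (P - q).map (scalarPart A) = 0
    have s1 : E'.map (scalarPart A) = P.map (scalarPart A) := by
      rw [hE'def, mul_map_starHom, sub_map_starHom, hGs, one_map_starHom, sub_zero, mul_one, hEs]
    have s2 : P.map (scalarPart A) * P.map (scalarPart A) = P.map (scalarPart A) := by
      rw [← mul_map_starHom, hP']
    -- The scalar part of `E' P E' - E'` vanishes because `E'` and `P` have the same scalar part, a
    -- projection. So the scalar part of `s` squares to `1`, and `q` has the scalar part of `P`.
    have s3 : s.map (scalarPart A) * s.map (scalarPart A) = 1 := by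
      have := congrArg (fun M => M.map (scalarPart A)) hs1
      rw [mul_map_starHom, mul_map_starHom, add_comm, sub_add, sub_map_starHom, sub_map_starHom,
        mul_map_starHom, mul_map_starHom, s1, s2, s2, one_map_starHom, sub_sub_cancel,
        mul_one] at this
      exact this
    have s4 : v.map (scalarPart A) = P.map (scalarPart A) * s.map (scalarPart A) := by
      rw [hv, mul_map_starHom, mul_map_starHom, s1, s2]
    have s5 : (P.map (scalarPart A)).conjTranspose = P.map (scalarPart A) := by
      rw [conjTranspose_map_starHom, hP]
    have s6 : (s.map (scalarPart A)).conjTranspose = s.map (scalarPart A) := by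
      rw [conjTranspose_map_starHom, hs]
    rw [sub_map_starHom, hq, mul_map_starHom, ← conjTranspose_map_starHom, s4,
      Matrix.conjTranspose_mul, s5, s6, mul_assoc, ← mul_assoc (s.map _), s3, one_mul, s2, sub_self]
  · change cls ⟨n, P, hP, hP'⟩ + cls ⟨n, E * G, hEG, hEG'⟩ = cls ⟨n, E, hE, hE'⟩ + _
    rw [← c2, ← c3, c1]
    abel

end ScalarPart

end TwistedCStar
end

noncomputable section

namespace TwistedCStar

/-! ### `K_0` of a finite direct sum of algebras of compact operators -/

section K0Compact

open ProjMonoid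

variable {ι : Type*} {H : ι → Type*} [∀ i, NormedAddCommGroup (H i)]
  [∀ i, InnerProductSpace ℂ (H i)] [∀ i, CompleteSpace (H i)]

/-- This supplies approximate units of projections for `exists_cls_add_eq`. The index set is finite,
so finite-rank projections chosen in each summand form an element of the direct sum. -/
theorem exists_projection_norm_sub_lt [Finite ι] (n : ℕ)
    (x : Fin n → Fin n → C0Sum fun i => CompactOps (H i)) (ε : ℝ) (hε : 0 < ε) :
    ∃ g : C0Sum fun i => CompactOps (H i), star g = g ∧ g * g = g ∧
      ∀ j k, ‖x j k - g * x j k‖ < ε := by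
  have h1 : ∀ i j k, ∃ U : Submodule ℂ (H i), ∃ _ : FiniteDimensional ℂ U,
      ‖(C0Sum.proj i (x j k)).toCLM - U.starProjection * (C0Sum.proj i (x j k)).toCLM‖ ≤ ε / 2 :=
    fun i j k => exists_finiteDimensional_norm_sub_le (CompactOps.isCompactOperator _) (half_pos hε)
  choose U hU hUx using h1
  -- One finite-dimensional space containing the approximating spaces of all matrix entries;
  -- enlarging the space only improves the approximation.
  let W : ∀ i, Submodule ℂ (H i) := fun i => ⨆ p : Fin n × Fin n, U i p.1 p.2
  have hW : ∀ i, FiniteDimensional ℂ (W i) := fun i => by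
    have : ∀ p : Fin n × Fin n, FiniteDimensional ℂ (U i p.1 p.2) := fun p => hU i p.1 p.2
    exact Submodule.finiteDimensional_iSup _
  have hc : ∀ i, IsCompactOperator (W i).starProjection := fun i => by
    have : ProperSpace (W i) := FiniteDimensional.proper ℂ (W i)
    have : IsCompactOperator (W i).orthogonalProjectionOnto :=
      isCompactOperator_of_locallyCompactSpace_dom _
    exact this.clm_comp (W i).subtypeL
  let g : C0Sum fun i => CompactOps (H i) :=
    C0Sum.mk (fun i => CompactOps.mk _ (hc i)) (Set.finite_range _).bddAbove
      (by rw [Filter.cofinite_eq_bot]; exact Filter.tendsto_bot)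
  refine ⟨g, C0Sum.ext fun i => CompactOps.ext ?_, C0Sum.ext fun i => CompactOps.ext ?_,
    fun j k => ?_⟩
  · exact isSelfAdjoint_starProjection (W i)
  · exact (W i).isIdempotentElem_starProjection
  · refine (C0Sum.norm_le (half_pos hε).le fun i => ?_).trans_lt (half_lt_self hε)
    refine le_trans ?_ (hUx i j k)
    refine ContinuousLinearMap.opNorm_le_bound _ (norm_nonneg _) fun v => ?_
    refine le_trans ?_ (ContinuousLinearMap.le_opNorm _ v)
    let y := (C0Sum.proj i (x j k)).toCLM v
    change ‖y - (W i).starProjection y‖ ≤ ‖y - (U i j k).starProjection y‖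
    rw [(W i).starProjection_minimal y]
    have hmem : (U i j k).starProjection y ∈ W i :=
      (le_iSup (fun p : Fin n × Fin n => U i p.1 p.2) (j, k))
        ((U i j k).starProjection_apply_mem y)
    refine ciInf_le ⟨0, ?_⟩ (⟨_, hmem⟩ : W i)
    rintro _ ⟨w, rfl⟩
    exact norm_nonneg _

/-- The projection to a summand as a `*`-homomorphism. -/
def C0Sum.projStarHom {A : ι → Type*} [∀ i, NonUnitalCStarAlgebra (A i)] (i : ι) :
    C0Sum A →⋆ₙₐ[ℂ] A i where
  toFun := C0Sum.proj i
  map_smul' _ _ := rfl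
  map_zero' := rfl
  map_add' _ _ := rfl
  map_mul' _ _ := rfl
  map_star' _ := rfl

variable [DecidableEq ι]

/-- The rank one operator `v ↦ ⟪w, v⟫ u` on `H i` in the unitized direct sum. -/
def rankOneSingle (i : ι) (u w : H i) : Unitization ℂ (C0Sum fun i => CompactOps (H i)) :=
  (C0Sum.single i (CompactOps.rankOne u w) : C0Sum fun i => CompactOps (H i))

theorem star_rankOneSingle (i : ι) (u w : H i) :
    star (rankOneSingle i u w) = rankOneSingle i w u := by
  rw [rankOneSingle, ← Unitization.inr_star, rankOneSingle]
  congr 1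
  refine C0Sum.ext fun j => ?_
  rw [C0Sum.proj_star]
  by_cases h : j = i
  · subst h
    rw [C0Sum.proj_single_same, C0Sum.proj_single_same, CompactOps.star_rankOne]
  · rw [C0Sum.proj_single_of_ne h, C0Sum.proj_single_of_ne h, star_zero]

theorem rankOneSingle_mul_same (i : ι) (u w u' w' : H i) :
    rankOneSingle i u w * rankOneSingle i u' w' = ⟪w, u'⟫_ℂ • rankOneSingle i u w' := by
  rw [rankOneSingle, rankOneSingle, rankOneSingle, ← Unitization.inr_mul, ← Unitization.inr_smul]
  congr 1
  refine C0Sum.ext fun j => ?_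
  rw [C0Sum.proj_mul, C0Sum.proj_smul]
  by_cases h : j = i
  · subst h
    rw [C0Sum.proj_single_same, C0Sum.proj_single_same, C0Sum.proj_single_same,
      CompactOps.rankOne_mul_rankOne]
  · rw [C0Sum.proj_single_of_ne h, C0Sum.proj_single_of_ne h, C0Sum.proj_single_of_ne h, mul_zero,
      smul_zero]

theorem rankOneSingle_mul_of_ne {i i' : ι} (h : i ≠ i') (u w : H i) (u' w' : H i') :
    rankOneSingle i u w * rankOneSingle i' u' w' = 0 := by
  rw [rankOneSingle, rankOneSingle, ← Unitization.inr_mul, ← Unitization.inr_zero ℂ]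
  congr 1
  refine C0Sum.ext fun j => ?_
  rw [C0Sum.proj_mul]
  by_cases h' : j = i
  · subst h'
    rw [C0Sum.proj_single_of_ne h, mul_zero, C0Sum.proj_zero]
  · rw [C0Sum.proj_single_of_ne h', zero_mul, C0Sum.proj_zero]

/-- The `1 × 1` matrix given by a rank one operator in a summand. -/
def rankOneMat (i : ι) (f : H i) :
    Matrix (Fin 1) (Fin 1) (Unitization ℂ (C0Sum fun i => CompactOps (H i))) :=
  Matrix.of fun _ _ => rankOneSingle i f f

/-- The projection given by a rank one projection in a summand. -/
def rankOneProj (i : ι) (f : H i) (hf : ‖f‖ = 1) :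
    MatProj (Unitization ℂ (C0Sum fun i => CompactOps (H i))) where
  n := 1
  p := rankOneMat i f
  star_eq := by
    ext1 j k
    exact star_rankOneSingle i f f
  idem := by
    ext1 j k
    rw [Matrix.mul_apply, Fin.sum_univ_one]
    refine (rankOneSingle_mul_same i f f f f).trans ?_
    rw [inner_self_eq_norm_sq_to_K, hf]
    simp [rankOneMat]

/-- The column of rank one operators given by a vector in a power of `H i`. -/
def rankOneCol {n : ℕ} (i : ι) (f : H i) (ξ : PiLp 2 fun _ : Fin n => H i) :
    Matrix (Fin n) (Fin 1) (Unitization ℂ (C0Sum fun i => CompactOps (H i))) :=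
  Matrix.of fun j _ => rankOneSingle i (ξ j) f

theorem rankOneCol_conjTranspose_mul {n : ℕ} (i : ι) (f : H i)
    (ξ η : PiLp 2 fun _ : Fin n => H i) :
    (rankOneCol i f ξ).conjTranspose * rankOneCol i f η =
      ⟪ξ, η⟫_ℂ • rankOneMat i f := by
  ext1 a b
  rw [Matrix.mul_apply, PiLp.inner_apply]
  refine Eq.trans ?_ (Finset.sum_smul (f := fun j => ⟪ξ j, η j⟫_ℂ) (s := Finset.univ)
    (x := rankOneSingle i f f)).symm
  refine Finset.sum_congr rfl fun j _ => ?_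
  change star (rankOneSingle i (ξ j) f) * rankOneSingle i (η j) f = _
  rw [star_rankOneSingle, rankOneSingle_mul_same]

theorem rankOneCol_conjTranspose_mul_of_ne {n : ℕ} {i i' : ι} (h : i ≠ i') (f : H i) (f' : H i')
    (ξ : PiLp 2 fun _ : Fin n => H i) (η : PiLp 2 fun _ : Fin n => H i') :
    (rankOneCol i f ξ).conjTranspose * rankOneCol i' f' η = 0 := by
  ext1 a b
  rw [Matrix.mul_apply]
  refine Finset.sum_eq_zero fun j _ => ?_
  change star (rankOneSingle i (ξ j) f) * rankOneSingle i' (η j) f' = _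
  rw [star_rankOneSingle, rankOneSingle_mul_of_ne h]

theorem rankOneCol_mul_proj {n : ℕ} (i : ι) {f : H i} (hf : ‖f‖ = 1)
    (ξ : PiLp 2 fun _ : Fin n => H i) :
    rankOneCol i f ξ * rankOneMat i f = rankOneCol i f ξ := by
  ext1 a b
  rw [Matrix.mul_apply, Fin.sum_univ_one]
  refine (rankOneSingle_mul_same i (ξ a) f f f).trans ?_
  rw [inner_self_eq_norm_sq_to_K, hf]
  simp [rankOneCol]

theorem rankOneCol_mul_conjTranspose_apply {n : ℕ} (i : ι) {f : H i} (hf : ‖f‖ = 1)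
    (ξ : PiLp 2 fun _ : Fin n => H i) (j k : Fin n) :
    (rankOneCol i f ξ * (rankOneCol i f ξ).conjTranspose) j k =
      rankOneSingle i (ξ j) (ξ k) := by
  rw [Matrix.mul_apply, Fin.sum_univ_one]
  change rankOneSingle i (ξ j) f * star (rankOneSingle i (ξ k) f) = _
  rw [star_rankOneSingle, rankOneSingle_mul_same, inner_self_eq_norm_sq_to_K, hf]
  simp

/-- The class of a finite orthogonal sum of projections. -/
theorem cls_sum_mem {R : Type*} [Ring R] [StarRing R] {α : Type*} [DecidableEq α] {n : ℕ}
    (S : AddSubmonoid (ProjMonoid R)) {P : α → Matrix (Fin n) (Fin n) R}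
    (h1 : ∀ a, (P a).conjTranspose = P a) (h2 : ∀ a, P a * P a = P a)
    (h3 : ∀ a b, a ≠ b → P a * P b = 0) (h4 : ∀ a, cls ⟨n, P a, h1 a, h2 a⟩ ∈ S) (s : Finset α) :
    ∃ (h5 : (∑ a ∈ s, P a).conjTranspose = ∑ a ∈ s, P a)
      (h6 : (∑ a ∈ s, P a) * (∑ a ∈ s, P a) = ∑ a ∈ s, P a),
        cls ⟨n, ∑ a ∈ s, P a, h5, h6⟩ ∈ S := by
  induction s using Finset.induction_on with
  | empty =>
    refine ⟨Matrix.conjTranspose_zero, mul_zero _, ?_⟩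
    refine (cls_eq_zero (p := ⟨n, _, _, _⟩)).2 (Finset.sum_empty (f := P)) ▸ S.zero_mem
  | insert a s ha ih =>
    obtain ⟨h5, h6, h7⟩ := ih
    have h8 : P a * ∑ b ∈ s, P b = 0 := by
      rw [Finset.mul_sum]
      exact Finset.sum_eq_zero fun b hb => h3 a b (by rintro rfl; exact ha hb)
    have h9 : (∑ b ∈ s, P b) * P a = 0 := by
      rw [Finset.sum_mul]
      exact Finset.sum_eq_zero fun b hb => h3 b a (by rintro rfl; exact ha hb)
    have h10 : (∑ b ∈ insert a s, P b).conjTranspose = ∑ b ∈ insert a s, P b := by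
      rw [Finset.sum_insert ha, Matrix.conjTranspose_add, h1, h5]
    have h11 : (∑ b ∈ insert a s, P b) * (∑ b ∈ insert a s, P b) = ∑ b ∈ insert a s, P b := by
      rw [Finset.sum_insert ha, add_mul, mul_add, mul_add, h2, h6, h8, h9, add_zero, zero_add]
    refine ⟨h10, h11, ?_⟩
    rw [← cls_orthogonal_add (h1 a) (h2 a) h5 h6 h10 h11 (Finset.sum_insert ha).symm h8]
    exact S.add_mem (h4 a) h7

/-- The action of the unitized direct sum on `H i`. -/
def componentCLM (H : ι → Type*) [∀ i, NormedAddCommGroup (H i)] [∀ i, InnerProductSpace ℂ (H i)]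
    [∀ i, CompleteSpace (H i)] (i : ι) :
    Unitization ℂ (C0Sum fun i => CompactOps (H i)) →⋆ₐ[ℂ] (H i →L[ℂ] H i) :=
  (unitizedToCLM (H i)).comp (Unitization.starMap (C0Sum.projStarHom i))

theorem componentCLM_inr (i : ι) (x : C0Sum fun i => CompactOps (H i)) :
    componentCLM H i x = (C0Sum.proj i x).toCLM := by
  refine (congrArg (unitizedToCLM (H i)) (Unitization.starMap_inr _ _)).trans ?_
  exact unitizedToCLM_inr _

theorem rankOneSingle_eq_inr (i : ι) (u w : H i) : rankOneSingle i u w =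
    (C0Sum.single i (CompactOps.rankOne u w) : C0Sum fun i => CompactOps (H i)) := rfl

theorem componentCLM_rankOneSingle_same (i : ι) (u w : H i) :
    componentCLM H i (rankOneSingle i u w) = InnerProductSpace.rankOne ℂ u w := by
  rw [rankOneSingle_eq_inr, componentCLM_inr, C0Sum.proj_single_same]
  rfl

theorem componentCLM_rankOneSingle_of_ne {i j : ι} (h : j ≠ i) (u w : H i) :
    componentCLM H j (rankOneSingle i u w) = 0 := by
  rw [rankOneSingle_eq_inr, componentCLM_inr, C0Sum.proj_single_of_ne h]
  rfl

theorem scalarPart_rankOneSingle (i : ι) (u w : H i) :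
    scalarPart _ (rankOneSingle i u w) = 0 := rfl

/-- Elements with zero scalar part lie in the direct sum itself, which acts faithfully on the family
`H`. -/
theorem eq_of_componentCLM {x y : Unitization ℂ (C0Sum fun i => CompactOps (H i))}
    (hx : scalarPart _ x = 0) (hy : scalarPart _ y = 0)
    (h : ∀ i, componentCLM H i x = componentCLM H i y) : x = y := by
  rw [eq_inr_of_scalarPart_eq_zero hx, eq_inr_of_scalarPart_eq_zero hy] at h ⊢
  congr 1
  refine C0Sum.ext fun i => CompactOps.ext ?_
  rw [← componentCLM_inr, ← componentCLM_inr]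
  exact h i

/-- A projection over a finite direct sum of algebras of compact operators is an orthogonal sum of
rank one projections. -/
theorem cls_mem_closure [Fintype ι] (f : ∀ i, H i) (hf : ∀ i, ‖f i‖ = 1)
    (p : MatProj (Unitization ℂ (C0Sum fun i => CompactOps (H i))))
    (hp : p.p.map (scalarPart _) = 0) :
    cls p ∈ AddSubmonoid.closure (Set.range fun i => cls (rankOneProj i (f i) (hf i))) := by
  obtain ⟨n, p, hs, hi⟩ := p
  have hp0 : ∀ j k, scalarPart _ (p j k) = 0 := fun j k => congrFun (congrFun hp j) k
  -- Because its entries lie in the direct sum, `p` acts on each `H i ^ n` as a compact projection,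
  -- hence as a finite sum of rank one projections.
  have hQ : ∀ i, ∃ (r : ℕ) (ξ : Fin r → PiLp 2 fun _ : Fin n => H i), Orthonormal ℂ ξ ∧
      opMat (p.map (componentCLM H i)) =
        ∑ k, InnerProductSpace.rankOne ℂ (ξ k) (ξ k) := fun i => by
    refine exists_eq_sum_rankOne (isCompactOperator_opMat fun j k => ?_) ?_ ?_
    · rw [Matrix.map_apply, eq_inr_of_scalarPart_eq_zero (hp0 j k), componentCLM_inr]
      exact CompactOps.isCompactOperator _
    · rw [← opMat_conjTranspose, conjTranspose_map_starHom, hs]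
    · rw [← opMat_mul, ← mul_map_starHom, hi]
  choose r ξ hξ hξQ using hQ
  -- Each rank one piece factors as a column times its adjoint. The opposite product is the `1 × 1`
  -- projection onto `f i`, so all pieces in the summand `i` have the class of `rankOneProj`.
  let P : (Σ i, Fin (r i)) → Matrix (Fin n) (Fin n) (Unitization ℂ (C0Sum fun i =>
      CompactOps (H i))) := fun a =>
    rankOneCol a.1 (f a.1) (ξ a.1 a.2) * (rankOneCol a.1 (f a.1) (ξ a.1 a.2)).conjTranspose
  have hcol : ∀ a : Σ i, Fin (r i), (rankOneCol a.1 (f a.1) (ξ a.1 a.2)).conjTranspose *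
      rankOneCol a.1 (f a.1) (ξ a.1 a.2) = rankOneMat a.1 (f a.1) := fun a => by
    rw [rankOneCol_conjTranspose_mul, inner_self_eq_norm_sq_to_K, (hξ a.1).1 a.2]
    simp
  have h1 : ∀ a, (P a).conjTranspose = P a := fun a => by
    rw [Matrix.conjTranspose_mul, Matrix.conjTranspose_conjTranspose]
  have h2 : ∀ a, P a * P a = P a := fun a => by
    change _ * _ * (_ * _) = _ * _
    rw [Matrix.mul_assoc, ← Matrix.mul_assoc (Matrix.conjTranspose _), hcol, ← Matrix.mul_assoc,
      rankOneCol_mul_proj _ (hf a.1)]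
  have h3 : ∀ a b, a ≠ b → P a * P b = 0 := by
    rintro ⟨i, k⟩ ⟨i', k'⟩ hab
    change _ * _ * (_ * _) = _
    rw [Matrix.mul_assoc, ← Matrix.mul_assoc (Matrix.conjTranspose _)]
    by_cases h : i = i'
    · subst h
      rw [rankOneCol_conjTranspose_mul, (hξ i).2 (by rintro rfl; exact hab rfl), zero_smul,
        Matrix.zero_mul, Matrix.mul_zero]
    · rw [rankOneCol_conjTranspose_mul_of_ne h, Matrix.zero_mul, Matrix.mul_zero]
  have h4 : ∀ a, cls ⟨n, P a, h1 a, h2 a⟩ ∈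
      AddSubmonoid.closure (Set.range fun i => cls (rankOneProj i (f i) (hf i))) := fun a => by
    have : cls (rankOneProj a.1 (f a.1) (hf a.1)) = cls ⟨n, P a, h1 a, h2 a⟩ :=
      cls_eq_cls.2 ⟨rankOneCol a.1 (f a.1) (ξ a.1 a.2), hcol a, rfl⟩
    rw [← this]
    exact AddSubmonoid.subset_closure ⟨a.1, rfl⟩
  obtain ⟨h5, h6, h7⟩ := cls_sum_mem _ h1 h2 h3 h4 Finset.univ
  have hentry : ∀ a j k, P a j k = rankOneSingle a.1 (ξ a.1 a.2 j) (ξ a.1 a.2 k) := fun a j k =>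
    rankOneCol_mul_conjTranspose_apply _ (hf a.1) _ j k
  have hsum : p = ∑ a, P a := by
    ext1 j k
    rw [Matrix.sum_apply]
    simp only [hentry]
    refine eq_of_componentCLM (hp0 j k) ?_ fun i => ?_
    · rw [map_sum]
      exact Finset.sum_eq_zero fun a _ => rfl
    · rw [map_sum, Fintype.sum_sigma, Finset.sum_eq_single_of_mem i (Finset.mem_univ i)]
      · simp only [componentCLM_rankOneSingle_same]
        ext x
        have h8 := opMat_single (p.map (componentCLM H i)) j k x
        rw [hξQ i] at h8
        refine h8.symm.trans ?_
        rw [sum_apply, sum_apply, WithLp.ofLp_sum, Finset.sum_apply]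
        refine Finset.sum_congr rfl fun l _ => ?_
        rw [InnerProductSpace.rankOne_apply, InnerProductSpace.rankOne_apply, PiLp.smul_apply]
        congr 1
        rw [PiLp.inner_apply, Finset.sum_eq_single_of_mem k (Finset.mem_univ k)]
        · simp
        · intro l' _ hl'
          simp [hl']
      · intro i' _ hi'
        exact Finset.sum_eq_zero fun l _ => componentCLM_rankOneSingle_of_ne hi'.symm _ _
  have h9 : (⟨n, p, hs, hi⟩ : MatProj _) = ⟨n, ∑ a, P a, h5, h6⟩ := by congr
  rw [h9]
  exact h7

theorem K0_eq_ker (A : Type*) [NonUnitalCStarAlgebra A] {x : K0Unital (Unitization ℂ A)} :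
    x ∈ K0 A ↔ K0Unital.map (scalarPart A : Unitization ℂ A →+* ℂ) (map_star (scalarPart A)) x = 0 :=
  AddMonoidHom.mem_ker

variable (H) in
/-- The direct sum of the algebras of compact operators of a family of Hilbert spaces. -/
abbrev CompactSum : Type _ := C0Sum fun i => CompactOps (H i)

/-- `K_0` of a finite direct sum of algebras of compact operators. -/
theorem nonempty_K0_C0Sum_compactOps [Fintype ι] [∀ i, Nontrivial (H i)] :
    Nonempty (K0 (C0Sum fun i => CompactOps (H i)) ≃+ (ι →₀ ℤ)) := by
  choose f hf using fun i => exists_norm_eq (H i) zero_le_one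
  let F : (ι →₀ ℤ) →+ K0Unital (Unitization ℂ (CompactSum H)) := Finsupp.liftAddHom fun i =>
    zmultiplesHom _ (Algebra.GrothendieckAddGroup.of (cls (rankOneProj i (f i) (hf i))))
  have hF : ∀ i, F (Finsupp.single i 1) =
      Algebra.GrothendieckAddGroup.of (cls (rankOneProj i (f i) (hf i))) := fun i => by
    rw [Finsupp.liftAddHom_apply_single, zmultiplesHom_apply, one_zsmul]
  let ε := K0Unital.map (scalarPart (CompactSum H) : Unitization ℂ (CompactSum H) →+* ℂ) (map_star (scalarPart (CompactSum H)))
  let j := K0Unital.map (scalarIncl (CompactSum H) : ℂ →+* Unitization ℂ (CompactSum H)) (map_star (scalarIncl (CompactSum H)))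
  have hεof : ∀ p, ε (Algebra.GrothendieckAddGroup.of (cls p)) = Algebra.GrothendieckAddGroup.of
      (cls (p.map (scalarPart (CompactSum H) : Unitization ℂ (CompactSum H) →+* ℂ)
        (map_star (scalarPart (CompactSum H))))) := fun p => K0Unital.map_of _ _ _
  have hεF : ∀ x, ε (F x) = 0 := fun x => by
    have h1 : ε.comp F = 0 := by
      refine Finsupp.addHom_ext' fun i => AddMonoidHom.ext_int ?_
      change ε (F (Finsupp.single i 1)) = 0
      rw [hF, hεof, cls_eq_zero.2, map_zero]
      ext1 a b
      exact scalarPart_rankOneSingle i (f i) (f i)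
    exact DFunLike.congr_fun h1 x
  have hclosure : ∀ p : MatProj (Unitization ℂ (CompactSum H)), p.p.map (scalarPart (CompactSum H)) = 0 →
      Algebra.GrothendieckAddGroup.of (cls p) ∈ F.range := fun p hp => by
    have h1 : AddSubmonoid.closure (Set.range fun i => cls (rankOneProj i (f i) (hf i))) ≤
        F.range.toAddSubmonoid.comap Algebra.GrothendieckAddGroup.of := by
      rw [AddSubmonoid.closure_le]
      rintro _ ⟨c, rfl⟩
      exact ⟨_, hF c⟩
    exact h1 (cls_mem_closure f hf p hp)
  -- After the class of the scalar part is subtracted, a class is a difference of classes of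
  -- projections with zero scalar part, and these lie in the range of `F`.
  have hsurj : ∀ p : MatProj (Unitization ℂ (CompactSum H)), Algebra.GrothendieckAddGroup.of (cls p) -
      j (ε (Algebra.GrothendieckAddGroup.of (cls p))) ∈ F.range := fun p => by
    obtain ⟨a, b, ha, hb, hab⟩ := exists_cls_add_eq exists_projection_norm_sub_lt p
    have h1 : j (ε (Algebra.GrothendieckAddGroup.of (cls p))) =
        Algebra.GrothendieckAddGroup.of (cls (scalarProj p)) := by
      rw [hεof]
      exact K0Unital.map_of _ _ _
    have h2 := congrArg Algebra.GrothendieckAddGroup.of hab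
    rw [map_add, map_add] at h2
    have h3 : Algebra.GrothendieckAddGroup.of (cls p) -
        Algebra.GrothendieckAddGroup.of (cls (scalarProj p)) =
        Algebra.GrothendieckAddGroup.of (cls b) - Algebra.GrothendieckAddGroup.of (cls a) := by
      rw [sub_eq_sub_iff_add_eq_add, h2, add_comm]
    rw [h1, h3]
    exact F.range.sub_mem (hclosure b hb) (hclosure a ha)
  have hinj : ∀ x, F x = 0 → x = 0 := fun x hx => by
    have hsum : ∀ y : ι → ℕ, F (Finsupp.equivFunOnFinite.symm fun i => (y i : ℤ)) =
        Algebra.GrothendieckAddGroup.of (∑ i, y i • cls (rankOneProj i (f i) (hf i))) := fun y => by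
      rw [Finsupp.liftAddHom_apply, Finsupp.sum_fintype _ _ fun _ => map_zero _, map_sum]
      refine Finset.sum_congr rfl fun i _ => ?_
      rw [zmultiplesHom_apply, map_nsmul]
      exact natCast_zsmul _ _
    -- Splitting `x` into positive and negative parts turns `F x = 0` into a stable equality of sums
    -- of rank one projections.
    have hx' : x = (Finsupp.equivFunOnFinite.symm fun i => (((x i).toNat : ℕ) : ℤ)) -
        Finsupp.equivFunOnFinite.symm fun i => (((-x i).toNat : ℕ) : ℤ) := by
      ext i
      exact (Int.toNat_sub_toNat_neg (x i)).symm
    rw [hx', map_sub, sub_eq_zero, hsum, hsum, of_eq_of_iff] at hx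
    obtain ⟨c, hc⟩ := hx
    ext i
    -- Projecting to the summand `i` leaves only the multiples of one nonzero projection, whose
    -- number is determined by stable finiteness of the unitized compact operators.
    let θ : Unitization ℂ (CompactSum H) →⋆ₐ[ℂ] Unitization ℂ (CompactOps (H i)) :=
      Unitization.starMap (C0Sum.projStarHom i)
    have hθ : ∀ k (y : ι → ℕ), k = ∑ l, y l • cls (rankOneProj l (f l) (hf l)) →
        ProjMonoid.map (θ : Unitization ℂ (CompactSum H) →+* Unitization ℂ (CompactOps (H i))) (map_star θ) k =
        y i • cls ((rankOneProj i (f i) (hf i)).map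
          (θ : Unitization ℂ (CompactSum H) →+* Unitization ℂ (CompactOps (H i))) (map_star θ)) := by
      rintro _ y rfl
      rw [map_sum, Finset.sum_eq_single_of_mem i (Finset.mem_univ i), map_nsmul]
      · rfl
      intro l _ hl
      rw [map_nsmul]
      refine (congrArg (y l • ·) (cls_eq_zero.2 ?_)).trans (nsmul_zero _)
      ext1 a b
      refine (Unitization.starMap_inr _ _).trans ?_
      exact (congrArg (fun z : CompactOps (H i) => (z : Unitization ℂ (CompactOps (H i))))
        (C0Sum.proj_single_of_ne (A := fun i => CompactOps (H i)) hl.symm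
          (CompactOps.rankOne (f l) (f l)))).trans
        (Unitization.inr_zero ℂ)
    have h1 := congrArg
      (ProjMonoid.map (θ : Unitization ℂ (CompactSum H) →+* Unitization ℂ (CompactOps (H i))) (map_star θ)) hc
    rw [map_add, map_add, hθ _ _ rfl, hθ _ _ rfl] at h1
    have h2 := eq_of_nsmul_cls_add (fun n Y => mul_conjTranspose_eq_one) (fun h0 => ?_) h1
    · rw [Finsupp.zero_apply]
      omega
    · have h3 := congrArg (unitizedToCLM (H i)) (congrFun (congrFun h0 (0 : Fin 1)) (0 : Fin 1))
      have h4 : InnerProductSpace.rankOne ℂ (f i) (f i) = 0 := by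
        rw [← componentCLM_rankOneSingle_same]
        refine Eq.trans h3 (map_zero _)
      have h5 := InnerProductSpace.norm_rankOne (𝕜 := ℂ) (f i) (f i)
      rw [h4, norm_zero, hf, one_mul] at h5
      exact zero_ne_one h5
  -- For every `y` the difference `y - j (ε y)` lies in the range of `F`, and on the kernel of `ε`
  -- this difference is `y`.
  have hrange : ∀ y, ε y = 0 → y ∈ F.range := fun y hy => by
    obtain ⟨a, b, rfl⟩ := exists_of_sub_of y
    obtain ⟨p, rfl⟩ := exists_cls a
    obtain ⟨q, rfl⟩ := exists_cls b
    have h1 := F.range.sub_mem (hsurj p) (hsurj q)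
    rwa [sub_sub_sub_comm, ← map_sub j, ← map_sub ε, hy, map_zero, sub_zero] at h1
  let F' : (ι →₀ ℤ) →+ K0 (CompactSum H) := F.codRestrict (K0 (CompactSum H)) fun x => (K0_eq_ker (CompactSum H)).2 (hεF x)
  refine ⟨(AddEquiv.ofBijective F' ⟨?_, ?_⟩).symm⟩
  · rw [injective_iff_map_eq_zero]
    exact fun x hx => hinj x (congrArg Subtype.val hx)
  · rintro ⟨y, hy⟩
    obtain ⟨x, hx⟩ := hrange y ((K0_eq_ker (CompactSum H)).1 hy)
    exact ⟨x, Subtype.ext hx⟩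

end K0Compact

end TwistedCStar
end

/-! ### Assembly of the isomorphisms -/

noncomputable section

namespace TwistedCStar

/-- `K_0` of the twisted group algebra of `T × Π_T`. -/
theorem nonempty_K0_groupCStar {κ : ℤ →+ ℤ} (hκ : κ ≠ 0) :
    Nonempty (K0 (GroupCStar (tau κ) haarTPi) ≃+ ((ℤ ⧸ κ.range) →₀ ℤ)) := by
  classical
  let _ := finite_quotient_range hκ
  let _ : Fintype (ℤ ⧸ κ.range) := Fintype.ofFinite _
  have (c : ℤ ⧸ κ.range) : Nontrivial (V κ c).H := by
    obtain ⟨l⟩ := nonempty_weights c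
    refine nontrivial_of_ne (basisVec l) 0 fun h => ?_
    have := norm_basisVec l
    rw [h, norm_zero] at this
    exact zero_ne_one this
  obtain ⟨Ψ, -⟩ := exists_starAlgEquiv_compactOps hκ
  obtain ⟨e⟩ := nonempty_K0_addEquiv Ψ
  obtain ⟨e'⟩ := nonempty_K0_C0Sum_compactOps (H := fun c => (V κ c).H)
  exact ⟨e.trans e'⟩

end TwistedCStar
end

open TwistedCStar in
theorem mainTheorem7 (κ : ℤ →+ ℤ) (hκ : κ ≠ 0) :
    (∃ Φ : GroupCStar (1 : Cocycle (CentralExt (tau κ))) (CentralExt.measure (tau κ) haarTPi)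
          ≃⋆ₐ[ℂ] C0Sum (fun n : ℤ => GroupCStar (tau (n • κ)) haarTPi),
        ∀ (f : C_c(CentralExt (tau κ), ℂ)) (n : ℤ),
          C0Sum.proj n (Φ (toCStar 1 (CentralExt.measure (tau κ) haarTPi) f)) =
            toCStar (tau (n • κ)) haarTPi (component (tau κ) n f)) ∧
    (∀ n : ℤ, n ≠ 0 →
      ∃ Ψ : GroupCStar (tau (n • κ)) haarTPi
          ≃⋆ₐ[ℂ] C0Sum (fun c : ℤ ⧸ (n • κ).range => CompactOps (V (n • κ) c).H),
        ∀ (f : C_c(TPi, ℂ)) (c : ℤ ⧸ (n • κ).range),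
          (C0Sum.proj c (Ψ (toCStar (tau (n • κ)) haarTPi f))).toCLM =
            (V (n • κ) c).integrated haarTPi f) ∧
    Nonempty (GroupCStar (tau ((0 : ℤ) • κ)) haarTPi ≃⋆ₐ[ℂ] C₀(Multiplicative ℤ × Circle, ℂ)) ∧
    Nonempty (K0 (GroupCStar (tau κ) haarTPi) ≃+ ((ℤ ⧸ κ.range) →₀ ℤ)) ∧
    (∃ e : ((ℤ ⧸ κ.range) →₀ ℤ) ≃+ RTau κ,
      ∀ c : ℤ ⧸ κ.range, ∃ h : FiniteMult (V κ c),
        e (Finsupp.single c 1) = RTau.mk κ (V κ c) h) := by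
  -- A homomorphism from `ℤ` is determined by its value at `1`, and `ℤ` has no zero divisors; so the
  -- decomposition into compact operators applies to each `n • κ`.
  have hn : ∀ n : ℤ, n ≠ 0 → n • κ ≠ 0 := fun n hn h => by
    have h1 : κ 1 ≠ 0 := fun h1 => hκ (AddMonoidHom.ext_int h1)
    have h2 : n * κ 1 = 0 := DFunLike.congr_fun h 1
    exact (mul_ne_zero hn h1) h2
  refine ⟨exists_starAlgEquiv_centralExt haarTPi (tau κ) (fun n => tau (n • κ)) (tau_zsmul κ),
    fun n h => exists_starAlgEquiv_compactOps (hn n h), ?_, nonempty_K0_groupCStar hκ,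
    exists_addEquiv_RTau hκ⟩
  rw [zero_smul]
  exact nonempty_starAlgEquiv_zeroAtInfty
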